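/- Let $d\ge 2$, let $\omega\subset\mathbb R^{d-1}$ be a bounded connected open set with Lipschitz boundary, and for $\varepsilon>0$ let $\Omega_\varepsilon=\omega\times(0,\varepsilon)\subset\mathbb R^d$. For $s\in(0,1)$, an open set $U\subset\mathbb R^d$ and a measurable $u:U\to\mathbb R$ write $$\lfloor u\rfloor_s^2(U)=\int_U\int_U\frac{|u(x)-u(y)|^2}{|x-y|^{d+2s}}\,dx\,dy\in[0,+\infty].$$ Let $\varepsilon_n>0$ with $\varepsilon_n\to0$, let $s_n\in(0,1)$ with $s_n\to s_0>\tfrac12$, and let $u_n:\Omega_{\varepsilon_n}\to\mathbb R$ be measurable functions such that $$\sup_n\frac{1-s_n}{\varepsilon_n^{3-2s_n}}\,\lfloor u_n\rfloor_{s_n}^2(\Omega_{\varepsilon_n})<+\infty.$$ Then there exist $u\in H^1(\omega)$, a subsequence $(u_{n_k})_k$ and constants $c_k\in\mathbb R$ such that $u_{n_k}+c_k$ dimension-reduction converges to $u$ locally in $L^1$; that is, the rescaled functions $v_k(x',x_d)=u_{n_k}(x',\varepsilon_{n_k}x_d)+c_k$, defined for $(x',x_d)\in\omega\times(0,1)$,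 belong to $L^1_{\rm loc}(\omega\times(0,1))$ and satisfy $$\lim_{k\to\infty}\int_K|v_k(x',x_d)-u(x')|\,dx'\,dx_d=0\qquad\text{for every compact } K\subset\omega\times(0,1).$$ -/

import Mathlib

open MeasureTheory Set Filter Topology
open scoped NNReal ENNReal

/-- `ω ⊆ ℝ^m` has Lipschitz boundary: near each boundary point `x₀` there are a direction `e` and a
Lipschitz function `γ` of the component orthogonal to `e` such that `ω` is, inside a ball around
`x₀`, the region above the graph of `γ` in the direction `e`. -/
def HasLipschitzBoundary {m : ℕ} (ω : Set (EuclideanSpace ℝ (Fin m))) : Prop :=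
  ∀ x₀ ∈ frontier ω, ∃ (e : EuclideanSpace ℝ (Fin m)) (L : ℝ≥0)
    (γ : EuclideanSpace ℝ (Fin m) → ℝ) (r : ℝ),
    ‖e‖ = 1 ∧ LipschitzWith L γ ∧ 0 < r ∧
      ∀ y ∈ Metric.ball x₀ r, (y ∈ ω ↔ γ (y - (inner ℝ e y) • e) < inner ℝ e y)

/-- `g` is the weak `i`-th partial derivative of `u` on the open set `ω`. -/
def HasWeakPartialDeriv {m : ℕ} (ω : Set (EuclideanSpace ℝ (Fin m))) (i : Fin m)
    (u g : EuclideanSpace ℝ (Fin m) → ℝ) : Prop :=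
  ∀ φ : EuclideanSpace ℝ (Fin m) → ℝ, ContDiff ℝ (⊤ : ℕ∞) φ → HasCompactSupport φ → tsupport φ ⊆ ω →
    ∫ x in ω, u x * fderiv ℝ φ x (EuclideanSpace.single i 1) = -∫ x in ω, g x * φ x

/-- `u ∈ H¹(ω)`: `u ∈ L²(ω)`, and all its weak first derivatives exist and lie in `L²(ω)`. -/
def MemH1 {m : ℕ} (ω : Set (EuclideanSpace ℝ (Fin m))) (u : EuclideanSpace ℝ (Fin m) → ℝ) :
    Prop :=
  MemLp u 2 (volume.restrict ω) ∧
    ∀ i : Fin m, ∃ g : EuclideanSpace ℝ (Fin m) → ℝ,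
      MemLp g 2 (volume.restrict ω) ∧ HasWeakPartialDeriv ω i u g

/-- The squared Gagliardo seminorm
`∫_U ∫_U |u(x) - u(y)|² / |x - y|^(d+2s) dx dy`, with values in `[0, ∞]`. -/
noncomputable def gagliardoSq {d : ℕ} (s : ℝ) (U : Set (EuclideanSpace ℝ (Fin d)))
    (u : EuclideanSpace ℝ (Fin d) → ℝ) : ℝ≥0∞ :=
  ∫⁻ x in U, ∫⁻ y in U, ENNReal.ofReal (|u x - u y| ^ 2 / ‖x - y‖ ^ ((d : ℝ) + 2 * s))

/-- The planar part `x' = (x₁, …, x_m)` of a point `x ∈ ℝ^(m+1)`. -/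
def planar {m : ℕ} (x : EuclideanSpace ℝ (Fin (m + 1))) : EuclideanSpace ℝ (Fin m) :=
  WithLp.toLp 2 fun i => x i.castSucc

/-- The point `(x', t) ∈ ℝ^(m+1)` with planar part `x'` and last coordinate `t`. -/
def withHeight {m : ℕ} (x' : EuclideanSpace ℝ (Fin m)) (t : ℝ) :
    EuclideanSpace ℝ (Fin (m + 1)) :=
  WithLp.toLp 2 (Fin.snoc (α := fun _ => ℝ) (fun i => x' i) t)

/-- The thin film `ω × (0, ε) ⊆ ℝ^(m+1)`. -/
def thinFilm {m : ℕ} (ω : Set (EuclideanSpace ℝ (Fin m))) (ε : ℝ) :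
    Set (EuclideanSpace ℝ (Fin (m + 1))) :=
  {x | planar x ∈ ω ∧ x (Fin.last m) ∈ Ioo 0 ε}

/-- The rescaled function `v(x', x_d) = u(x', ε x_d)`. -/
def rescale {m : ℕ} (ε : ℝ) (u : EuclideanSpace ℝ (Fin (m + 1)) → ℝ) :
    EuclideanSpace ℝ (Fin (m + 1)) → ℝ :=
  fun x => u (withHeight (planar x) (ε * x (Fin.last m)))

/-- Dimension-reduction convergence, locally in `L¹`, of functions `u j` on `ω × (0, ε j)` to a
function `u₀` on `ω`: the rescaled functions converge in `L¹_loc(ω × (0, 1))` to the function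
`x ↦ u₀ x'`, which does not depend on the last variable. -/
def DRConvergesL1Loc {m : ℕ} (ω : Set (EuclideanSpace ℝ (Fin m))) (ε : ℕ → ℝ)
    (u : ℕ → EuclideanSpace ℝ (Fin (m + 1)) → ℝ) (u₀ : EuclideanSpace ℝ (Fin m) → ℝ) : Prop :=
  (∀ j, LocallyIntegrableOn (rescale (ε j) (u j)) (thinFilm ω 1)) ∧
    LocallyIntegrableOn u₀ ω ∧
    ∀ K : Set (EuclideanSpace ℝ (Fin (m + 1))), IsCompact K → K ⊆ thinFilm ω 1 →
      Tendsto (fun j => ∫⁻ x in K, ‖rescale (ε j) (u j) x - u₀ (planar x)‖ₑ) atTop (𝓝 0)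

/-! Put `d = m + 1`, and let `I(R)` be the integral of `|u p - u q|²` over pairs at distance less
than `R`, with `p` kept away from the lateral boundary. Cutting each segment into `2^k` equal pieces
and telescoping bounds `I(R)` by `2^(k(d+2))` times the energy of increments of length below
`R/2^k`. With the weights `4^(k(s-1))` these factors become `2^(k(d+2s))`. Summed over `k` they are
dominated by the Gagliardo kernel, while the left side becomes `I(R) / (1 - 4^(s-1))`, at least of
order `I(R) / (1-s)`. Hence `I(R) ≤ 6 (1-s) R^(d+2s)` times the Gagliardo energy, uniformly in `s`
(`lintegral_ball_pairs_le_gagliardo`). For `R = 2ε` the normalization in the hypothesis is exactly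
what gives `O(ε^(m+2))` after the height is rescaled to 1 (`lintegral_rescaled_pairs_le`).

By Jensen the vertical averages `f n` inherit this estimate, and the rescaled functions differ from
them by `O(ε n)` in `L²` on interior sets. Splitting a translation `h` into steps of length at most
`ε n / 2` gives an `L²` modulus of continuity `M (‖h‖ + ε n)` (`lintegral_translate_le`). It implies
a Poincaré inequality on balls; connectedness of `ω` then yields local `L²` bounds once constants
are added. A Kolmogorov–Riesz argument provides a subsequence converging in `L²` on interior sets:
averages over balls of a fixed radius are asymptotically equicontinuous and converge at a dense set
of centres, and for small radii they are close to the functions.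

In the limit the offset `ε n` disappears, so translating `u₀` by `h` costs at most `M ‖h‖`. Pushing
points inward across the Lipschitz boundary turns this into square integrability on all of `ω`
(`lintegral_sq_ne_top_of_lipschitz`). The same estimate bounds `φ ↦ ∫ u₀ ∂ᵢφ` by the `L²` norm of
`φ`, and Riesz representation produces the weak derivatives (`exists_hasWeakPartialDeriv`). -/

/-! ### Squares of extended norms. -/

theorem enorm_sq_eq_ofReal (x : ℝ) : ‖x‖ₑ ^ 2 = ENNReal.ofReal (x ^ 2) := by
  rw [Real.enorm_eq_ofReal_abs, ← ENNReal.ofReal_pow (abs_nonneg x), sq_abs]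

theorem enorm_sq_telescope_le (f : ℕ → ℝ) (N : ℕ) :
    ‖f N - f 0‖ₑ ^ 2 ≤ N * ∑ i ∈ Finset.range N, ‖f (i + 1) - f i‖ₑ ^ 2 := by
  simp only [enorm_sq_eq_ofReal]
  rw [← ENNReal.ofReal_sum_of_nonneg (fun i _ => sq_nonneg _), ← Finset.sum_range_sub f,
    ← ENNReal.ofReal_natCast, ← ENNReal.ofReal_mul (Nat.cast_nonneg _)]
  refine ENNReal.ofReal_le_ofReal ?_
  simpa using sq_sum_le_card_mul_sum_sq (s := Finset.range N) (f := fun i => f (i + 1) - f i)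

theorem enorm_add_sq_le (a b : ℝ) : ‖a + b‖ₑ ^ 2 ≤ 2 * ‖a‖ₑ ^ 2 + 2 * ‖b‖ₑ ^ 2 := by
  simp only [enorm_sq_eq_ofReal]
  rw [show (2 : ℝ≥0∞) = ENNReal.ofReal 2 by simp, ← ENNReal.ofReal_mul (by norm_num),
    ← ENNReal.ofReal_mul (by norm_num), ← ENNReal.ofReal_add (by positivity) (by positivity)]
  exact ENNReal.ofReal_le_ofReal (by nlinarith [sq_nonneg (a - b)])

/-! ### Telescoping of translation differences. -/

section Chain

variable {W : Type*} [NormedAddCommGroup W] [MeasurableSpace W] [BorelSpace W]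
  (μ : Measure W) [μ.IsAddRightInvariant]

theorem setLIntegral_add_right_le {F : W → ℝ≥0∞} {A B : Set W}
    {h : W} (hAB : ∀ x ∈ A, x + h ∈ B) :
    ∫⁻ x in A, F (x + h) ∂μ ≤ ∫⁻ x in B, F x ∂μ := by
  have hpre : ∫⁻ x in (fun x => x + h) ⁻¹' B, F (x + h) ∂μ = ∫⁻ x in B, F x ∂μ :=
    (measurePreserving_add_right μ h).setLIntegral_comp_preimage_emb
      (MeasurableEquiv.addRight h).measurableEmbedding F B
  rw [← hpre]
  exact lintegral_mono_set hAB

/-- Telescoping along a segment of `N` equal steps. -/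
theorem setLIntegral_enorm_sub_sq_chain_le {f : W → ℝ} (hf : Measurable f) {A B : Set W}
    (N : ℕ) (h : W)
    (hAB : ∀ x ∈ A, ∀ i < N, x + i • h ∈ B) :
    ∫⁻ x in A, ‖f (x + N • h) - f x‖ₑ ^ 2 ∂μ ≤
      (N : ℝ≥0∞) ^ 2 * ∫⁻ x in B, ‖f (x + h) - f x‖ₑ ^ 2 ∂μ := by
  have hm : ∀ a b : W, Measurable fun x => ‖f (x + a) - f (x + b)‖ₑ ^ 2 := fun a b =>
    (((hf.comp (measurable_add_const a)).sub (hf.comp (measurable_add_const b))).enorm).pow_const 2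
  calc ∫⁻ x in A, ‖f (x + N • h) - f x‖ₑ ^ 2 ∂μ
      ≤ ∫⁻ x in A, N * ∑ i ∈ Finset.range N,
          ‖f (x + (i + 1) • h) - f (x + i • h)‖ₑ ^ 2 ∂μ := by
        refine lintegral_mono fun x => ?_
        simpa using enorm_sq_telescope_le (fun i => f (x + i • h)) N
    _ = N * ∑ i ∈ Finset.range N,
          ∫⁻ x in A, ‖f (x + (i + 1) • h) - f (x + i • h)‖ₑ ^ 2 ∂μ := by
        rw [lintegral_const_mul _ (Finset.measurable_fun_sum _ fun i _ => hm _ _),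
          lintegral_finsetSum _ fun i _ => hm _ _]
    _ ≤ N * ∑ i ∈ Finset.range N, ∫⁻ x in B, ‖f (x + h) - f x‖ₑ ^ 2 ∂μ := by
        refine mul_le_mul' le_rfl (Finset.sum_le_sum fun i hi => ?_)
        -- The `i`-th increment is the first one translated by `i • h`, and `hAB` keeps the
        -- translated point in `B`.
        have := setLIntegral_add_right_le μ (F := fun x => ‖f (x + h) - f x‖ₑ ^ 2) (B := B)
          (h := i • h) (A := A) (fun x hx => hAB x hx i (Finset.mem_range.1 hi))
        simpa only [add_smul, one_smul, add_assoc] using this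
    _ = _ := by
        rw [Finset.sum_const, Finset.card_range, nsmul_eq_mul, ← mul_assoc, sq]

end Chain

/-- A truncated geometric sum is dominated by its last term. -/
theorem sum_range_geom_indicator_le {a α : ℝ} (ha : 0 < a) (hα : 1 ≤ α) (K : ℕ) :
    ∑ k ∈ Finset.range K, (if 2 ^ k * a < 1 then ((2 : ℝ) ^ α) ^ k else 0) ≤ 2 * a ^ (-α) := by
  set q : ℝ := (2 : ℝ) ^ α with hq
  have hq2 : 2 ≤ q := by
    calc (2 : ℝ) = 2 ^ (1 : ℝ) := by simp
      _ ≤ q := Real.rpow_le_rpow_of_exponent_le (by norm_num) hα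
  -- Since `α ≥ 1` the ratio is at least 2, so a geometric sum is at most twice its last term.
  have hgeom : ∀ K : ℕ, ∑ k ∈ Finset.range (K + 1), q ^ k ≤ 2 * q ^ K := by
    intro K
    induction K with
    | zero => simp
    | succ K ih =>
      rw [Finset.sum_range_succ, pow_succ]
      nlinarith [pow_pos (show 0 < q by linarith) K]
  induction K with
  | zero => simp; positivity
  | succ K ih =>
    -- If the top index is active, every indicator may be replaced by 1 and `2 ^ K ≤ a⁻¹` bounds the
    -- last term. Otherwise the last term vanishes.
    by_cases hK : 2 ^ K * a < 1
    · calc _ ≤ ∑ k ∈ Finset.range (K + 1), q ^ k := by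
            refine Finset.sum_le_sum fun k _ => ?_
            split_ifs
            · exact le_rfl
            · positivity
        _ ≤ 2 * q ^ K := hgeom K
        _ ≤ 2 * a ^ (-α) := by
            gcongr
            have h2 : (2 : ℝ) ^ K ≤ a⁻¹ := by
              rw [le_inv_comm₀ (by positivity) ha, ← one_div, le_div_iff₀ (by positivity)]
              linarith
            rw [hq, ← Real.rpow_natCast, ← Real.rpow_mul (by norm_num), mul_comm, Real.rpow_mul
              (by norm_num), Real.rpow_natCast, Real.rpow_neg ha.le, ← Real.inv_rpow ha.le]
            exact Real.rpow_le_rpow (by positivity) h2 (by linarith)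
    · rw [Finset.sum_range_succ, if_neg hK, add_zero]
      exact ih

/-- The tangent line inequality for `exp` gives the bound `(1 - s) log 4`. This is the source of the
factor `1 - s` in front of the Gagliardo energy. -/
theorem one_sub_four_rpow_le (s : ℝ) : 1 - (4 : ℝ) ^ (s - 1) ≤ 3 * |1 - s| := by
  have h : (4 : ℝ) ^ (s - 1) = Real.exp (Real.log 4 * (s - 1)) :=
    Real.rpow_def_of_pos (by norm_num) _
  have h1 := Real.add_one_le_exp (Real.log 4 * (s - 1))
  have h2 : Real.log 4 ≤ 3 := by
    have := Real.log_le_sub_one_of_pos (show (0 : ℝ) < 4 by norm_num)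
    linarith
  have h3 : 0 ≤ Real.log 4 := Real.log_nonneg (by norm_num)
  rw [h]
  nlinarith [le_abs_self (1 - s), abs_nonneg (1 - s)]

/-! ### Nonlocal energy at a fixed scale versus the Gagliardo energy. -/

section SmallScale

variable {W : Type*} [NormedAddCommGroup W] [NormedSpace ℝ W] [FiniteDimensional ℝ W]
  [MeasurableSpace W] [BorelSpace W] (μ : Measure W) [μ.IsAddHaarMeasure]

theorem setLIntegral_ball_comp_smul (F : W → ℝ≥0∞) (R : ℝ) {c : ℝ} (hc : 0 < c) :
    ∫⁻ h in Metric.ball 0 R, F (c⁻¹ • h) ∂μ =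
      ENNReal.ofReal (c ^ Module.finrank ℝ W) * ∫⁻ h in Metric.ball 0 (R / c), F h ∂μ := by
  have hpre : (fun h : W => c⁻¹ • h) ⁻¹' Metric.ball 0 (R / c) = Metric.ball 0 R := by
    ext h
    simp only [mem_preimage, mem_ball_zero_iff, norm_smul, norm_inv, Real.norm_eq_abs,
      abs_of_pos hc]
    rw [inv_mul_eq_div, div_lt_div_iff_of_pos_right hc]
  have hemb : MeasurableEmbedding fun h : W => c⁻¹ • h :=
    (Homeomorph.smulOfNeZero c⁻¹ (inv_ne_zero hc.ne')).measurableEmbedding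
  rw [← hpre, ← hemb.lintegral_map, ← hemb.restrict_map, Measure.map_addHaar_smul μ
      (inv_ne_zero hc.ne'),
    Measure.restrict_smul, lintegral_smul_measure, smul_eq_mul]
  congr 2
  rw [inv_pow, inv_inv, abs_of_pos (by positivity)]

/-- The increments `p ↦ u (p + h) - u p`, as far as `p` and `p + h` belong to `B`. -/
noncomputable def incrementEnergy (B : Set W) (u : W → ℝ) (h : W) : ℝ≥0∞ :=
  ∫⁻ p, (B ∩ (fun p => p + h) ⁻¹' B).indicator (fun p => ‖u (p + h) - u p‖ₑ ^ 2) p ∂μ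

variable {u : W → ℝ} (hu : Measurable u) {A B : Set W}
include hu

theorem measurable_increment (hA : MeasurableSet A) (hB : MeasurableSet B) :
    Measurable fun z : W × W =>
      (A ∩ (fun p => p + z.2) ⁻¹' B).indicator (fun p => ‖u (p + z.2) - u p‖ₑ ^ 2) z.1 := by
  have hs : MeasurableSet {z : W × W | z.1 ∈ A ∧ z.1 + z.2 ∈ B} :=
    (measurable_fst hA).inter ((measurable_fst.add measurable_snd) hB)
  have : Measurable fun z : W × W => ‖u (z.1 + z.2) - u z.1‖ₑ ^ 2 :=
    (((hu.comp (measurable_fst.add measurable_snd)).sub (hu.comp measurable_fst)).enorm).pow_const 2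
  exact this.indicator hs

theorem measurable_incrementEnergy (hB : MeasurableSet B) :
    Measurable (incrementEnergy μ B u) :=
  (measurable_increment hu hB hB).lintegral_prod_left'

/-- Substitution `q = p + h` and Tonelli. In terms of increments, telescoping acts on `p` and
dilation on `h`. -/
theorem lintegral_ball_pairs_eq (hA : MeasurableSet A) (hB : MeasurableSet B) (R : ℝ) :
    ∫⁻ p in A, ∫⁻ q in B ∩ Metric.ball p R, ‖u p - u q‖ₑ ^ 2 ∂μ ∂μ =
      ∫⁻ h in Metric.ball 0 R, ∫⁻ p, (A ∩ (fun p => p + h) ⁻¹' B).indicator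
        (fun p => ‖u (p + h) - u p‖ₑ ^ 2) p ∂μ ∂μ := by
  have h1 : ∀ p, ∫⁻ q in B ∩ Metric.ball p R, ‖u p - u q‖ₑ ^ 2 ∂μ =
      ∫⁻ h in Metric.ball 0 R, ((fun p => p + h) ⁻¹' B).indicator
        (fun p => ‖u (p + h) - u p‖ₑ ^ 2) p ∂μ := by
    intro p
    rw [← lintegral_indicator (hB.inter measurableSet_ball),
      ← lintegral_add_left_eq_self _ p, ← lintegral_indicator measurableSet_ball]
    refine lintegral_congr fun h => ?_
    by_cases h1 : p + h ∈ B <;> by_cases h2 : ‖h‖ < R <;>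
      simp [indicator, h1, h2, enorm_sq_eq_ofReal, sub_sq_comm (u p)]
  simp_rw [h1]
  rw [← lintegral_indicator hA]
  rw [← lintegral_lintegral_swap (measurable_increment hu hA hB).aemeasurable]
  refine lintegral_congr fun p => ?_
  simp only [← indicator_indicator]
  by_cases hp : p ∈ A
  · simp only [indicator_of_mem hp]
  · simp only [indicator_of_notMem hp, lintegral_zero]

/-- Each increment `h` is cut into `N` steps `h / N`. Telescoping costs `N ^ 2` and the change of
variables in `h` costs `N` to the dimension; `hseg` keeps the intermediate points in `B`. -/
theorem lintegral_ball_pairs_le_scaled (hA : MeasurableSet A) (hB : MeasurableSet B) {R : ℝ}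
    (hseg : ∀ p ∈ A, ∀ q ∈ B, dist q p < R → segment ℝ p q ⊆ B) {N : ℕ} (hN : 0 < N) :
    ∫⁻ p in A, ∫⁻ q in B ∩ Metric.ball p R, ‖u p - u q‖ₑ ^ 2 ∂μ ∂μ ≤
      (N : ℝ≥0∞) ^ (Module.finrank ℝ W + 2) *
        ∫⁻ h in Metric.ball 0 (R / N), incrementEnergy μ B u h ∂μ := by
  have hN' : (0 : ℝ) < N := Nat.cast_pos.2 hN
  rw [lintegral_ball_pairs_eq μ hu hA hB]
  calc _ ≤ ∫⁻ h in Metric.ball 0 R, (N : ℝ≥0∞) ^ 2 * incrementEnergy μ B u ((N : ℝ)⁻¹ • h) ∂μ := by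
        refine setLIntegral_mono' measurableSet_ball fun h hh => ?_
        have hNh : N • ((N : ℝ)⁻¹ • h) = h := by
          rw [← Nat.cast_smul_eq_nsmul ℝ, smul_smul, mul_inv_cancel₀ hN'.ne', one_smul]
        have hpre : ∀ g : W, MeasurableSet ((fun p => p + g) ⁻¹' B) := fun g =>
          measurable_add_const g hB
        rw [incrementEnergy, lintegral_indicator (hA.inter (hpre _)),
          lintegral_indicator (hB.inter (hpre _))]
        have := setLIntegral_enorm_sub_sq_chain_le μ hu (A := A ∩ (fun p => p + h) ⁻¹' B)
          (B := B ∩ (fun p => p + (N : ℝ)⁻¹ • h) ⁻¹' B) N ((N : ℝ)⁻¹ • h) ?_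
        · rwa [hNh] at this
        rintro x ⟨hxA, hxB⟩ i hi
        have hmem : ∀ j : ℕ, j ≤ N → x + j • ((N : ℝ)⁻¹ • h) ∈ B := by
          intro j hj
          refine hseg x hxA (x + h) hxB (by simpa using hh) ?_
          rw [segment_eq_image']
          refine ⟨j / N, ⟨by positivity, div_le_one_of_le₀ (by exact_mod_cast hj) hN'.le⟩, ?_⟩
          simp only [add_sub_cancel_left, ← Nat.cast_smul_eq_nsmul ℝ, smul_smul, div_eq_mul_inv]
        refine ⟨hmem i hi.le, ?_⟩
        have := hmem (i + 1) hi
        rwa [add_smul, one_smul, ← add_assoc] at this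
    _ = _ := by
        rw [lintegral_const_mul' _ _ (by simp), setLIntegral_ball_comp_smul μ _ R hN', ← mul_assoc]
        congr 1
        rw [ENNReal.ofReal_pow hN'.le, ENNReal.ofReal_natCast, ← pow_add, add_comm]

/-- The nonlocal energy at scale `R` is controlled by the Gagliardo energy, uniformly as `s → 1`. -/
theorem lintegral_ball_pairs_le_gagliardo (hA : MeasurableSet A) (hB : MeasurableSet B) {R s : ℝ}
    (hR : 0 < R) (hs : s ∈ Ioo (0 : ℝ) 1) (hd : 1 ≤ Module.finrank ℝ W)
    (hseg : ∀ p ∈ A, ∀ q ∈ B, dist q p < R → segment ℝ p q ⊆ B) :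
    ∫⁻ p in A, ∫⁻ q in B ∩ Metric.ball p R, ‖u p - u q‖ₑ ^ 2 ∂μ ∂μ ≤
      ENNReal.ofReal (6 * (1 - s) * R ^ ((Module.finrank ℝ W : ℝ) + 2 * s)) *
        ∫⁻ x in B, ∫⁻ y in B,
          ENNReal.ofReal (|u x - u y| ^ 2 / ‖x - y‖ ^
              ((Module.finrank ℝ W : ℝ) + 2 * s)) ∂μ ∂μ := by
  set d := Module.finrank ℝ W with hdd
  set α : ℝ := (d : ℝ) + 2 * s with hα
  have hd1 : (1 : ℝ) ≤ d := by exact_mod_cast hd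
  have hα1 : 1 ≤ α := by linarith [hs.1]
  set I := ∫⁻ p in A, ∫⁻ q in B ∩ Metric.ball p R, ‖u p - u q‖ₑ ^ 2 ∂μ ∂μ with hI
  set Φ := incrementEnergy μ B u with hΦ
  have hΦm : Measurable Φ := measurable_incrementEnergy μ hu hB
  -- This ratio satisfies `r ^ k * (2 ^ k) ^ (d + 2) = (2 ^ α) ^ k`, so the weighted dyadic scales
  -- carry the exponent of the Gagliardo kernel.
  set r : ℝ := (4 : ℝ) ^ (s - 1) with hr
  have hr0 : 0 < r := by positivity
  have hr1 : r < 1 := Real.rpow_lt_one_of_one_lt_of_neg (by norm_num) (by linarith [hs.2])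
  have hterm : ∀ k : ℕ, ENNReal.ofReal r ^ k * I ≤
      ∫⁻ h, ENNReal.ofReal (if 2 ^ k * (‖h‖ / R) < 1 then ((2 : ℝ) ^ α) ^ k else 0) * Φ h ∂μ := by
    intro k
    have h1 := lintegral_ball_pairs_le_scaled μ hu hA hB hseg (N := 2 ^ k) (by positivity)
    calc _ ≤ ENNReal.ofReal r ^ k * (((2 ^ k : ℕ) : ℝ≥0∞) ^ (d + 2) *
          ∫⁻ h in Metric.ball 0 (R / (2 ^ k : ℕ)), Φ h ∂μ) := by gcongr
      _ = ∫⁻ h in Metric.ball 0 (R / (2 ^ k : ℕ)), ENNReal.ofReal (((2 : ℝ) ^ α) ^ k) * Φ h ∂μ := by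
          rw [lintegral_const_mul _ hΦm, ← mul_assoc]
          congr 1
          rw [← ENNReal.ofReal_natCast, ← ENNReal.ofReal_pow hr0.le,
            ← ENNReal.ofReal_pow (by positivity), ← ENNReal.ofReal_mul (by positivity)]
          congr 1
          rw [hr, show (4 : ℝ) = 2 ^ (2 : ℝ) by norm_num, ← Real.rpow_mul (by norm_num)]
          push_cast
          rw [← pow_mul, mul_comm k, pow_mul, ← mul_pow]
          congr 1
          rw [← Real.rpow_natCast, ← Real.rpow_add (by norm_num), hα]
          congr 1
          push_cast
          ring
      _ ≤ _ := by
          rw [← lintegral_indicator measurableSet_ball]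
          refine lintegral_mono fun h => ?_
          by_cases hh : h ∈ Metric.ball 0 (R / (2 ^ k : ℕ))
          · rw [indicator_of_mem hh, if_pos]
            rw [mem_ball_zero_iff, lt_div_iff₀ (by positivity)] at hh
            push_cast at hh
            rw [← mul_div_assoc, div_lt_one hR]
            linarith
          · rw [indicator_of_notMem hh]
            exact zero_le
  -- On the left the sum is `1 / (1 - r)`. On the right, only the scales with `2 ^ k * ‖h‖ < R`
  -- contribute at `h`, and the last of them dominates.
  have hsum : (∑' k : ℕ, ENNReal.ofReal r ^ k) * I ≤
      ∫⁻ h, ENNReal.ofReal (2 * (‖h‖ / R) ^ (-α)) * Φ h ∂μ := by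
    rw [← ENNReal.tsum_mul_right]
    calc _ ≤ ∑' k : ℕ, ∫⁻ h, ENNReal.ofReal
          (if 2 ^ k * (‖h‖ / R) < 1 then ((2 : ℝ) ^ α) ^ k else 0) * Φ h ∂μ :=
          ENNReal.tsum_le_tsum hterm
      _ = ∫⁻ h, ∑' k : ℕ, ENNReal.ofReal
          (if 2 ^ k * (‖h‖ / R) < 1 then ((2 : ℝ) ^ α) ^ k else 0) * Φ h ∂μ := by
          rw [lintegral_tsum]
          intro k
          refine ((ENNReal.measurable_ofReal.comp (Measurable.ite ?_ measurable_const
            measurable_const)).mul hΦm).aemeasurable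
          exact measurableSet_lt (by fun_prop) measurable_const
      _ ≤ _ := by
          refine lintegral_mono fun h => ?_
          simp only
          rw [ENNReal.tsum_mul_right]
          -- At `h = 0` the real power `(‖h‖ / R) ^ (-α)` takes the value 0 and bounds nothing, but
          -- the increments vanish there.
          rcases eq_or_ne h 0 with rfl | hh
          · simp [hΦ, incrementEnergy]
          gcongr
          refine ENNReal.tsum_le_of_sum_range_le fun K => ?_
          rw [← ENNReal.ofReal_sum_of_nonneg fun i _ => by positivity]
          exact ENNReal.ofReal_le_ofReal (sum_range_geom_indicator_le (by positivity) hα1 K)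
  have hgag : ∫⁻ x in B, ∫⁻ y in B, ENNReal.ofReal (|u x - u y| ^ 2 / ‖x - y‖ ^ α) ∂μ ∂μ =
      ∫⁻ h, ENNReal.ofReal (‖h‖ ^ (-α)) * Φ h ∂μ := by
    have hk : ∀ h : W, ∀ a b : ℝ, ENNReal.ofReal (|a - b| ^ 2 / ‖h‖ ^ α) =
        ENNReal.ofReal (‖h‖ ^ (-α)) * ‖b - a‖ₑ ^ 2 := by
      intro h a b
      rw [enorm_sq_eq_ofReal, ← ENNReal.ofReal_mul (by positivity), Real.rpow_neg (norm_nonneg _),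
        sq_abs, sub_sq_comm, div_eq_inv_mul]
    have h1 : ∀ x, ∫⁻ y in B, ENNReal.ofReal (|u x - u y| ^ 2 / ‖x - y‖ ^ α) ∂μ =
        ∫⁻ h, ENNReal.ofReal (‖h‖ ^ (-α)) * ((fun p => p + h) ⁻¹' B).indicator
          (fun p => ‖u (p + h) - u p‖ₑ ^ 2) x ∂μ := by
      intro x
      rw [← lintegral_indicator hB, ← lintegral_add_left_eq_self _ x]
      refine lintegral_congr fun h => ?_
      by_cases h1 : x + h ∈ B
      · rw [indicator_of_mem h1, indicator_of_mem (by exact h1), hk]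
        simp
      · rw [indicator_of_notMem h1, indicator_of_notMem (by exact h1), mul_zero]
    simp_rw [h1]
    have hker : Measurable fun h : W => ENNReal.ofReal (‖h‖ ^ (-α)) :=
      ENNReal.measurable_ofReal.comp (measurable_norm.pow_const _)
    rw [← lintegral_indicator hB]
    simp_rw [hΦ, incrementEnergy]
    have hmeas := measurable_increment hu hB hB
    calc _ = ∫⁻ x, ∫⁻ h, ENNReal.ofReal (‖h‖ ^ (-α)) * (B ∩ (fun p => p + h) ⁻¹' B).indicator
          (fun p => ‖u (p + h) - u p‖ₑ ^ 2) x ∂μ ∂μ := by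
          refine lintegral_congr fun p => ?_
          simp only [← indicator_indicator]
          by_cases hp : p ∈ B
          · simp only [indicator_of_mem hp]
          · simp only [indicator_of_notMem hp, lintegral_zero, mul_zero]
      _ = _ := by
          rw [lintegral_lintegral_swap ((hker.comp measurable_snd).mul hmeas).aemeasurable]
          refine lintegral_congr fun h => ?_
          exact lintegral_const_mul _ (hmeas.comp measurable_prodMk_right)
  have hRα : ∀ h : W, ENNReal.ofReal (2 * (‖h‖ / R) ^ (-α)) * Φ h =
      ENNReal.ofReal (2 * R ^ α) * (ENNReal.ofReal (‖h‖ ^ (-α)) * Φ h) := by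
    intro h
    rw [← mul_assoc, ← ENNReal.ofReal_mul (by positivity), Real.div_rpow (norm_nonneg _) hR.le,
      Real.rpow_neg hR.le, div_inv_eq_mul]
    congr 2
    ring
  simp_rw [hRα] at hsum
  rw [lintegral_const_mul' _ _ ENNReal.ofReal_ne_top, ← hgag, ENNReal.tsum_geometric,
    ← ENNReal.ofReal_one, ← ENNReal.ofReal_sub _ hr0.le] at hsum
  have h1r : 0 < 1 - r := by linarith
  rw [mul_comm, ← div_eq_mul_inv, ENNReal.div_le_iff_le_mul (Or.inl (by simpa using hr1))
    (Or.inl ENNReal.ofReal_ne_top), mul_comm, ← mul_assoc, ← ENNReal.ofReal_mul h1r.le] at hsum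
  refine hsum.trans ?_
  refine mul_le_mul' (ENNReal.ofReal_le_ofReal ?_) le_rfl
  have h3 := one_sub_four_rpow_le s
  rw [abs_of_pos (by linarith [hs.2])] at h3
  have : 0 < R ^ α := by positivity
  nlinarith

end SmallScale

/-! ### Square norms and Jensen's inequality. -/

theorem eLpNorm_two_sq {α : Type*} [MeasurableSpace α] (μ : Measure α) (f : α → ℝ) :
    eLpNorm f 2 μ ^ 2 = ∫⁻ x, ‖f x‖ₑ ^ 2 ∂μ := by
  rw [eLpNorm_eq_lintegral_rpow_enorm_toReal (by norm_num) (by norm_num)]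
  simp only [ENNReal.toReal_ofNat, ENNReal.rpow_ofNat]
  rw [← ENNReal.rpow_natCast, ← ENNReal.rpow_mul]
  norm_num

theorem memLp_two_of_lintegral_ne_top {α : Type*} [MeasurableSpace α] {μ : Measure α} {f : α → ℝ}
    (hf : AEStronglyMeasurable f μ) (h : ∫⁻ x, ‖f x‖ₑ ^ 2 ∂μ ≠ ∞) : MemLp f 2 μ := by
  refine ⟨hf, ?_⟩
  rw [← eLpNorm_two_sq] at h
  exact lt_top_iff_ne_top.2 fun h' => h (by simp [h'])

section Jensen

variable {α β : Type*} [MeasurableSpace α] [MeasurableSpace β]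
  (μ : Measure α) [IsProbabilityMeasure μ] (ν : Measure β) [IsProbabilityMeasure ν]

/-- Jensen for the square. Integrability of `p` need not be assumed: if the right side is finite, `p
- c` is square-integrable for a probability measure, hence integrable. -/
theorem enorm_integral_sub_sq_le {p : α → ℝ} (hp : AEStronglyMeasurable p μ) (c : ℝ) :
    ‖(∫ x, p x ∂μ) - c‖ₑ ^ 2 ≤ ∫⁻ x, ‖p x - c‖ₑ ^ 2 ∂μ := by
  by_cases h : ∫⁻ x, ‖p x - c‖ₑ ^ 2 ∂μ = ∞
  · simp [h]
  have hm : AEStronglyMeasurable (fun x => p x - c) μ := hp.sub aestronglyMeasurable_const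
  have hL : MemLp (fun x => p x - c) 2 μ := memLp_two_of_lintegral_ne_top hm h
  have hi : Integrable (fun x => p x - c) μ := hL.integrable (by norm_num)
  have hip : Integrable p μ := 
    (hi.add (integrable_const c)).congr (ae_of_all _ fun x => by simp)
  have h1 : (∫ x, p x ∂μ) - c = ∫ x, (p x - c) ∂μ := by
    rw [integral_sub hip (integrable_const c)]
    simp
  rw [h1, ← eLpNorm_two_sq]
  refine pow_le_pow_left' ((enorm_integral_le_lintegral_enorm _).trans ?_) 2
  rw [← eLpNorm_one_eq_lintegral_enorm]
  exact eLpNorm_le_eLpNorm_of_exponent_le (by norm_num) hm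

theorem enorm_integral_sub_integral_sq_le {p : α → ℝ} {q : β → ℝ}
    (hp : AEStronglyMeasurable p μ) (hq : AEStronglyMeasurable q ν) :
    ‖(∫ x, p x ∂μ) - ∫ y, q y ∂ν‖ₑ ^ 2 ≤ ∫⁻ x, ∫⁻ y, ‖p x - q y‖ₑ ^ 2 ∂ν ∂μ := by
  refine (enorm_integral_sub_sq_le μ hp _).trans (lintegral_mono fun x => ?_)
  have := enorm_integral_sub_sq_le ν hq (p x)
  simpa only [enorm_sq_eq_ofReal, sub_sq_comm] using this

/-- Up to the factor 4 the mean is the best constant: insert `c`, and control its distance to the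
mean by Jensen. -/
theorem lintegral_enorm_sub_integral_sq_le {p : α → ℝ} (hp : AEStronglyMeasurable p μ) (c : ℝ) :
    ∫⁻ x, ‖p x - ∫ y, p y ∂μ‖ₑ ^ 2 ∂μ ≤ 4 * ∫⁻ x, ‖p x - c‖ₑ ^ 2 ∂μ := by
  calc _ ≤ ∫⁻ x, (2 * ‖p x - c‖ₑ ^ 2 + 2 * ‖(∫ y, p y ∂μ) - c‖ₑ ^ 2) ∂μ := by
        refine lintegral_mono fun x => ?_
        have := enorm_add_sq_le (p x - c) (c - ∫ y, p y ∂μ)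
        rw [sub_add_sub_cancel] at this
        refine this.trans_eq ?_
        simp only [enorm_sq_eq_ofReal, sub_sq_comm c]
    _ = 2 * ∫⁻ x, ‖p x - c‖ₑ ^ 2 ∂μ + 2 * ‖(∫ y, p y ∂μ) - c‖ₑ ^ 2 := by
        rw [lintegral_add_right _ measurable_const, lintegral_const_mul' _ _ (by norm_num)]
        simp
    _ ≤ 2 * ∫⁻ x, ‖p x - c‖ₑ ^ 2 ∂μ + 2 * ∫⁻ x, ‖p x - c‖ₑ ^ 2 ∂μ := by
        gcongr
        exact enorm_integral_sub_sq_le μ hp c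
    _ = _ := by rw [← add_mul]; norm_num

end Jensen

/-! ### Interior sets at a given distance from the complement. -/

/-- The points of `ω` at distance at least `r` from the complement. -/
def innerCore {E : Type*} [PseudoMetricSpace E] (ω : Set E) (r : ℝ) : Set E :=
  (Metric.thickening r ωᶜ)ᶜ

section InnerCore

variable {E : Type*} [PseudoMetricSpace E] {ω : Set E}

theorem mem_innerCore_iff {r : ℝ} {x : E} : x ∈ innerCore ω r ↔ Metric.ball x r ⊆ ω := by
  simp only [innerCore, mem_compl_iff, Metric.mem_thickening_iff, not_exists, not_and, not_lt]
  constructor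
  · intro h y hy
    by_contra hyω
    rw [Metric.mem_ball'] at hy
    exact absurd (h y hyω) (not_le.2 hy)
  · intro h y hy
    by_contra hlt
    exact hy (h (Metric.mem_ball'.2 (not_le.1 hlt)))

theorem isClosed_innerCore (r : ℝ) : IsClosed (innerCore ω r) :=
  Metric.isOpen_thickening.isClosed_compl

theorem innerCore_anti {r r' : ℝ} (h : r ≤ r') : innerCore ω r' ⊆ innerCore ω r := fun _ hx =>
  mem_innerCore_iff.2 ((Metric.ball_subset_ball h).trans (mem_innerCore_iff.1 hx))

theorem innerCore_subset {r : ℝ} (hr : 0 < r) : innerCore ω r ⊆ ω := fun _ hx =>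
  mem_innerCore_iff.1 hx (Metric.mem_ball_self hr)

theorem mem_innerCore_of_dist {r r' : ℝ} {x y : E} (hx : x ∈ innerCore ω r)
    (h : r' + dist y x ≤ r) : y ∈ innerCore ω r' :=
  mem_innerCore_iff.2 ((Metric.ball_subset_ball' h).trans (mem_innerCore_iff.1 hx))

theorem isCompact_innerCore [ProperSpace E] (hω : Bornology.IsBounded ω) {r : ℝ} (hr : 0 < r) :
    IsCompact (innerCore ω r) :=
  Metric.isCompact_of_isClosed_isBounded (isClosed_innerCore r) (hω.subset (innerCore_subset hr))

theorem IsCompact.exists_subset_innerCore {K : Set E} (hK : IsCompact K) (hω : IsOpen ω)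
    (hKω : K ⊆ ω) : ∃ r > 0, K ⊆ innerCore ω r := by
  obtain ⟨r, hr, h⟩ := hK.exists_thickening_subset_open hω hKω
  exact ⟨r, hr, fun x hx => mem_innerCore_iff.2
    ((Metric.ball_subset_thickening hx r).trans h)⟩

theorem measurableSet_innerCore [MeasurableSpace E] [BorelSpace E] (r : ℝ) :
    MeasurableSet (innerCore ω r) := (isClosed_innerCore r).measurableSet

end InnerCore

/-! ### Averages over the unit interval. -/

section VerticalAverage

variable {E : Type*} [NormedAddCommGroup E] [NormedSpace ℝ E] [FiniteDimensional ℝ E]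
  [MeasureSpace E] [BorelSpace E] [(volume : Measure E).IsAddHaarMeasure]

instance isProbabilityMeasure_volume_restrict_Ioo_zero_one :
    IsProbabilityMeasure (volume.restrict (Ioo (0 : ℝ) 1)) := ⟨by simp⟩

/-- The average of `v x ·` over the unit interval. -/
noncomputable def verticalAverage (v : E × ℝ → ℝ) (x : E) : ℝ := ∫ t in Ioo (0 : ℝ) 1, v (x, t)

variable {v : E × ℝ → ℝ} (hv : Measurable v)
include hv

theorem measurable_verticalAverage : Measurable (verticalAverage v) :=
  (hv.stronglyMeasurable.integral_prod_right' (ν := volume.restrict (Ioo (0 : ℝ) 1))).measurable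

theorem measurable_enorm_sub_sq (x : E) :
    Measurable fun z : ℝ × (E × ℝ) => ‖v (x, z.1) - v z.2‖ₑ ^ 2 := by
  have : Measurable fun z : ℝ × (E × ℝ) => v (x, z.1) := hv.comp (by fun_prop)
  exact ((this.sub (hv.comp measurable_snd)).enorm).pow_const 2

/-- Jensen in both vertical variables, followed by Tonelli. -/
theorem lintegral_ball_verticalAverage_le (x : E) (r : ℝ) :
    ∫⁻ y in Metric.ball x r, ‖verticalAverage v y - verticalAverage v x‖ₑ ^ 2 ≤
      ∫⁻ t in Ioo (0 : ℝ) 1, ∫⁻ w in Metric.ball x r ×ˢ Ioo (0 : ℝ) 1, ‖v (x, t) - v w‖ₑ ^ 2 := by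
  have hx : ∀ y : E, Measurable fun t => v (y, t) := fun y => hv.comp measurable_prodMk_left
  calc _ ≤ ∫⁻ y in Metric.ball x r, ∫⁻ t in Ioo (0 : ℝ) 1, ∫⁻ τ in Ioo (0 : ℝ) 1,
        ‖v (x, t) - v (y, τ)‖ₑ ^ 2 := by
        refine lintegral_mono fun y => ?_
        have := enorm_integral_sub_integral_sq_le (volume.restrict (Ioo (0 : ℝ) 1))
          (volume.restrict (Ioo (0 : ℝ) 1)) (hx x).aestronglyMeasurable
          (hx y).aestronglyMeasurable
        refine le_trans (le_of_eq ?_) this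
        simp only [enorm_sq_eq_ofReal, verticalAverage, sub_sq_comm]
    _ = ∫⁻ t in Ioo (0 : ℝ) 1, ∫⁻ y in Metric.ball x r, ∫⁻ τ in Ioo (0 : ℝ) 1,
        ‖v (x, t) - v (y, τ)‖ₑ ^ 2 := by
        refine lintegral_lintegral_swap (Measurable.aemeasurable ?_)
        have : Measurable fun z : (E × ℝ) × ℝ => ‖v (x, z.1.2) - v (z.1.1, z.2)‖ₑ ^ 2 :=
          (measurable_enorm_sub_sq hv x).comp (show Measurable fun z : (E × ℝ) × ℝ =>
            (z.1.2, (z.1.1, z.2)) by fun_prop)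
        exact this.lintegral_prod_right'
    _ = _ := by
        refine lintegral_congr fun t => ?_
        rw [Measure.volume_eq_prod, ← Measure.prod_restrict, lintegral_prod]
        exact ((measurable_enorm_sub_sq hv x).comp
          (measurable_prodMk_left (x := t))).aemeasurable

/-- For each `w` in the cylinder the value `v w` serves as comparison constant for the mean of `v
(x, ·)`. Integrating over `w` produces the volume of the ball, the height being 1. -/
theorem volume_ball_mul_lintegral_sub_verticalAverage_le (x : E) (r : ℝ) :
    volume (Metric.ball x r) * ∫⁻ t in Ioo (0 : ℝ) 1, ‖v (x, t) - verticalAverage v x‖ₑ ^ 2 ≤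
      4 * ∫⁻ t in Ioo (0 : ℝ) 1, ∫⁻ w in Metric.ball x r ×ˢ Ioo (0 : ℝ) 1,
        ‖v (x, t) - v w‖ₑ ^ 2 := by
  have hx : Measurable fun t => v (x, t) := hv.comp measurable_prodMk_left
  have hvol : volume (Metric.ball x r) =
      volume.restrict (Metric.ball x r ×ˢ Ioo (0 : ℝ) 1) univ := by
    rw [Measure.restrict_apply_univ, Measure.volume_eq_prod, Measure.prod_prod]
    simp
  rw [lintegral_lintegral_swap (measurable_enorm_sub_sq hv x).aemeasurable,
    hvol, mul_comm, ← lintegral_const, ← lintegral_const_mul' 4 _ (by norm_num)]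
  exact lintegral_mono fun w => lintegral_enorm_sub_integral_sq_le _ hx.aestronglyMeasurable _

end VerticalAverage

/-! ### From the energy at scale `ε` to a modulus of continuity. -/

section Translates

variable {E : Type*} [NormedAddCommGroup E] [NormedSpace ℝ E] [FiniteDimensional ℝ E]
  [MeasureSpace E] [BorelSpace E] [(volume : Measure E).IsAddHaarMeasure]
  {ω : Set E} {f : E → ℝ} (hf : Measurable f)
include hf

theorem measurable_enorm_add_sub_sq :
    Measurable fun z : E × E => ‖f (z.1 + z.2) - f z.1‖ₑ ^ 2 :=
  (((hf.comp (measurable_fst.add measurable_snd)).sub (hf.comp measurable_fst)).enorm).pow_const 2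

omit hf in
-- Recentring at `x + g` replaces `k` by `k - g`, of norm below `ε`. Moving the base point by `g`
-- uses the room between the cores at `3 * ε` and `2 * ε`.
theorem lintegral_ball_sub_translate_le {ε : ℝ} {A : Set E} (hA : A ⊆ innerCore ω (3 * ε)) {g : E}
    (hg : ‖g‖ ≤ ε / 2) :
    ∫⁻ x in A, ∫⁻ k in Metric.ball 0 (ε / 2), ‖f (x + k) - f (x + g)‖ₑ ^ 2 ≤
      ∫⁻ x in innerCore ω (2 * ε), ∫⁻ k in Metric.ball 0 ε, ‖f (x + k) - f x‖ₑ ^ 2 := by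
  have hε : 0 ≤ ε := by linarith [norm_nonneg g]
  calc _ ≤ ∫⁻ x in A, ∫⁻ k in Metric.ball 0 ε, ‖f (x + g + k) - f (x + g)‖ₑ ^ 2 := by
        refine lintegral_mono fun x => ?_
        have := setLIntegral_add_right_le (volume : Measure E)
          (F := fun k => ‖f (x + g + k) - f (x + g)‖ₑ ^ 2)
          (A := Metric.ball 0 (ε / 2)) (B := Metric.ball 0 ε) (h := -g) ?_
        · refine le_trans (le_of_eq (lintegral_congr fun k => ?_)) this
          congr 4
          abel
        · intro k hk
          rw [mem_ball_zero_iff] at hk ⊢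
          have := norm_sub_le k g
          rw [← sub_eq_add_neg]
          linarith
    _ ≤ _ := by
        refine setLIntegral_add_right_le (volume : Measure E)
          (F := fun x => ∫⁻ k in Metric.ball 0 ε, ‖f (x + k) - f x‖ₑ ^ 2) fun x hx => ?_
        refine mem_innerCore_of_dist (hA hx) ?_
        simp only [dist_self_add_left]
        linarith

/-- A single short translation is controlled by averaged ones: insert `f (x + k)` between `f (x +
g)` and `f x`, and integrate over `k`. -/
theorem volume_ball_mul_translate_le {ε : ℝ} {A : Set E} (hA : A ⊆ innerCore ω (3 * ε)) {g : E}
    (hg : ‖g‖ ≤ ε / 2) :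
    volume (Metric.ball (0 : E) (ε / 2)) * ∫⁻ x in A, ‖f (x + g) - f x‖ₑ ^ 2 ≤
      4 * ∫⁻ x in innerCore ω (2 * ε), ∫⁻ k in Metric.ball 0 ε, ‖f (x + k) - f x‖ₑ ^ 2 := by
  have hε : 0 ≤ ε := by linarith [norm_nonneg g]
  set I := ∫⁻ x in innerCore ω (2 * ε), ∫⁻ k in Metric.ball 0 ε, ‖f (x + k) - f x‖ₑ ^ 2 with hI
  have hm := measurable_enorm_add_sub_sq hf
  have hm1 : ∀ x, Measurable fun k => ‖f (x + k) - f x‖ₑ ^ 2 := fun x =>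
    (((hf.comp (measurable_const_add x)).sub measurable_const).enorm).pow_const 2
  have h1 : ∫⁻ x in A, ∫⁻ k in Metric.ball 0 (ε / 2), ‖f (x + k) - f x‖ₑ ^ 2 ≤ I :=
    (lintegral_mono_set (hA.trans (innerCore_anti (by linarith)))).trans
      (lintegral_mono fun x => lintegral_mono_set (Metric.ball_subset_ball (by linarith)))
  have h2 : ∫⁻ x in A, ∫⁻ k in Metric.ball 0 (ε / 2), ‖f (x + k) - f (x + g)‖ₑ ^ 2 ≤ I :=
    lintegral_ball_sub_translate_le hA hg
  calc _ = ∫⁻ x in A, ∫⁻ k in Metric.ball (0 : E) (ε / 2), ‖f (x + g) - f x‖ₑ ^ 2 := by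
        rw [← lintegral_const_mul' _ _ measure_ball_lt_top.ne]
        simp [mul_comm]
    _ ≤ ∫⁻ x in A, (2 * (∫⁻ k in Metric.ball (0 : E) (ε / 2), ‖f (x + k) - f x‖ₑ ^ 2) +
          2 * ∫⁻ k in Metric.ball (0 : E) (ε / 2), ‖f (x + k) - f (x + g)‖ₑ ^ 2) := by
        refine lintegral_mono fun x => ?_
        rw [← lintegral_const_mul' 2 _ ENNReal.ofNat_ne_top,
          ← lintegral_const_mul' 2 _ ENNReal.ofNat_ne_top,
          ← lintegral_add_left ((hm1 x).const_mul 2)]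
        refine lintegral_mono fun k => ?_
        have := enorm_add_sq_le (f (x + k) - f x) (f (x + g) - f (x + k))
        rw [add_comm (f (x + k) - f x), sub_add_sub_cancel] at this
        refine this.trans_eq ?_
        simp only [enorm_sq_eq_ofReal, sub_sq_comm (f (x + g))]
    _ = 2 * (∫⁻ x in A, ∫⁻ k in Metric.ball (0 : E) (ε / 2), ‖f (x + k) - f x‖ₑ ^ 2) +
          2 * ∫⁻ x in A, ∫⁻ k in Metric.ball (0 : E) (ε / 2), ‖f (x + k) - f (x + g)‖ₑ ^ 2 := by
        rw [lintegral_add_left (hm.lintegral_prod_right'.const_mul 2),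
          lintegral_const_mul' 2 _ ENNReal.ofNat_ne_top,
          lintegral_const_mul' 2 _ ENNReal.ofNat_ne_top]
    _ ≤ 2 * I + 2 * I := add_le_add (mul_le_mul' le_rfl h1) (mul_le_mul' le_rfl h2)
    _ = 4 * I := by rw [← add_mul]; norm_num

/-- Telescoping over `N` steps costs `N ^ 2`, each step contributes `O(ε ^ 2)`, and `N * ε ≤ 2 *
(‖h‖ + ε)`. The offset `ε` stays because at least one step is taken, however short `h` is. -/
theorem lintegral_translate_le {K : ℝ≥0∞} {ε δ : ℝ} (hε : 0 < ε) (hεδ : ε ≤ δ)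
    (hI : ∫⁻ x in innerCore ω (2 * ε), ∫⁻ k in Metric.ball 0 ε, ‖f (x + k) - f x‖ₑ ^ 2 ≤
      K * ENNReal.ofReal (ε ^ (Module.finrank ℝ E + 2))) {h : E} (hh : ‖h‖ ≤ δ) :
    ∫⁻ x in innerCore ω (4 * δ), ‖f (x + h) - f x‖ₑ ^ 2 ≤
      16 * 2 ^ Module.finrank ℝ E * K / volume (Metric.ball (0 : E) 1) *
        ENNReal.ofReal (‖h‖ + ε) ^ 2 := by
  set d := Module.finrank ℝ E
  -- The ceiling makes the steps at most `ε / 2` long; the extra 1 keeps `N` positive when `h = 0`.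
  set N : ℕ := ⌈2 * ‖h‖ / ε⌉₊ + 1 with hN
  have hN0 : (0 : ℝ) < N := by rw [hN]; positivity
  have hN1 : 2 * ‖h‖ / ε ≤ N := (Nat.le_ceil _).trans (by rw [hN]; push_cast; linarith)
  have hN2 : N * ε ≤ 2 * (‖h‖ + ε) := by
    have h1 : (N : ℝ) ≤ 2 * ‖h‖ / ε + 2 := by
      have := (Nat.ceil_lt_add_one (show 0 ≤ 2 * ‖h‖ / ε by positivity)).le
      rw [hN]; push_cast; linarith
    calc N * ε ≤ (2 * ‖h‖ / ε + 2) * ε := by gcongr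
      _ = _ := by field_simp
  set g : E := (N : ℝ)⁻¹ • h with hg
  have hgn : ‖g‖ = ‖h‖ / N := by
    rw [hg, norm_smul, norm_inv, Real.norm_of_nonneg hN0.le, inv_mul_eq_div]
  have hg2 : ‖g‖ ≤ ε / 2 := by
    rw [hgn, div_le_iff₀ hN0]
    rw [div_le_iff₀ hε] at hN1
    linarith
  have hNg : N • g = h := by
    rw [← Nat.cast_smul_eq_nsmul ℝ, hg, smul_smul, mul_inv_cancel₀ hN0.ne', one_smul]
  have hchain := setLIntegral_enorm_sub_sq_chain_le (volume : Measure E) hf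
    (A := innerCore ω (4 * δ)) (B := innerCore ω (3 * δ)) N g ?_
  swap
  · intro x hx i hi
    refine mem_innerCore_of_dist hx ?_
    rw [dist_self_add_left, ← Nat.cast_smul_eq_nsmul ℝ, norm_smul, hgn, RCLike.norm_natCast]
    have : (i : ℝ) * (‖h‖ / N) ≤ ‖h‖ := by
      rw [← mul_div_assoc, div_le_iff₀ hN0, mul_comm]
      gcongr
    linarith
  rw [hNg] at hchain
  refine hchain.trans ?_
  have hone := volume_ball_mul_translate_le hf (ω := ω) (ε := ε) (A := innerCore ω (3 * δ))
    (innerCore_anti (by linarith)) hg2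
  have hball : volume (Metric.ball (0 : E) (ε / 2)) =
      ENNReal.ofReal ((ε / 2) ^ d) * volume (Metric.ball (0 : E) 1) :=
    Measure.addHaar_ball_of_pos _ _ (by positivity)
  have hb0 : volume (Metric.ball (0 : E) 1) ≠ 0 := (Metric.measure_ball_pos _ _ one_pos).ne'
  have hbt : volume (Metric.ball (0 : E) 1) ≠ ∞ := measure_ball_lt_top.ne
  set b := volume (Metric.ball (0 : E) 1)
  set F := ∫⁻ x in innerCore ω (3 * δ), ‖f (x + g) - f x‖ₑ ^ 2
  have hF : F ≤ 4 * 2 ^ d * K / b * ENNReal.ofReal (ε ^ 2) := by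
    have h1 : ENNReal.ofReal ((ε / 2) ^ d) * b * F ≤
        4 * (K * ENNReal.ofReal (ε ^ (d + 2))) := by
      rw [← hball]
      exact hone.trans (by gcongr)
    have h2 : (4 : ℝ≥0∞) * (K * ENNReal.ofReal (ε ^ (d + 2))) =
        ENNReal.ofReal ((ε / 2) ^ d) * b * (4 * 2 ^ d * K / b * ENNReal.ofReal (ε ^ 2)) := by
      have h3 : ENNReal.ofReal (ε ^ (d + 2)) =
          ENNReal.ofReal ((ε / 2) ^ d) * 2 ^ d * ENNReal.ofReal (ε ^ 2) := by
        rw [show (2 : ℝ≥0∞) ^ d = ENNReal.ofReal (2 ^ d) by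
          rw [ENNReal.ofReal_pow (by norm_num)]; simp, ← ENNReal.ofReal_mul (by positivity),
          ← ENNReal.ofReal_mul (by positivity), ← mul_pow, div_mul_cancel₀ _ (by norm_num),
          pow_add]
      rw [h3, ENNReal.div_eq_inv_mul]
      calc _ = ENNReal.ofReal ((ε / 2) ^ d) * (b * b⁻¹) *
            (4 * 2 ^ d * K * ENNReal.ofReal (ε ^ 2)) := by
            rw [ENNReal.mul_inv_cancel hb0 hbt]; ring
        _ = _ := by ring
    rw [h2] at h1
    refine (ENNReal.mul_le_mul_iff_right ?_ ?_).1 h1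
    · exact mul_ne_zero (by simpa using by positivity) hb0
    · exact ENNReal.mul_ne_top ENNReal.ofReal_ne_top hbt
  calc _ ≤ (N : ℝ≥0∞) ^ 2 * (4 * 2 ^ d * K / b * ENNReal.ofReal (ε ^ 2)) := by gcongr
    _ = 4 * 2 ^ d * K / b * ENNReal.ofReal ((N * ε) ^ 2) := by
        rw [mul_pow, ENNReal.ofReal_mul (by positivity), ENNReal.ofReal_pow hN0.le,
          ENNReal.ofReal_natCast]
        ring
    _ ≤ 4 * 2 ^ d * K / b * ENNReal.ofReal ((2 * (‖h‖ + ε)) ^ 2) := by gcongr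
    _ = _ := by
        rw [mul_pow, ENNReal.ofReal_mul (by positivity), show ENNReal.ofReal
            (2 ^ 2) = 4 by norm_num,
          ENNReal.ofReal_pow (by positivity), ENNReal.div_eq_inv_mul, ENNReal.div_eq_inv_mul]
        ring

end Translates

/-! ### Coordinates on the film and the rescaled energy. -/

section Film

variable {m : ℕ}

@[simp] theorem planar_withHeight (x : EuclideanSpace ℝ (Fin m)) (t : ℝ) : planar
    (withHeight x t) = x := by
  ext i
  simp [planar, withHeight]

@[simp] theorem withHeight_last (x : EuclideanSpace ℝ (Fin m)) (t : ℝ) : withHeight x t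
    (Fin.last m) = t := by
  simp [withHeight]

@[simp] theorem withHeight_planar (x : EuclideanSpace ℝ (Fin (m + 1))) :
    withHeight (planar x) (x (Fin.last m)) = x := by
  ext i
  refine Fin.lastCases ?_ (fun j => ?_) i <;> simp [planar, withHeight]

theorem continuous_planar : Continuous (planar (m := m)) := by
  unfold planar
  fun_prop

theorem continuous_withHeight :
    Continuous fun z : EuclideanSpace ℝ (Fin m) × ℝ => withHeight z.1 z.2 := by
  unfold withHeight
  refine (PiLp.continuous_toLp 2 _).comp (continuous_pi fun i => ?_)
  refine Fin.lastCases ?_ (fun j => ?_) i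
  · simpa using continuous_snd
  · simp only [Fin.snoc_castSucc]
    exact (PiLp.continuous_apply 2 (fun _ : Fin m => ℝ) j).comp continuous_fst

theorem norm_sq_eq_planar_add (x : EuclideanSpace ℝ (Fin (m + 1))) :
    ‖x‖ ^ 2 = ‖planar x‖ ^ 2 + x (Fin.last m) ^ 2 := by
  simp [EuclideanSpace.real_norm_sq_eq, Fin.sum_univ_castSucc, planar]

theorem planar_sub (x y : EuclideanSpace ℝ (Fin (m + 1))) :
    planar (x - y) = planar x - planar y := rfl

theorem norm_planar_le (x : EuclideanSpace ℝ (Fin (m + 1))) : ‖planar x‖ ≤ ‖x‖ :=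
  abs_le_of_sq_le_sq' (by nlinarith [norm_sq_eq_planar_add x, sq_nonneg (x (Fin.last m))])
    (norm_nonneg _) |>.2

/-- Splitting off the last coordinate. -/
noncomputable def heightEquiv (m : ℕ) :
    EuclideanSpace ℝ (Fin (m + 1)) ≃ᵐ EuclideanSpace ℝ (Fin m) × ℝ where
  toFun x := (planar x, x (Fin.last m))
  invFun z := withHeight z.1 z.2
  left_inv x := withHeight_planar x
  right_inv z := by simp
  measurable_toFun := (continuous_planar.prodMk
    (PiLp.continuous_apply 2 (fun _ : Fin (m + 1) => ℝ) (Fin.last m))).measurable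
  measurable_invFun := continuous_withHeight.measurable

theorem measurePreserving_heightEquiv : MeasurePreserving (heightEquiv m) := by
  have h1 := EuclideanSpace.volume_preserving_symm_measurableEquiv_toLp (Fin (m + 1))
  have h2 := volume_preserving_piFinSuccAbove (fun _ : Fin (m + 1) => ℝ) (Fin.last m)
  have h3 : MeasurePreserving (Prod.swap : ℝ × (Fin m → ℝ) → (Fin m → ℝ) × ℝ) :=
    Measure.measurePreserving_swap
  have h4 : MeasurePreserving (Prod.map (WithLp.toLp 2) id : (Fin m → ℝ) × ℝ → EuclideanSpace ℝ
      (Fin m) × ℝ) :=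
    (PiLp.volume_preserving_toLp (Fin m)).prod (MeasurePreserving.id volume)
  have h5 := h4.comp (h3.comp (h2.comp h1))
  refine (congrArg (fun g => MeasurePreserving g volume volume) (funext fun x => ?_)).mp h5
  refine Prod.ext ?_ rfl
  ext i
  simp [heightEquiv, planar, MeasurableEquiv.piFinSuccAbove, Fin.insertNthEquiv, Fin.init]

theorem map_prodMap_id_mul {ε : ℝ} (hε : 0 < ε) :
    (volume : Measure (EuclideanSpace ℝ (Fin m) × ℝ)).map (Prod.map id
        (ε * ·)) = ENNReal.ofReal ε⁻¹ • volume := by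
  rw [Measure.volume_eq_prod, ← Measure.map_prod_map _ _ measurable_id (measurable_const_mul ε),
    Measure.map_id, Real.map_volume_mul_left hε.ne', Measure.prod_smul_right, abs_of_pos
    (inv_pos.2 hε)]

theorem thinFilm_eq_preimage (A : Set (EuclideanSpace ℝ (Fin m))) (ε : ℝ) :
    thinFilm A ε = heightEquiv m ⁻¹' (A ×ˢ Ioo 0 ε) := rfl

theorem lintegral_thinFilm {ε : ℝ} (hε : 0 < ε) (F : EuclideanSpace ℝ (Fin (m + 1)) → ℝ≥0∞)
    (A : Set (EuclideanSpace ℝ (Fin m))) :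
    ∫⁻ x in thinFilm A ε, F x =
      ENNReal.ofReal ε * ∫⁻ z in A ×ˢ Ioo (0 : ℝ) 1, F (withHeight z.1 (ε * z.2)) := by
  have hemb : MeasurableEmbedding (Prod.map id (ε * ·) : EuclideanSpace ℝ
      (Fin m) × ℝ → EuclideanSpace ℝ (Fin m) × ℝ) :=
    ((Homeomorph.refl (EuclideanSpace ℝ (Fin m))).prodCongr
        (Homeomorph.mulLeft₀ ε hε.ne')).measurableEmbedding
  have h1 : ∫⁻ x in thinFilm A ε, F x = ∫⁻ z in A ×ˢ Ioo 0 ε, F (withHeight z.1 z.2) := by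
    have := measurePreserving_heightEquiv.setLIntegral_comp_preimage_emb
      (heightEquiv m).measurableEmbedding (fun z => F (withHeight z.1 z.2)) (A ×ˢ Ioo 0 ε)
    rw [← thinFilm_eq_preimage] at this
    simpa [heightEquiv] using this
  have h2 : (Prod.map id (ε * ·) : EuclideanSpace ℝ (Fin m) × ℝ → EuclideanSpace ℝ (Fin m) × ℝ) ⁻¹'
      (A ×ˢ Ioo 0 ε) = A ×ˢ Ioo 0 1 := by
    ext z
    simp only [mem_preimage, mem_prod, Prod.map_fst, Prod.map_snd, id, mem_Ioo, hε,
      mul_pos_iff_of_pos_left]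
    rw [mul_lt_iff_lt_one_right hε]
  have h3 := hemb.lintegral_map (μ := volume.restrict (A ×ˢ Ioo (0 : ℝ) 1))
    (fun z => F (withHeight z.1 z.2))
  rw [← h2, ← hemb.restrict_map, map_prodMap_id_mul hε, Measure.restrict_smul,
    lintegral_smul_measure, h2] at h3
  simp only [Prod.map_fst, Prod.map_snd, id] at h3
  rw [h1, ← h3, smul_eq_mul, ← mul_assoc, ← ENNReal.ofReal_mul hε.le, mul_inv_cancel₀ hε.ne']
  simp

theorem measurableSet_thinFilm {A : Set (EuclideanSpace ℝ (Fin m))} (hA : MeasurableSet A) (ε : ℝ) :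
    MeasurableSet (thinFilm A ε) :=
  (heightEquiv m).measurable (hA.prod measurableSet_Ioo)

/-- Horizontally the segment stays in the ball of radius `R` around `planar p`, which lies in `ω`;
vertically an interval is convex. Thus `ω` need not be convex. -/
theorem segment_subset_thinFilm {ω : Set (EuclideanSpace ℝ (Fin m))} {ε R : ℝ}
    {p q : EuclideanSpace ℝ (Fin (m + 1))}
    (hp : p ∈ thinFilm (innerCore ω R) ε) (hq : q ∈ thinFilm ω ε) (hpq : dist q p < R) :
    segment ℝ p q ⊆ thinFilm ω ε := by
  rw [segment_eq_image']
  rintro _ ⟨θ, hθ, rfl⟩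
  refine ⟨mem_innerCore_iff.1 hp.1 ?_, ?_⟩
  · rw [Metric.mem_ball, dist_eq_norm]
    calc ‖planar (p + θ • (q - p)) - planar p‖ ≤ ‖θ • (q - p)‖ := by
          rw [← planar_sub, add_sub_cancel_left]
          exact norm_planar_le _
      _ ≤ 1 * ‖q - p‖ := by
          rw [norm_smul, Real.norm_of_nonneg hθ.1]
          gcongr
          exact hθ.2
      _ < R := by rwa [one_mul, ← dist_eq_norm]
  · have := (convex_Ioo (0 : ℝ) ε).add_smul_sub_mem hp.2 hq.2 hθ
    simpa using this

/-- The rescaled nonlocal energy at distance `ε`. -/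
theorem lintegral_rescaled_pairs_le {ω : Set (EuclideanSpace ℝ (Fin m))} (hω : IsOpen ω) {ε s : ℝ}
    (hε : 0 < ε)
    (hs : s ∈ Ioo (0 : ℝ) 1) {u : EuclideanSpace ℝ (Fin (m + 1)) → ℝ} (hu : Measurable u)
    {S : ℝ≥0} (hS : ENNReal.ofReal ((1 - s) / ε ^ (3 - 2 * s)) *
      gagliardoSq s (thinFilm ω ε) u ≤ S) :
    ∫⁻ z in innerCore ω (2 * ε) ×ˢ Ioo (0 : ℝ) 1, ∫⁻ w in Metric.ball z.1 ε ×ˢ Ioo (0 : ℝ) 1,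
        ‖u (withHeight z.1 (ε * z.2)) - u (withHeight w.1 (ε * w.2))‖ₑ ^ 2 ≤
      ((6 * 2 ^ (m + 3) * S : ℝ≥0) : ℝ≥0∞) * ENNReal.ofReal (ε ^ (m + 2)) := by
  have hs0 := hs.1
  have hs1 := hs.2
  have key := lintegral_ball_pairs_le_gagliardo (volume : Measure (EuclideanSpace ℝ (Fin (m + 1))))
    hu (A := thinFilm (innerCore ω (2 * ε)) ε) (B := thinFilm ω ε)
    (measurableSet_thinFilm (measurableSet_innerCore _) _)
    (measurableSet_thinFilm hω.measurableSet _) (R := 2 * ε) (by positivity) hs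
    (by simp) (fun p hp q hq hpq => segment_subset_thinFilm hp hq hpq)
  rw [finrank_euclideanSpace_fin] at key
  set J := ∫⁻ z in innerCore ω (2 * ε) ×ˢ Ioo (0 : ℝ) 1,
    ∫⁻ w in Metric.ball z.1 ε ×ˢ Ioo (0 : ℝ) 1,
        ‖u (withHeight z.1 (ε * z.2)) - u (withHeight w.1 (ε * w.2))‖ₑ ^ 2 with hJ
  -- Each of the two vertical variables contributes a factor `ε`. Points whose planar parts and
  -- heights both differ by less than `ε` are at distance less than `2 * ε`.
  have hlow : ENNReal.ofReal ε * (ENNReal.ofReal ε * J) ≤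
      ∫⁻ p in thinFilm (innerCore ω (2 * ε)) ε, ∫⁻ q in thinFilm ω ε ∩ Metric.ball p (2 * ε),
        ‖u p - u q‖ₑ ^ 2 := by
    rw [lintegral_thinFilm hε, hJ, ← lintegral_const_mul' _ _ ENNReal.ofReal_ne_top]
    refine mul_le_mul' le_rfl (setLIntegral_mono' ((measurableSet_innerCore _).prod
      measurableSet_Ioo) fun z hz => ?_)
    rw [← lintegral_thinFilm hε (fun q => ‖u (withHeight z.1 (ε * z.2)) - u q‖ₑ ^ 2)]
    refine lintegral_mono_set fun q hq => ⟨⟨?_, hq.2⟩, ?_⟩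
    · exact mem_innerCore_iff.1 hz.1 (Metric.ball_subset_ball (by linarith) hq.1)
    · have h1 := norm_sq_eq_planar_add (q - withHeight z.1 (ε * z.2))
      have h2 : ‖planar (q - withHeight z.1 (ε * z.2))‖ < ε := by
        rw [planar_sub, planar_withHeight, ← dist_eq_norm]
        exact hq.1
      have h3 : (q - withHeight z.1 (ε * z.2)) (Fin.last m) ^ 2 < ε ^ 2 := by
        have := hq.2
        have hz2 := hz.2
        simp only [PiLp.sub_apply, withHeight_last]
        rw [mem_Ioo] at this hz2
        have a1 : 0 < ε * z.2 := mul_pos hε hz2.1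
        have a2 : ε * z.2 < ε := by nlinarith
        exact sq_lt_sq' (by linarith) (by linarith)
      rw [Metric.mem_ball, dist_eq_norm]
      refine lt_of_pow_lt_pow_left₀ 2 (by positivity) ?_
      rw [h1]
      have h4 : ‖planar (q - withHeight z.1 (ε * z.2))‖ ^ 2 < ε ^ 2 := by gcongr
      nlinarith
  have hup : ENNReal.ofReal (6 * (1 - s) * (2 * ε) ^ (((m + 1 : ℕ) : ℝ) + 2 * s)) *
      gagliardoSq s (thinFilm ω ε) u ≤
      ENNReal.ofReal ε * (ENNReal.ofReal ε *
        (((6 * 2 ^ (m + 3) * S : ℝ≥0) : ℝ≥0∞) * ENNReal.ofReal (ε ^ (m + 2)))) := by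
    have h1 : 6 * (1 - s) * (2 * ε) ^ (((m + 1 : ℕ) : ℝ) + 2 * s) ≤
        6 * 2 ^ (m + 3) * ε ^ (m + 4) * ((1 - s) / ε ^ (3 - 2 * s)) := by
      -- The exponents match because `m + 1 + 2s = (m + 4) - (3 - 2s)`. Two of the `m + 4` powers of
      -- `ε` are then spent on the vertical rescaling.
      have e1 : (2 * ε) ^ (((m + 1 : ℕ) : ℝ) + 2 * s) =
          2 ^ (((m + 1 : ℕ) : ℝ) + 2 * s) * (ε ^ (m + 4) / ε ^ (3 - 2 * s)) := by
        rw [Real.mul_rpow (by norm_num) hε.le, ← Real.rpow_natCast, ← Real.rpow_sub hε]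
        congr 2
        push_cast
        ring
      have e2 : (2 : ℝ) ^ (((m + 1 : ℕ) : ℝ) + 2 * s) ≤ 2 ^ (m + 3) := by
        rw [← Real.rpow_natCast]
        refine Real.rpow_le_rpow_of_exponent_le (by norm_num) ?_
        push_cast
        linarith
      rw [e1]
      calc _ ≤ 6 * (1 - s) * (2 ^ (m + 3) * (ε ^ (m + 4) / ε ^ (3 - 2 * s))) := by
            have : 0 ≤ 1 - s := by linarith
            gcongr
        _ = _ := by ring
    calc _ ≤ ENNReal.ofReal (6 * 2 ^ (m + 3) * ε ^ (m + 4) * ((1 - s) / ε ^ (3 - 2 * s))) *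
          gagliardoSq s (thinFilm ω ε) u := by gcongr
      _ = ENNReal.ofReal (6 * 2 ^ (m + 3) * ε ^ (m + 4)) *
          (ENNReal.ofReal ((1 - s) / ε ^ (3 - 2 * s)) * gagliardoSq s (thinFilm ω ε) u) := by
          rw [ENNReal.ofReal_mul (by positivity), mul_assoc]
      _ ≤ ENNReal.ofReal (6 * 2 ^ (m + 3) * ε ^ (m + 4)) * S := by gcongr
      _ = _ := by
          rw [← ENNReal.ofReal_coe_nnreal, ← ENNReal.ofReal_coe_nnreal,
            ← ENNReal.ofReal_mul (by positivity), ← ENNReal.ofReal_mul (by positivity),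
            ← ENNReal.ofReal_mul (by positivity), ← ENNReal.ofReal_mul (by positivity)]
          congr 1
          push_cast
          ring
  have hfin := hlow.trans (key.trans hup)
  have hε' : ENNReal.ofReal ε ≠ 0 := by simpa using hε
  rwa [ENNReal.mul_le_mul_iff_right hε' ENNReal.ofReal_ne_top,
    ENNReal.mul_le_mul_iff_right hε' ENNReal.ofReal_ne_top] at hfin

end Film

/-- Functions of finite Gagliardo energy on a bounded set are square-integrable. -/
theorem lintegral_sq_ne_top_of_gagliardoSq {d : ℕ} {s : ℝ} (hs : 0 < s)
    {U : Set (EuclideanSpace ℝ (Fin d))} (hU : MeasurableSet U) (hb : Bornology.IsBounded U)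
    {u : EuclideanSpace ℝ (Fin d) → ℝ} (hu : Measurable u) (h : gagliardoSq s U u ≠ ∞) :
    ∫⁻ x in U, ‖u x‖ₑ ^ 2 ≠ ∞ := by
  obtain ⟨D, hD⟩ := hb.exists_norm_le
  have hDD : ∀ x ∈ U, ∀ y ∈ U, ‖x - y‖ ≤ 2 * |D| + 1 := fun x hx y hy => by
    linarith [norm_sub_le x y, hD x hx, hD y hy, le_abs_self D]
  set R : ℝ := 2 * |D| + 1
  have hR : 0 < R := by positivity
  set α : ℝ := (d : ℝ) + 2 * s
  have hα : 0 < α := by positivity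
  have h1 : ∫⁻ x in U, ∫⁻ y in U, ‖u x - u y‖ₑ ^ 2 ≤
      ENNReal.ofReal (R ^ α) * gagliardoSq s U u := by
    rw [gagliardoSq, ← lintegral_const_mul' _ _ ENNReal.ofReal_ne_top]
    refine setLIntegral_mono' hU fun x hx => ?_
    rw [← lintegral_const_mul' _ _ ENNReal.ofReal_ne_top]
    refine setLIntegral_mono' hU fun y hy => ?_
    rw [enorm_sq_eq_ofReal, ← ENNReal.ofReal_mul (by positivity)]
    refine ENNReal.ofReal_le_ofReal ?_
    rcases eq_or_ne x y with rfl | hxy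
    · simp
    have hn : 0 < ‖x - y‖ := norm_pos_iff.2 (sub_ne_zero.2 hxy)
    rw [sq_abs, ← mul_div_assoc, le_div_iff₀ (by positivity), mul_comm]
    gcongr
    exact hDD x hx y hy
  have h2 : ∫⁻ x in U, ∫⁻ y in U, ‖u x - u y‖ₑ ^ 2 ≠ ∞ :=
    (h1.trans_lt (ENNReal.mul_lt_top ENNReal.ofReal_lt_top h.lt_top)).ne
  have hm : Measurable fun x => ∫⁻ y in U, ‖u x - u y‖ₑ ^ 2 := by
    refine Measurable.lintegral_prod_right' (f := fun z => ‖u z.1 - u z.2‖ₑ ^ 2) ?_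
    exact (((hu.comp measurable_fst).sub (hu.comp measurable_snd)).enorm).pow_const 2
  rcases eq_or_ne (volume U) 0 with h0 | h0
  · rw [Measure.restrict_eq_zero.2 h0]; simp
  have : NeZero (volume.restrict U) := ⟨by simpa using h0⟩
  -- One base point with finite inner integral suffices: `u` is compared with the constant `u x` on
  -- a set of finite measure.
  obtain ⟨x, hx⟩ := (ae_lt_top hm h2).exists
  have hUt : volume U ≠ ∞ := hb.measure_lt_top.ne
  have h3 : ∫⁻ y in U, ‖u y‖ₑ ^ 2 ≤ ∫⁻ y in U, (2 * ‖u x‖ₑ ^ 2 + 2 * ‖u x - u y‖ₑ ^ 2) := by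
    refine lintegral_mono fun y => ?_
    have := enorm_add_sq_le (u x) (u y - u x)
    rw [add_sub_cancel] at this
    simpa only [enorm_sq_eq_ofReal, sub_sq_comm (u y)] using this
  rw [lintegral_add_left measurable_const, lintegral_const,
    lintegral_const_mul' 2 _ ENNReal.ofNat_ne_top, Measure.restrict_apply_univ] at h3
  refine (h3.trans_lt (ENNReal.add_lt_top.2 ⟨ENNReal.mul_lt_top (ENNReal.mul_lt_top
    ENNReal.ofNat_lt_top (ENNReal.pow_lt_top enorm_lt_top)) hUt.lt_top,
    ENNReal.mul_lt_top ENNReal.ofNat_lt_top hx⟩)).ne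

/-! ### Poincaré inequality and local `L²` bounds. -/

section Planar

variable {E : Type*} [NormedAddCommGroup E] [NormedSpace ℝ E] [FiniteDimensional ℝ E]
  [MeasureSpace E] [BorelSpace E] [(volume : Measure E).IsAddHaarMeasure]

/-- Asymptotically, the functions `f n` have the `L²`-modulus of continuity `M (‖h‖ + ε n)` on
compact subsets of `ω`. -/
def TranslationBound (ω : Set E) (f : ℕ → E → ℝ) (ε : ℕ → ℝ) (M : ℝ≥0) : Prop :=
  ∀ δ > 0, ∀ᶠ n in atTop, ∀ h : E, ‖h‖ ≤ δ →
    ∫⁻ x in innerCore ω (4 * δ), ‖f n (x + h) - f n x‖ₑ ^ 2 ≤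
      (M * ENNReal.ofReal (‖h‖ + ε n)) ^ 2

/-- The `L²`-norms of `f n` on `A` are bounded for large `n`. -/
def EventuallyL2Bounded (f : ℕ → E → ℝ) (A : Set E) : Prop :=
  ∃ C : ℝ≥0∞, C ≠ ∞ ∧ ∀ᶠ n in atTop, ∫⁻ x in A, ‖f n x‖ₑ ^ 2 ≤ C

variable {ω : Set E} {f : ℕ → E → ℝ} {ε : ℕ → ℝ} {M : ℝ≥0}

omit [NormedSpace ℝ E] [FiniteDimensional ℝ E] [BorelSpace E]
  [(volume : Measure E).IsAddHaarMeasure] in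
theorem TranslationBound.add_const (h : TranslationBound ω f ε M) (c : ℕ → ℝ) :
    TranslationBound ω (fun n x => f n x + c n) ε M := by
  intro δ hδ
  filter_upwards [h δ hδ] with n hn v hv
  simpa using hn v hv

omit [NormedSpace ℝ E] [FiniteDimensional ℝ E] [BorelSpace E]
  [(volume : Measure E).IsAddHaarMeasure] in
theorem TranslationBound.comp_strictMono (h : TranslationBound ω f ε M) {φ : ℕ → ℕ}
    (hφ : StrictMono φ) : TranslationBound ω (fun n => f (φ n)) (fun n => ε (φ n)) M :=
  fun δ hδ => hφ.tendsto_atTop.eventually (h δ hδ)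

/-- A Poincaré inequality on balls. -/
theorem TranslationBound.lintegral_ball_ball_le (hB : TranslationBound ω f ε M)
    (hf : ∀ n, Measurable (f n)) (hε : Tendsto ε atTop (𝓝 0)) {x : E} {r : ℝ} (hr : 0 < r)
    (hx : Metric.ball x (9 * r) ⊆ ω) :
    ∃ C : ℝ≥0∞, C ≠ ∞ ∧ ∀ᶠ n in atTop,
      ∫⁻ z in Metric.ball x r, ∫⁻ w in Metric.ball x r, ‖f n w - f n z‖ₑ ^ 2 ≤ C := by
  refine ⟨volume (Metric.ball (0 : E) (2 * r)) * (M * ENNReal.ofReal (2 * r + 1)) ^ 2,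
    ENNReal.mul_ne_top measure_ball_lt_top.ne (ENNReal.pow_ne_top
      (ENNReal.mul_ne_top ENNReal.coe_ne_top ENNReal.ofReal_ne_top)), ?_⟩
  -- Differences of points of the ball have norm below `2 * r`, so the bound is used with `δ = 2 *
  -- r`. It needs the ball inside the core at `8 * r`, whence the radius `9 * r`.
  filter_upwards [hB (2 * r) (by positivity), hε.eventually (ge_mem_nhds one_pos)] with n hn hεn
  have hm := measurable_enorm_add_sub_sq (hf n)
  calc _ ≤ ∫⁻ z in Metric.ball x r, ∫⁻ h in Metric.ball 0 (2 * r),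
        ‖f n (z + h) - f n z‖ₑ ^ 2 := by
        refine setLIntegral_mono' measurableSet_ball fun z hz => ?_
        have := setLIntegral_add_right_le (volume : Measure E)
          (F := fun h => ‖f n (z + h) - f n z‖ₑ ^ 2)
          (A := Metric.ball x r) (B := Metric.ball 0 (2 * r)) (h := -z) ?_
        · simpa using this
        · intro w hw
          rw [mem_ball_zero_iff, ← sub_eq_add_neg, ← dist_eq_norm]
          have := dist_triangle_right w z x
          rw [Metric.mem_ball] at hz hw
          linarith
    _ = ∫⁻ h in Metric.ball 0 (2 * r), ∫⁻ z in Metric.ball x r,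
        ‖f n (z + h) - f n z‖ₑ ^ 2 := lintegral_lintegral_swap hm.aemeasurable
    _ ≤ ∫⁻ h in Metric.ball (0 : E) (2 * r), (M * ENNReal.ofReal (2 * r + 1)) ^ 2 := by
        refine setLIntegral_mono' measurableSet_ball fun h hh => ?_
        rw [mem_ball_zero_iff] at hh
        refine (lintegral_mono_set ?_).trans ((hn h hh.le).trans ?_)
        · intro z hz
          rw [Metric.mem_ball] at hz
          exact mem_innerCore_of_dist (r := 9 * r) (mem_innerCore_iff.2 hx) (by linarith)
        · gcongr
    _ = _ := by simp [mul_comm]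

/-- A bound spreads from a small ball to a larger one: estimate `f n z` by `f n w` and `f n w - f n
z`, average over `w` in the small ball, and apply the Poincaré inequality. -/
theorem TranslationBound.eventuallyL2Bounded_ball (hB : TranslationBound ω f ε M)
    (hf : ∀ n, Measurable (f n)) (hε : Tendsto ε atTop (𝓝 0)) {x y : E} {r r' : ℝ} (hr : 0 < r)
    (hr' : 0 < r') (hx : Metric.ball x (9 * r) ⊆ ω) (hy : y ∈ Metric.ball x r)
    (h : EventuallyL2Bounded f (Metric.ball y r')) :
    EventuallyL2Bounded f (Metric.ball x r) := by
  obtain ⟨C, hC, hCn⟩ := hB.lintegral_ball_ball_le hf hε hr hx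
  obtain ⟨C', hC', hCn'⟩ := h
  set ρ := min r' (r - dist y x) with hρ
  have hρ0 : 0 < ρ := lt_min hr' (sub_pos.2 hy)
  set b := volume (Metric.ball y ρ)
  have hb0 : b ≠ 0 := (Metric.measure_ball_pos _ _ hρ0).ne'
  refine ⟨(2 * C + 2 * (volume (Metric.ball x r) * C')) / b, ?_, ?_⟩
  · refine ENNReal.div_ne_top ?_ hb0
    exact ENNReal.add_ne_top.2 ⟨ENNReal.mul_ne_top (by norm_num) hC, ENNReal.mul_ne_top
      (by norm_num) (ENNReal.mul_ne_top measure_ball_lt_top.ne hC')⟩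
  filter_upwards [hCn, hCn'] with n hn hn'
  rw [ENNReal.le_div_iff_mul_le (Or.inl hb0) (Or.inl measure_ball_lt_top.ne), mul_comm,
    ← lintegral_const_mul' _ _ measure_ball_lt_top.ne]
  have hmz : Measurable fun z : E × E => ‖f n z.2 - f n z.1‖ₑ ^ 2 :=
    ((((hf n).comp measurable_snd).sub ((hf n).comp measurable_fst)).enorm).pow_const 2
  have hsub1 : Metric.ball y ρ ⊆ Metric.ball x r :=
    Metric.ball_subset_ball' (by linarith [min_le_right r' (r - dist y x)])
  have hsub2 : Metric.ball y ρ ⊆ Metric.ball y r' := Metric.ball_subset_ball (min_le_left _ _)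
  calc _ ≤ ∫⁻ z in Metric.ball x r, (2 * (∫⁻ w in Metric.ball x r, ‖f n w - f n z‖ₑ ^ 2) +
        2 * C') := by
        refine lintegral_mono fun z => ?_
        calc b * ‖f n z‖ₑ ^ 2 = ∫⁻ w in Metric.ball y ρ, ‖f n z‖ₑ ^ 2 := by simp [b, mul_comm]
          _ ≤ ∫⁻ w in Metric.ball y ρ, (2 * ‖f n w - f n z‖ₑ ^ 2 + 2 * ‖f n w‖ₑ ^ 2) := by
              refine lintegral_mono fun w => ?_
              have := enorm_add_sq_le (f n z - f n w) (f n w)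
              rw [sub_add_cancel] at this
              simpa only [enorm_sq_eq_ofReal, sub_sq_comm (f n z)] using this
          _ ≤ 2 * (∫⁻ w in Metric.ball y ρ, ‖f n w - f n z‖ₑ ^ 2) +
              2 * ∫⁻ w in Metric.ball y ρ, ‖f n w‖ₑ ^ 2 := by
              rw [lintegral_add_right _ ((((hf n).enorm).pow_const 2).const_mul 2),
                lintegral_const_mul' 2 _ ENNReal.ofNat_ne_top,
                lintegral_const_mul' 2 _ ENNReal.ofNat_ne_top]
          _ ≤ _ := add_le_add (mul_le_mul' le_rfl (lintegral_mono_set hsub1))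
              (mul_le_mul' le_rfl ((lintegral_mono_set hsub2).trans hn'))
    _ = 2 * (∫⁻ z in Metric.ball x r, ∫⁻ w in Metric.ball x r, ‖f n w - f n z‖ₑ ^ 2) +
          2 * (volume (Metric.ball x r) * C') := by
        rw [lintegral_add_right _ measurable_const, lintegral_const_mul' 2 _ ENNReal.ofNat_ne_top]
        simp only [lintegral_const, Measure.restrict_apply_univ]
        ring
    _ ≤ _ := by gcongr

omit [NormedSpace ℝ E] [FiniteDimensional ℝ E] [(volume : Measure E).IsAddHaarMeasure]
  [BorelSpace E] in
theorem EventuallyL2Bounded.mono {A B : Set E} (h : EventuallyL2Bounded f B) (hAB : A ⊆ B) :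
    EventuallyL2Bounded f A := by
  obtain ⟨C, hC, h⟩ := h
  exact ⟨C, hC, h.mono fun n hn => (lintegral_mono_set hAB).trans hn⟩

omit [NormedSpace ℝ E] [FiniteDimensional ℝ E] [(volume : Measure E).IsAddHaarMeasure]
  [BorelSpace E] in
theorem EventuallyL2Bounded.union {A B : Set E} (hA : EventuallyL2Bounded f A)
    (hB : EventuallyL2Bounded f B) : EventuallyL2Bounded f (A ∪ B) := by
  obtain ⟨C, hC, h⟩ := hA
  obtain ⟨C', hC', h'⟩ := hB
  refine ⟨C + C', ENNReal.add_ne_top.2 ⟨hC, hC'⟩, ?_⟩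
  filter_upwards [h, h'] with n hn hn'
  exact (lintegral_union_le _ _ _).trans (add_le_add hn hn')

/-- The points having a ball with a bound form an open set, which is also relatively closed in `ω`
by the previous propagation step. Connectedness gives all of `ω`, and finitely many balls cover `K`.
-/
theorem TranslationBound.eventuallyL2Bounded_of_isCompact (hB : TranslationBound ω f ε M)
    (hf : ∀ n, Measurable (f n)) (hε : Tendsto ε atTop (𝓝 0)) (hωo : IsOpen ω)
    (hωc : IsPreconnected ω) {x₀ : E} (hx₀ : x₀ ∈ ω) {r₀ : ℝ} (hr₀ : 0 < r₀)
    (h₀ : EventuallyL2Bounded f (Metric.ball x₀ r₀)) {K : Set E} (hK : IsCompact K) (hKω : K ⊆ ω) :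
    EventuallyL2Bounded f K := by
  set u : Set E := {x | ∃ r > 0, EventuallyL2Bounded f (Metric.ball x r)} with hu
  have huo : IsOpen u := by
    rw [Metric.isOpen_iff]
    rintro x ⟨r, hr, hx⟩
    refine ⟨r, hr, fun y hy => ⟨r - dist y x, sub_pos.2 hy, hx.mono ?_⟩⟩
    exact Metric.ball_subset_ball' (by linarith)
  have hωu : ω ⊆ u := by
    refine hωc.subset_of_closure_inter_subset huo ⟨x₀, hx₀, r₀, hr₀, h₀⟩ ?_
    rintro x ⟨hxu, hxω⟩
    obtain ⟨R, hR, hball⟩ := Metric.isOpen_iff.1 hωo x hxω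
    have hr : 0 < R / 9 := by positivity
    obtain ⟨y, ⟨r', hr', hy⟩, hxy⟩ := Metric.mem_closure_iff.1 hxu (R / 9) hr
    refine ⟨R / 9, hr, hB.eventuallyL2Bounded_ball hf hε hr hr' ?_ (Metric.mem_ball'.2 hxy) hy⟩
    rwa [mul_div_cancel₀ _ (by norm_num)]
  refine hK.induction_on (p := EventuallyL2Bounded f) ⟨0, by simp, by simp⟩
    (fun s t hst ht => ht.mono hst) (fun s t hs ht => hs.union ht) fun x hx => ?_
  obtain ⟨r, hr, hxr⟩ := hωu (hKω hx)
  exact ⟨_, mem_nhdsWithin_of_mem_nhds (Metric.ball_mem_nhds x hr), hxr⟩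

/-- After adding suitable constants, the functions are bounded in `L²` on compact sets. -/
theorem TranslationBound.exists_const_eventuallyL2Bounded (hB : TranslationBound ω f ε M)
    (hf : ∀ n, Measurable (f n)) (hε : Tendsto ε atTop (𝓝 0)) (hωo : IsOpen ω)
    (hωc : IsConnected ω) :
    ∃ c : ℕ → ℝ, ∀ K : Set E, IsCompact K → K ⊆ ω →
      EventuallyL2Bounded (fun n x => f n x + c n) K := by
  obtain ⟨x₀, hx₀⟩ := hωc.nonempty
  obtain ⟨R, hR, hball⟩ := Metric.isOpen_iff.1 hωo x₀ hx₀
  set r := R / 9 with hrdef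
  have hr : 0 < r := by positivity
  obtain ⟨C, hC, hCn⟩ := hB.lintegral_ball_ball_le hf hε hr (x := x₀)
    (by rwa [hrdef, mul_div_cancel₀ _ (by norm_num)])
  have hb0 : volume (Metric.ball x₀ r) ≠ 0 := (Metric.measure_ball_pos _ _ hr).ne'
  have hex : ∀ n, ∃ c : ℝ, ∫⁻ x in Metric.ball x₀ r, ‖f n x + c‖ₑ ^ 2 ≤
      (∫⁻ z in Metric.ball x₀ r, ∫⁻ w in Metric.ball x₀ r, ‖f n w - f n z‖ₑ ^ 2) /
        volume (Metric.ball x₀ r) := by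
    intro n
    have hm : Measurable fun z => ∫⁻ w in Metric.ball x₀ r, ‖f n w - f n z‖ₑ ^ 2 := by
      refine Measurable.lintegral_prod_right' (f := fun z => ‖f n z.2 - f n z.1‖ₑ ^ 2) ?_
      exact ((((hf n).comp measurable_snd).sub ((hf n).comp measurable_fst)).enorm).pow_const 2
    -- The constant is `-f n z` for a point `z` where the inner integral does not exceed its mean.
    obtain ⟨z, -, hz⟩ := exists_le_setLAverage hb0 measure_ball_lt_top.ne hm.aemeasurable
    rw [setLAverage_eq] at hz
    exact ⟨-f n z, by simpa [← sub_eq_add_neg] using hz⟩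
  choose c hc using hex
  refine ⟨c, fun K hK hKω => (hB.add_const c).eventuallyL2Bounded_of_isCompact
    (fun n => (hf n).add_const _) hε hωo hωc.isPreconnected hx₀ hr
    ⟨C / volume (Metric.ball x₀ r), ENNReal.div_ne_top hC hb0, ?_⟩ hK hKω⟩
  filter_upwards [hCn] with n hn
  exact (hc n).trans (ENNReal.div_le_div_right hn _)

end Planar

/-! ### Averages over balls. -/

section BallAverage

variable {E : Type*} [NormedAddCommGroup E] [NormedSpace ℝ E] [FiniteDimensional ℝ E]
  [MeasureSpace E] [BorelSpace E] [(volume : Measure E).IsAddHaarMeasure]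

/-- The uniform probability measure on the ball of radius `r` around the origin. -/
noncomputable def uniformBall (E : Type*) [NormedAddCommGroup E] [MeasureSpace E] (r : ℝ) :
    Measure E :=
  (volume (Metric.ball (0 : E) r))⁻¹ • volume.restrict (Metric.ball 0 r)

theorem isProbabilityMeasure_uniformBall {r : ℝ} (hr : 0 < r) :
    IsProbabilityMeasure (uniformBall E r) := by
  constructor
  simp only [uniformBall, Measure.smul_apply, Measure.restrict_apply_univ, smul_eq_mul]
  exact ENNReal.inv_mul_cancel (Metric.measure_ball_pos _ _ hr).ne' measure_ball_lt_top.ne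

/-- The average of `f` over the ball of radius `r` around `x`. -/
noncomputable def ballAverage (f : E → ℝ) (r : ℝ) (x : E) : ℝ :=
  ∫ h, f (x + h) ∂uniformBall E r

instance isFiniteMeasure_uniformBall {r : ℝ} : IsFiniteMeasure (uniformBall E r) := by
  rcases le_or_gt r 0 with hr | hr
  · constructor
    simp [uniformBall, Metric.ball_eq_empty.2 hr]
  · have := isProbabilityMeasure_uniformBall (E := E) hr
    infer_instance

variable {f : E → ℝ} {ω : Set E}

theorem measurable_ballAverage (hf : Measurable f) (r : ℝ) : Measurable (ballAverage f r) := by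
  have : Measurable fun z : E × E => f (z.1 + z.2) := hf.comp (measurable_fst.add measurable_snd)
  exact (this.stronglyMeasurable.integral_prod_right' (ν := uniformBall E r)).measurable

omit [NormedSpace ℝ E] [FiniteDimensional ℝ E] [BorelSpace E]
  [(volume : Measure E).IsAddHaarMeasure] in
theorem lintegral_uniformBall (F : E → ℝ≥0∞) (r : ℝ) :
    ∫⁻ h, F h ∂uniformBall E r =
      (volume (Metric.ball (0 : E) r))⁻¹ * ∫⁻ h in Metric.ball 0 r, F h := by
  rw [uniformBall, lintegral_smul_measure, smul_eq_mul]

/-- Jensen and Tonelli: the error of averaging is at most the mean of the translation errors. -/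
theorem lintegral_sub_ballAverage_le (hf : Measurable f) {r : ℝ} (hr : 0 < r) {A : Set E}
    {C : ℝ≥0∞} (h : ∀ v : E, ‖v‖ ≤ r → ∫⁻ x in A, ‖f (x + v) - f x‖ₑ ^ 2 ≤ C) :
    ∫⁻ x in A, ‖f x - ballAverage f r x‖ₑ ^ 2 ≤ C := by
  have := isProbabilityMeasure_uniformBall (E := E) hr
  have hm := measurable_enorm_add_sub_sq hf
  calc _ ≤ ∫⁻ x in A, ∫⁻ v, ‖f (x + v) - f x‖ₑ ^ 2 ∂uniformBall E r := by
        refine lintegral_mono fun x => ?_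
        have := enorm_integral_sub_sq_le (uniformBall E r) (p := fun v => f (x + v))
          (hf.comp (measurable_const_add x)).aestronglyMeasurable (f x)
        refine le_trans (le_of_eq ?_) this
        simp only [enorm_sq_eq_ofReal, sub_sq_comm (f x), ballAverage]
    _ = ∫⁻ v, ∫⁻ x in A, ‖f (x + v) - f x‖ₑ ^ 2 ∂volume ∂uniformBall E r :=
        lintegral_lintegral_swap hm.aemeasurable
    _ ≤ ∫⁻ _, C ∂uniformBall E r := by
        rw [lintegral_uniformBall, lintegral_uniformBall]
        refine mul_le_mul' le_rfl ?_
        refine setLIntegral_mono' measurableSet_ball fun v hv => h v ?_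
        rw [mem_ball_zero_iff] at hv
        exact hv.le
    _ = C := by simp

theorem integrable_uniformBall (hf : MemLp f 2 (volume.restrict ω)) {x : E} {r : ℝ} (hr : 0 < r)
    (hx : Metric.ball x r ⊆ ω) : Integrable (fun h => f (x + h)) (uniformBall E r) := by
  have h1 : IntegrableOn f (Metric.ball x r) :=
    haveI : IsFiniteMeasure (volume.restrict (Metric.ball x r)) :=
      ⟨by simpa using measure_ball_lt_top⟩
    (hf.mono_measure (Measure.restrict_mono hx le_rfl)).integrable (by norm_num)
  have h2 : IntegrableOn (f ∘ fun h => x + h) ((fun h => x + h) ⁻¹' Metric.ball x r) :=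
    ((measurePreserving_add_left volume x).integrableOn_comp_preimage
      (MeasurableEquiv.addLeft x).measurableEmbedding).2 h1
  have h3 : (fun h => x + h) ⁻¹' Metric.ball x r = Metric.ball 0 r := by
    ext h; simp
  rw [h3] at h2
  exact h2.integrable.smul_measure (ENNReal.inv_ne_top.2 (Metric.measure_ball_pos _ _ hr).ne')

theorem lintegral_ball_add (F : E → ℝ≥0∞) (x : E) (r : ℝ) :
    ∫⁻ h in Metric.ball 0 r, F (x + h) = ∫⁻ y in Metric.ball x r, F y := by
  have := (measurePreserving_add_left volume x).setLIntegral_comp_preimage_emb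
    (MeasurableEquiv.addLeft x).measurableEmbedding F (Metric.ball x r)
  rw [← this]
  congr 2
  ext h; simp

theorem enorm_ballAverage_sq_le (hf : Measurable f) {r : ℝ} (hr : 0 < r) (x : E) :
    ‖ballAverage f r x‖ₑ ^ 2 ≤
      (volume (Metric.ball (0 : E) r))⁻¹ * ∫⁻ y in Metric.ball x r, ‖f y‖ₑ ^ 2 := by
  have := isProbabilityMeasure_uniformBall (E := E) hr
  have h1 := enorm_integral_sub_sq_le (uniformBall E r) (p := fun v => f (x + v))
    (hf.comp (measurable_const_add x)).aestronglyMeasurable 0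
  simp only [sub_zero] at h1
  rw [lintegral_uniformBall, lintegral_ball_add (fun y => ‖f y‖ₑ ^ 2)] at h1
  exact h1

/-- Jensen turns the difference of two averages into an `L²` translation difference over one ball.
At a fixed radius this makes the averages asymptotically equicontinuous. -/
theorem abs_ballAverage_sub_le (hf : Measurable f) (hfL : MemLp f 2 (volume.restrict ω)) {r : ℝ}
    (hr : 0 < r) {x y : E} (hx : Metric.ball x r ⊆ ω) (hy : Metric.ball y r ⊆ ω) {M t : ℝ}
    (hM : 0 ≤ M) (ht : 0 ≤ t)
    (h : ∫⁻ z in Metric.ball y r, ‖f (z + (x - y)) - f z‖ₑ ^ 2 ≤ ENNReal.ofReal ((M * t) ^ 2)) :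
    |ballAverage f r x - ballAverage f r y| ≤
      M / √(volume (Metric.ball (0 : E) r)).toReal * t := by
  have := isProbabilityMeasure_uniformBall (E := E) hr
  have hb0 : volume (Metric.ball (0 : E) r) ≠ 0 := (Metric.measure_ball_pos _ _ hr).ne'
  have hbt : volume (Metric.ball (0 : E) r) ≠ ∞ := measure_ball_lt_top.ne
  set b := volume (Metric.ball (0 : E) r)
  have hb : 0 < b.toReal := ENNReal.toReal_pos hb0 hbt
  have h1 : ballAverage f r x - ballAverage f r y =
      ∫ v, (f (x + v) - f (y + v)) ∂uniformBall E r :=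
    (integral_sub (integrable_uniformBall hfL hr hx) (integrable_uniformBall hfL hr hy)).symm
  have h2 := enorm_integral_sub_sq_le (uniformBall E r) (p := fun v => f (x + v) - f (y + v))
    ((hf.comp (measurable_const_add x)).sub (hf.comp
        (measurable_const_add y))).aestronglyMeasurable 0
  simp only [sub_zero] at h2
  rw [← h1, lintegral_uniformBall] at h2
  have h3 := lintegral_ball_add (fun z => ‖f (z + (x - y)) - f z‖ₑ ^ 2) y r
  have h4 : ∀ v : E, y + v + (x - y) = x + v := fun v => by abel
  simp only [h4] at h3
  rw [h3] at h2
  have h5 := h2.trans (mul_le_mul' le_rfl h)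
  rw [enorm_sq_eq_ofReal, ← ENNReal.ofReal_toReal (ENNReal.inv_ne_top.2 hb0),
    ← ENNReal.ofReal_mul ENNReal.toReal_nonneg, ENNReal.ofReal_le_ofReal_iff (by positivity),
    ENNReal.toReal_inv] at h5
  refine abs_le_of_sq_le_sq ?_ (by positivity)
  refine h5.trans_eq ?_
  rw [mul_pow, mul_pow, div_pow, Real.sq_sqrt hb.le]
  ring

end BallAverage

/-! ### Convergence of the averages along a subsequence. -/

section Compactness

variable {E : Type*} [NormedAddCommGroup E] [NormedSpace ℝ E] [FiniteDimensional ℝ E]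
  [MeasureSpace E] [BorelSpace E] [(volume : Measure E).IsAddHaarMeasure]
  {ω : Set E} {f : ℕ → E → ℝ} {ε : ℕ → ℝ} {M : ℝ≥0}

/-- Along a subsequence, countably many eventually bounded sequences converge. -/
theorem exists_strictMono_forall_tendsto {ι : Type*} [Countable ι] (a : ℕ → ι → ℝ)
    (h : ∀ i, ∃ R, ∀ᶠ n in atTop, |a n i| ≤ R) :
    ∃ φ : ℕ → ℕ, StrictMono φ ∧ ∀ i, ∃ l, Tendsto (fun n => a (φ n) i) atTop (𝓝 l) := by
  have h' : ∀ i, ∃ R, ∀ n, |a n i| ≤ R := by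
    intro i
    obtain ⟨R, hR⟩ := h i
    obtain ⟨N, hN⟩ := eventually_atTop.1 hR
    refine ⟨R ⊔ ∑ n ∈ Finset.range N, |a n i|, fun n => ?_⟩
    rcases le_or_gt N n with hn | hn
    · exact (hN n hn).trans le_sup_left
    · exact (Finset.single_le_sum (f := fun n => |a n i|) (fun _ _ => abs_nonneg _)
        (Finset.mem_range.2 hn)).trans le_sup_right
  choose R hR using h'
  -- A countable product of compact intervals is compact and metrizable, which replaces an explicit
  -- diagonal argument.
  have hc : IsCompact (Set.pi univ fun i => Icc (-R i) (R i)) :=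
    isCompact_univ_pi fun i => isCompact_Icc
  obtain ⟨l, -, φ, hφ, hl⟩ := hc.tendsto_subseq (x := a) fun n i _ => abs_le.1 (hR i n)
  exact ⟨φ, hφ, fun i => ⟨l i, (tendsto_pi_nhds.1 hl) i⟩⟩

/-- Dense centres and radii `1 / (k + 1)` leave only countably many averages, each eventually
bounded by the local `L²` bound. -/
theorem exists_subseq_ballAverage_tendsto (hf : ∀ n, Measurable (f n))
    (hbdd : ∀ K : Set E, IsCompact K → K ⊆ ω → EventuallyL2Bounded f K) :
    ∃ φ : ℕ → ℕ, StrictMono φ ∧ ∀ p k : ℕ,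
      Metric.closedBall (TopologicalSpace.denseSeq E p) (1 / ((k : ℝ) + 1)) ⊆ ω →
      ∃ l, Tendsto (fun n => ballAverage (f (φ n)) (1 / ((k : ℝ) + 1))
        (TopologicalSpace.denseSeq E p)) atTop (𝓝 l) := by
  let ι := {i : ℕ × ℕ //
    Metric.closedBall (TopologicalSpace.denseSeq E i.1) (1 / ((i.2 : ℝ) + 1)) ⊆ ω}
  have hι : ∀ i : ι, ∃ R, ∀ᶠ n in atTop, |ballAverage (f n) (1 / ((i.1.2 : ℝ) + 1))
      (TopologicalSpace.denseSeq E i.1.1)| ≤ R := by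
    rintro ⟨⟨p, k⟩, hpk⟩
    have hr : (0 : ℝ) < 1 / ((k : ℝ) + 1) := by positivity
    obtain ⟨C, hC, hn⟩ := hbdd _ (isCompact_closedBall _ _) hpk
    set b := volume (Metric.ball (0 : E) (1 / ((k : ℝ) + 1))) with hb
    have hb0 : b⁻¹ ≠ ∞ := ENNReal.inv_ne_top.2 (Metric.measure_ball_pos _ _ hr).ne'
    refine ⟨√(b⁻¹ * C).toReal, hn.mono fun n hn => ?_⟩
    refine Real.abs_le_sqrt ?_
    have h1 := (enorm_ballAverage_sq_le (hf n) hr (TopologicalSpace.denseSeq E p)).trans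
      (mul_le_mul' le_rfl ((lintegral_mono_set Metric.ball_subset_closedBall).trans hn))
    rw [enorm_sq_eq_ofReal] at h1
    exact (ENNReal.ofReal_le_iff_le_toReal (ENNReal.mul_ne_top hb0 hC)).1 h1
  obtain ⟨φ, hφ, h⟩ := exists_strictMono_forall_tendsto (ι := ι)
    (fun n i => ballAverage (f n) (1 / ((i.1.2 : ℝ) + 1)) (TopologicalSpace.denseSeq E i.1.1)) hι
  exact ⟨φ, hφ, fun p k hpk => h ⟨(p, k), hpk⟩⟩

/-- Uniform convergence of averages at a fixed scale. -/
theorem TranslationBound.eventually_abs_ballAverage_sub_le (hB : TranslationBound ω f ε M)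
    (hf : ∀ n, Measurable (f n)) (hfL : ∀ n, MemLp (f n) 2 (volume.restrict ω))
    (hε : Tendsto ε atTop (𝓝 0)) (hε0 : ∀ n, 0 < ε n) (hωb : Bornology.IsBounded ω) {k : ℕ} {δ : ℝ}
    (hδ : 0 < δ) (hk : 1 / ((k : ℝ) + 1) ≤ δ)
    (hlim : ∀ p : ℕ, Metric.closedBall (TopologicalSpace.denseSeq E p) (1 / ((k : ℝ) + 1)) ⊆ ω →
      ∃ l, Tendsto (fun n => ballAverage (f n) (1 / ((k : ℝ) + 1))
        (TopologicalSpace.denseSeq E p)) atTop (𝓝 l)) {κ : ℝ} (hκ : 0 < κ) :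
    ∃ N : ℕ, ∀ n ≥ N, ∀ n' ≥ N, ∀ x ∈ innerCore ω (4 * δ),
      |ballAverage (f n) (1 / ((k : ℝ) + 1)) x - ballAverage (f n') (1 / ((k : ℝ) + 1)) x| ≤ κ := by
  set r : ℝ := 1 / ((k : ℝ) + 1) with hrdef
  have hr : 0 < r := by positivity
  set q := TopologicalSpace.denseSeq E
  set L : ℝ := M / √(volume (Metric.ball (0 : E) r)).toReal with hL
  have hL0 : 0 ≤ L := by positivity
  -- `ζ` is both the mesh of the finite cover and an eventual bound for `ε n`; passing to the
  -- nearest centre then costs `L * (ζ + ζ) ≤ κ / 4`.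
  obtain ⟨ζ, hζ0, hζδ, hζ⟩ : ∃ ζ > 0, ζ ≤ δ / 2 ∧ L * (ζ + ζ) ≤ κ / 4 := by
    refine ⟨min (δ / 2) (κ / (8 * (L + 1))), by positivity, min_le_left _ _, ?_⟩
    have h1 := min_le_right (δ / 2) (κ / (8 * (L + 1)))
    have h2 : L * (κ / (8 * (L + 1))) ≤ κ / 8 := by
      rw [mul_div_assoc', div_le_div_iff₀ (by positivity) (by positivity)]
      nlinarith
    nlinarith
  have hcomp : IsCompact (innerCore ω (4 * δ)) := isCompact_innerCore hωb (by positivity)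
  obtain ⟨t, ht⟩ := hcomp.elim_finite_subcover (fun p : ℕ => Metric.ball (q p) ζ)
    (fun p => Metric.isOpen_ball) fun x _ => by
      obtain ⟨_, ⟨p, rfl⟩, hp⟩ := Metric.mem_closure_iff.1
        (TopologicalSpace.denseRange_denseSeq E x) ζ hζ0
      exact mem_iUnion.2 ⟨p, hp⟩
  have hlim' : ∀ p, ∃ l : ℝ, Metric.closedBall (q p) r ⊆ ω →
      Tendsto (fun n => ballAverage (f n) r (q p)) atTop (𝓝 l) := fun p => by
    by_cases hp : Metric.closedBall (q p) r ⊆ ω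
    · obtain ⟨l, hl⟩ := hlim p hp
      exact ⟨l, fun _ => hl⟩
    · exact ⟨0, fun h => absurd h hp⟩
  choose l hl using hlim'
  have hev : ∀ᶠ n in atTop, ∀ p ∈ t, Metric.closedBall (q p) r ⊆ ω →
      |ballAverage (f n) r (q p) - l p| ≤ κ / 4 := by
    rw [eventually_all_finset]
    intro p _
    by_cases hp : Metric.closedBall (q p) r ⊆ ω
    · filter_upwards [Metric.tendsto_nhds.1 (hl p hp) (κ / 4) (by positivity)] with n hn _
      exact hn.le
    · exact Eventually.of_forall fun n h => absurd h hp
  obtain ⟨N, hN⟩ := eventually_atTop.1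
    (hev.and ((hB (δ / 2) (by positivity)).and (hε.eventually (ge_mem_nhds hζ0))))
  have key : ∀ n ≥ N, ∀ x ∈ innerCore ω (4 * δ), ∀ p ∈ t, x ∈ Metric.ball (q p) ζ →
      |ballAverage (f n) r x - l p| ≤ κ / 2 := by
    intro n hn x hx p hp hxp
    obtain ⟨h1, h2, h3⟩ := hN n hn
    have hdist : dist (q p) x < ζ := Metric.mem_ball'.1 hxp
    have hqω : Metric.closedBall (q p) r ⊆ ω :=
      (Metric.closedBall_subset_ball' (by linarith)).trans (mem_innerCore_iff.1 hx)
    have hxω : Metric.ball x r ⊆ ω :=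
      (Metric.ball_subset_ball (by linarith)).trans (mem_innerCore_iff.1 hx)
    have hlip := abs_ballAverage_sub_le (hf n) (hfL n) hr (x := q p) (y := x)
      (Metric.ball_subset_closedBall.trans hqω) hxω (M := M) (t := ‖q p - x‖ + ε n) M.2
      (by have := hε0 n; positivity) ?_
    · have h4 : |ballAverage (f n) r x - ballAverage (f n) r (q p)| ≤ κ / 4 := by
        rw [abs_sub_comm]
        refine hlip.trans (le_trans ?_ hζ)
        rw [← dist_eq_norm]
        gcongr
      have h5 := h1 p hp hqω
      calc _ ≤ |ballAverage (f n) r x - ballAverage (f n) r (q p)| +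
            |ballAverage (f n) r (q p) - l p| := abs_sub_le _ _ _
        _ ≤ κ / 2 := by linarith
    · refine (lintegral_mono_set ?_).trans ((h2 (q p - x) ?_).trans_eq ?_)
      · intro z hz
        rw [Metric.mem_ball] at hz
        exact mem_innerCore_of_dist hx (by linarith)
      · rw [← dist_eq_norm]; linarith
      · rw [ENNReal.ofReal_pow (by have := hε0 n; positivity), ENNReal.ofReal_mul M.coe_nonneg,
          ENNReal.ofReal_coe_nnreal]
  refine ⟨N, fun n hn n' hn' x hx => ?_⟩
  obtain ⟨p, hp⟩ := mem_iUnion.1 (ht hx)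
  obtain ⟨hpt, hxp⟩ := mem_iUnion.1 hp
  have h1 := key n hn x hx p hpt hxp
  have h2 := key n' hn' x hx p hpt hxp
  calc _ ≤ |ballAverage (f n) r x - l p| + |l p - ballAverage (f n') r x| := abs_sub_le _ _ _
    _ ≤ κ := by rw [abs_sub_comm (l p)]; linarith

omit [NormedAddCommGroup E] [NormedSpace ℝ E] [FiniteDimensional ℝ E] [BorelSpace E]
  [(volume : Measure E).IsAddHaarMeasure] in
theorem eLpNorm_two_le_of_lintegral_le [NormedAddCommGroup E] {g : E → ℝ} {A : Set E} {C : ℝ≥0∞}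
    (h : ∫⁻ x in A, ‖g x‖ₑ ^ 2 ≤ C ^ 2) : eLpNorm g 2 (volume.restrict A) ≤ C := by
  rw [← eLpNorm_two_sq] at h
  exact (ENNReal.pow_le_pow_left_iff two_ne_zero).1 h

end Compactness

/-! ### The limit function in `L²` on interior sets. -/

section Limit

variable {E : Type*} [NormedAddCommGroup E] [NormedSpace ℝ E] [FiniteDimensional ℝ E]
  [MeasureSpace E] [BorelSpace E] [(volume : Measure E).IsAddHaarMeasure]
  {ω : Set E} {f : ℕ → E → ℝ} {ε : ℕ → ℝ} {M : ℝ≥0}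

/-- Three-term splitting: at a small fixed radius each function is `κ / 3`-close to its ball average
by the translation bound, and the averages are uniformly Cauchy on the core. -/
theorem TranslationBound.eventually_eLpNorm_sub_le (hB : TranslationBound ω f ε M)
    (hf : ∀ n, Measurable (f n)) (hfL : ∀ n, MemLp (f n) 2 (volume.restrict ω))
    (hε : Tendsto ε atTop (𝓝 0)) (hε0 : ∀ n, 0 < ε n) (hωb : Bornology.IsBounded ω)
    (hlim : ∀ p k : ℕ, Metric.closedBall (TopologicalSpace.denseSeq E p) (1 / ((k : ℝ) + 1)) ⊆ ω →
      ∃ l, Tendsto (fun n => ballAverage (f n) (1 / ((k : ℝ) + 1))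
        (TopologicalSpace.denseSeq E p)) atTop (𝓝 l)) {δ : ℝ} (hδ : 0 < δ) {κ : ℝ} (hκ : 0 < κ) :
    ∃ N : ℕ, ∀ n ≥ N, ∀ n' ≥ N,
      eLpNorm (f n - f n') 2 (volume.restrict (innerCore ω (4 * δ))) ≤ ENNReal.ofReal κ := by
  set μ := volume.restrict (innerCore ω (4 * δ)) with hμ
  have hμt : μ univ ≠ ∞ := by
    rw [hμ, Measure.restrict_apply_univ]
    exact (isCompact_innerCore hωb (by positivity)).measure_lt_top.ne
  set V : ℝ≥0∞ := μ univ ^ ((2 : ℝ≥0∞).toReal⁻¹) with hV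
  have hVt : V ≠ ∞ := ENNReal.rpow_ne_top_of_nonneg (by positivity) hμt
  -- A uniform bound `κ'` costs `V * κ' ≤ κ / 3` in `L²`, where `V` is the square root of the volume
  -- of the core.
  set κ' : ℝ := κ / (3 * (V.toReal + 1)) with hκ'
  have hκ'0 : 0 < κ' := by positivity
  have hVκ : V * ENNReal.ofReal κ' ≤ ENNReal.ofReal (κ / 3) := by
    rw [← ENNReal.ofReal_toReal hVt, ← ENNReal.ofReal_mul ENNReal.toReal_nonneg]
    refine ENNReal.ofReal_le_ofReal ?_
    have : 0 ≤ V.toReal := ENNReal.toReal_nonneg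
    rw [hκ', mul_div_assoc', div_le_div_iff₀ (by positivity) (by positivity)]
    nlinarith
  obtain ⟨ζ, hζ0, hζδ, hζ⟩ : ∃ ζ > 0, ζ ≤ δ ∧ M * (ζ + ζ) ≤ κ / 3 := by
    refine ⟨min δ (κ / (6 * (M + 1))), by positivity, min_le_left _ _, ?_⟩
    have h1 := min_le_right δ (κ / (6 * ((M : ℝ) + 1)))
    have h2 : M * (κ / (6 * ((M : ℝ) + 1))) ≤ κ / 6 := by
      rw [mul_div_assoc', div_le_div_iff₀ (by positivity) (by positivity)]
      nlinarith [M.coe_nonneg]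
    nlinarith [M.coe_nonneg]
  obtain ⟨k, hk⟩ := exists_nat_one_div_lt hζ0
  set r : ℝ := 1 / ((k : ℝ) + 1) with hr
  have hr0 : 0 < r := by positivity
  obtain ⟨N, hN⟩ := hB.eventually_abs_ballAverage_sub_le hf hfL hε hε0 hωb hδ
    (hk.le.trans hζδ) (fun p => hlim p k) hκ'0
  obtain ⟨N', hN'⟩ := eventually_atTop.1 ((hB δ hδ).and (hε.eventually (ge_mem_nhds hζ0)))
  have happrox : ∀ n ≥ N', eLpNorm (f n - ballAverage (f n) r) 2 μ ≤ ENNReal.ofReal (κ / 3) := by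
    intro n hn
    obtain ⟨h1, h2⟩ := hN' n hn
    refine eLpNorm_two_le_of_lintegral_le (lintegral_sub_ballAverage_le (hf n) hr0 fun v hv =>
      (h1 v (by linarith)).trans ?_)
    refine pow_le_pow_left' ?_ 2
    rw [← ENNReal.ofReal_coe_nnreal, ← ENNReal.ofReal_mul M.coe_nonneg]
    refine ENNReal.ofReal_le_ofReal (le_trans ?_ hζ)
    have := M.coe_nonneg
    gcongr
    linarith
  have hmA : ∀ n, AEStronglyMeasurable (ballAverage (f n) r) μ := fun n =>
    (measurable_ballAverage (hf n) r).aestronglyMeasurable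
  have hmf : ∀ n, AEStronglyMeasurable (f n) μ := fun n => (hf n).aestronglyMeasurable
  refine ⟨max N N', fun n hn n' hn' => ?_⟩
  have e1 := happrox n (le_of_max_le_right hn)
  have e2 := happrox n' (le_of_max_le_right hn')
  have e3 : eLpNorm (ballAverage (f n) r - ballAverage (f n') r) 2 μ ≤ ENNReal.ofReal (κ / 3) := by
    refine (eLpNorm_le_of_ae_bound (C := κ') ?_).trans hVκ
    refine (ae_restrict_mem (measurableSet_innerCore _)).mono fun x hx => ?_
    exact hN n (le_of_max_le_left hn) n' (le_of_max_le_left hn') x hx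
  rw [eLpNorm_sub_comm] at e2
  have hdecomp : f n - f n' = (f n - ballAverage (f n) r) +
      ((ballAverage (f n) r - ballAverage (f n') r) + (ballAverage (f n') r - f n')) := by
    abel
  rw [hdecomp]
  calc _ ≤ eLpNorm (f n - ballAverage (f n) r) 2 μ +
        (eLpNorm (ballAverage (f n) r - ballAverage (f n') r) 2 μ +
          eLpNorm (ballAverage (f n') r - f n') 2 μ) :=
        (eLpNorm_add_le ((hmf n).sub (hmA n)) (((hmA n).sub (hmA n')).add ((hmA n').sub (hmf n')))
          (by norm_num)).trans (add_le_add le_rfl (eLpNorm_add_le ((hmA n).sub (hmA n'))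
          ((hmA n').sub (hmf n')) (by norm_num)))
    _ ≤ ENNReal.ofReal (κ / 3) + (ENNReal.ofReal (κ / 3) + ENNReal.ofReal (κ / 3)) := by gcongr
    _ = ENNReal.ofReal κ := by
        rw [← ENNReal.ofReal_add (by positivity) (by positivity),
          ← ENNReal.ofReal_add (by positivity) (by positivity)]
        congr 1
        ring

omit [NormedAddCommGroup E] [NormedSpace ℝ E] [FiniteDimensional ℝ E] [BorelSpace E]
  [(volume : Measure E).IsAddHaarMeasure] in
theorem exists_eLpNorm_tendsto_of_cauchy {α : Type*} [MeasurableSpace α] {μ : Measure α}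
    {g : ℕ → α → ℝ} (hg : ∀ n, MemLp (g n) 2 μ)
    (hc : ∀ κ : ℝ, 0 < κ → ∃ N : ℕ, ∀ n ≥ N, ∀ n' ≥ N,
      eLpNorm (g n - g n') 2 μ ≤ ENNReal.ofReal κ) :
    ∃ v : α → ℝ, MemLp v 2 μ ∧ Tendsto (fun n => eLpNorm (g n - v) 2 μ) atTop (𝓝 0) := by
  have hcs : CauchySeq fun n => (hg n).toLp := by
    rw [Metric.cauchySeq_iff]
    intro κ hκ
    obtain ⟨N, hN⟩ := hc (κ / 2) (by positivity)
    refine ⟨N, fun n hn n' hn' => ?_⟩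
    rw [dist_edist, Lp.edist_toLp_toLp]
    refine (ENNReal.toReal_mono ENNReal.ofReal_ne_top (hN n hn n' hn')).trans_lt ?_
    rw [ENNReal.toReal_ofReal (by positivity)]
    linarith
  obtain ⟨v, hv⟩ := cauchySeq_tendsto_of_complete hcs
  refine ⟨v, Lp.memLp v, ?_⟩
  have := (Lp.tendsto_Lp_iff_tendsto_eLpNorm'' (fun n => g n) hg v (Lp.memLp v)).1
    (by simpa using hv)
  exact this

/-- Local `L²`-limits on the sets of an exhaustion are restrictions of a single function. -/
theorem exists_limit_of_forall_innerCore (hf : ∀ n, Measurable (f n))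
    (h : ∀ δ > 0, ∃ v : E → ℝ, MemLp v 2 (volume.restrict (innerCore ω δ)) ∧
      Tendsto (fun n => eLpNorm (f n - v) 2 (volume.restrict (innerCore ω δ))) atTop (𝓝 0)) :
    ∃ u₀ : E → ℝ, ∀ δ > 0, MemLp u₀ 2 (volume.restrict (innerCore ω δ)) ∧
      Tendsto (fun n => eLpNorm (f n - u₀) 2 (volume.restrict (innerCore ω δ))) atTop (𝓝 0) := by
  classical
  have hpos : ∀ j : ℕ, (0 : ℝ) < 1 / ((j : ℝ) + 1) := fun j => by positivity
  choose v hvL hv using fun j : ℕ => h _ (hpos j)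
  have hanti : ∀ i j : ℕ, i ≤ j →
      innerCore ω (1 / ((i : ℝ) + 1)) ⊆ innerCore ω (1 / ((j : ℝ) + 1)) := fun i j hij =>
    innerCore_anti (one_div_le_one_div_of_le (by positivity) (by
      have : (i : ℝ) ≤ j := by exact_mod_cast hij
      linarith))
  have hagree : ∀ i j : ℕ, i ≤ j →
      v i =ᵐ[volume.restrict (innerCore ω (1 / ((i : ℝ) + 1)))] v j := by
    intro i j hij
    set μ := volume.restrict (innerCore ω (1 / ((i : ℝ) + 1)))
    have hle : μ ≤ volume.restrict (innerCore ω (1 / ((j : ℝ) + 1))) :=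
      Measure.restrict_mono (hanti i j hij) le_rfl
    have hj : MemLp (v j) 2 μ := (hvL j).mono_measure hle
    have hmf : ∀ n, AEStronglyMeasurable (f n) μ := fun n => (hf n).aestronglyMeasurable
    have h0 : eLpNorm (v i - v j) 2 μ ≤ 0 := by
      have ht : Tendsto (fun n => eLpNorm (f n - v i) 2 μ + eLpNorm (f n - v j) 2 μ) atTop
          (𝓝 (0 + 0)) := (hv i).add (tendsto_of_tendsto_of_tendsto_of_le_of_le tendsto_const_nhds
          (hv j) (fun _ => zero_le) fun n => eLpNorm_mono_measure _ hle)
      rw [add_zero] at ht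
      refine ge_of_tendsto' ht fun n => ?_
      rw [show v i - v j = (v i - f n) + (f n - v j) by abel, eLpNorm_sub_comm (f n) (v i)]
      exact eLpNorm_add_le ((hvL i).1.sub (hmf n)) ((hmf n).sub hj.1) (by norm_num)
    have h1 := (eLpNorm_eq_zero_iff ((hvL i).1.sub hj.1) (by norm_num)).1 (le_antisymm h0 zero_le)
    exact h1.mono fun x hx => sub_eq_zero.1 hx
  -- At `x` the limit belonging to the first core containing `x` is taken. Limits on different cores
  -- agree almost everywhere where both apply, so countably many null sets are discarded.
  set u₀ : E → ℝ := fun x =>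
    if hx : ∃ j : ℕ, x ∈ innerCore ω (1 / ((j : ℝ) + 1)) then v (Nat.find hx) x else 0 with hu₀
  have hu : ∀ J : ℕ, u₀ =ᵐ[volume.restrict (innerCore ω (1 / ((J : ℝ) + 1)))] v J := by
    intro J
    have hall : ∀ i : ℕ, i ≤ J → ∀ᵐ x ∂volume.restrict (innerCore ω (1 / ((J : ℝ) + 1))),
        x ∈ innerCore ω (1 / ((i : ℝ) + 1)) → v i x = v J x := by
      intro i hi
      refine ae_restrict_of_ae ?_
      exact (ae_restrict_iff' (measurableSet_innerCore _)).1 (hagree i J hi)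
    have hall' : ∀ᵐ x ∂volume.restrict (innerCore ω (1 / ((J : ℝ) + 1))), ∀ i : ℕ, i ≤ J →
        x ∈ innerCore ω (1 / ((i : ℝ) + 1)) → v i x = v J x := by
      rw [ae_all_iff]
      intro i
      by_cases hi : i ≤ J
      · exact (hall i hi).mono fun x hx _ => hx
      · exact ae_of_all _ fun x h => absurd h hi
    filter_upwards [hall', ae_restrict_mem (measurableSet_innerCore _)] with x hx hxJ
    have hex : ∃ j : ℕ, x ∈ innerCore ω (1 / ((j : ℝ) + 1)) := ⟨J, hxJ⟩
    rw [hu₀]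
    simp only [dif_pos hex]
    exact hx _ (Nat.find_min' hex hxJ) (Nat.find_spec hex)
  refine ⟨u₀, fun δ hδ => ?_⟩
  obtain ⟨J, hJ⟩ := exists_nat_one_div_lt hδ
  have hle : volume.restrict (innerCore ω δ) ≤ volume.restrict (innerCore ω (1 / ((J : ℝ) + 1))) :=
    Measure.restrict_mono (innerCore_anti hJ.le) le_rfl
  refine ⟨((memLp_congr_ae (hu J)).2 (hvL J)).mono_measure hle, ?_⟩
  refine tendsto_of_tendsto_of_tendsto_of_le_of_le tendsto_const_nhds (hv J) (fun _ => zero_le)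
    fun n => (eLpNorm_mono_measure _ hle).trans_eq (eLpNorm_congr_ae ?_)
  exact (hu J).mono fun x hx => by simp [hx]

/-- Compactness in `L²_loc` of functions with a common `L²`-modulus of continuity. -/
theorem TranslationBound.exists_subseq_limit (hB : TranslationBound ω f ε M)
    (hf : ∀ n, Measurable (f n)) (hfL : ∀ n, MemLp (f n) 2 (volume.restrict ω))
    (hε : Tendsto ε atTop (𝓝 0)) (hε0 : ∀ n, 0 < ε n) (hωb : Bornology.IsBounded ω)
    (hbdd : ∀ K : Set E, IsCompact K → K ⊆ ω → EventuallyL2Bounded f K) :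
    ∃ φ : ℕ → ℕ, StrictMono φ ∧ ∃ u₀ : E → ℝ, ∀ δ > 0,
      MemLp u₀ 2 (volume.restrict (innerCore ω δ)) ∧
      Tendsto (fun n => eLpNorm (f (φ n) - u₀) 2 (volume.restrict (innerCore ω δ))) atTop
          (𝓝 0) := by
  obtain ⟨φ, hφ, hlim⟩ := exists_subseq_ballAverage_tendsto hf hbdd
  refine ⟨φ, hφ, exists_limit_of_forall_innerCore (fun n => hf (φ n)) fun δ hδ => ?_⟩
  have h4 : 4 * (δ / 4) = δ := by ring
  have hc := fun κ (hκ : 0 < κ) => (hB.comp_strictMono hφ).eventually_eLpNorm_sub_le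
    (fun n => hf (φ n)) (fun n => hfL (φ n)) (hε.comp hφ.tendsto_atTop) (fun n => hε0 (φ n)) hωb
    hlim (δ := δ / 4) (by positivity) hκ
  rw [h4] at hc
  exact exists_eLpNorm_tendsto_of_cauchy
    (fun n => (hfL (φ n)).mono_measure (Measure.restrict_mono (innerCore_subset hδ) le_rfl)) hc

/-- The limit inherits the translation estimate. -/
theorem TranslationBound.eLpNorm_limit_translate_le (hB : TranslationBound ω f ε M)
    (hf : ∀ n, Measurable (f n)) (hε : Tendsto ε atTop (𝓝 0)) {u₀ : E → ℝ}
    (hu : ∀ δ > 0, MemLp u₀ 2 (volume.restrict (innerCore ω δ)) ∧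
      Tendsto (fun n => eLpNorm (f n - u₀) 2 (volume.restrict (innerCore ω δ))) atTop (𝓝 0))
    {δ : ℝ} (hδ : 0 < δ) {h : E} (hh : ‖h‖ ≤ δ) :
    eLpNorm (fun x => u₀ (x + h) - u₀ x) 2 (volume.restrict (innerCore ω (4 * δ))) ≤
      M * ENNReal.ofReal ‖h‖ := by
  set μ := volume.restrict (innerCore ω (4 * δ)) with hμ
  set μ' := volume.restrict (innerCore ω (3 * δ)) with hμ'
  have hmaps : ∀ x ∈ innerCore ω (4 * δ), x + h ∈ innerCore ω (3 * δ) := fun x hx =>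
    mem_innerCore_of_dist hx (by rw [dist_self_add_left]; linarith)
  have hqmp : Measure.QuasiMeasurePreserving (fun x => x + h) μ μ' := by
    refine ⟨measurable_add_const h, Measure.AbsolutelyContinuous.mk fun s hs h0 => ?_⟩
    rw [Measure.map_apply (measurable_add_const h) hs, hμ,
      Measure.restrict_apply (measurable_add_const h hs)]
    rw [hμ', Measure.restrict_apply hs] at h0
    refine measure_mono_null (t := (fun x => x + h) ⁻¹' (s ∩ innerCore ω (3 * δ)))
      (fun x hx => ⟨hx.1, hmaps x hx.2⟩) ?_
    rwa [measure_preimage_add_right]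
  have hu4 := hu (4 * δ) (by positivity)
  have hu3 := hu (3 * δ) (by positivity)
  have htr : ∀ n, eLpNorm (fun x => (u₀ - f n) (x + h)) 2 μ ≤ eLpNorm (f n - u₀) 2 μ' := by
    intro n
    refine eLpNorm_two_le_of_lintegral_le ?_
    rw [eLpNorm_sub_comm, eLpNorm_two_sq]
    exact setLIntegral_add_right_le (volume : Measure E) (F := fun x => ‖(u₀ - f n) x‖ₑ ^ 2) hmaps
  have hlimit : Tendsto (fun n => eLpNorm (f n - u₀) 2 μ' +
      (M * ENNReal.ofReal (‖h‖ + ε n) + eLpNorm (f n - u₀) 2 μ)) atTop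
      (𝓝 (0 + (M * ENNReal.ofReal (‖h‖ + 0) + 0))) := by
    refine hu3.2.add (Tendsto.add ?_ hu4.2)
    exact ENNReal.Tendsto.const_mul (ENNReal.tendsto_ofReal (hε.const_add ‖h‖))
      (Or.inr ENNReal.coe_ne_top)
  simp only [add_zero, zero_add] at hlimit
  refine ge_of_tendsto hlimit ?_
  filter_upwards [hB δ hδ] with n hn
  have hm1 : AEStronglyMeasurable (fun x => (u₀ - f n) (x + h)) μ :=
    (hu3.1.1.sub (hf n).aestronglyMeasurable).comp_quasiMeasurePreserving hqmp
  have hm2 : AEStronglyMeasurable (fun x => f n (x + h) - f n x) μ :=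
    (((hf n).comp (measurable_add_const h)).sub (hf n)).aestronglyMeasurable
  have hm3 : AEStronglyMeasurable (f n - u₀) μ := (hf n).aestronglyMeasurable.sub hu4.1.1
  -- The outer two terms vanish in the limit, and the middle one is bounded by `M (‖h‖ + ε n)`.
  have hdec : (fun x => u₀ (x + h) - u₀ x) = (fun x => (u₀ - f n) (x + h)) +
      ((fun x => f n (x + h) - f n x) + (f n - u₀)) := by
    ext x
    simp
  rw [hdec]
  refine (eLpNorm_add_le hm1 (hm2.add hm3) (by norm_num)).trans (add_le_add (htr n) ?_)
  exact (eLpNorm_add_le hm2 hm3 (by norm_num)).trans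
    (add_le_add (eLpNorm_two_le_of_lintegral_le (hn h hh)) le_rfl)

end Limit

/-! ### Square integrability up to a Lipschitz boundary. -/

section Boundary

variable {m : ℕ} {ω : Set (EuclideanSpace ℝ (Fin m))}

variable {u : EuclideanSpace ℝ (Fin m) → ℝ} {M : ℝ≥0}

/-- Translation estimate along segments which stay at positive distance from the boundary. -/
theorem lintegral_translate_le_of_segment (hu : Measurable u)
    (hT : ∀ δ > 0, ∀ h : EuclideanSpace ℝ (Fin m), ‖h‖ ≤ δ →
      ∫⁻ x in innerCore ω (4 * δ), ‖u (x + h) - u x‖ₑ ^ 2 ≤ (M * ENNReal.ofReal ‖h‖) ^ 2)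
    {A : Set (EuclideanSpace ℝ (Fin m))} {h : EuclideanSpace ℝ (Fin m)} {η : ℝ} (hη : 0 < η)
    (hA : ∀ x ∈ A, ∀ θ ∈ Icc (0 : ℝ) 1, x + θ • h ∈ innerCore ω η) :
    ∫⁻ x in A, ‖u (x + h) - u x‖ₑ ^ 2 ≤ (M * ENNReal.ofReal ‖h‖) ^ 2 := by
  -- Steps of length at most `η / 4` make `hT` applicable on the core at `η`. The factor `N ^ 2`
  -- cancels because the bound is linear in the step length, so `η` does not enter the result.
  obtain ⟨N, hN⟩ := exists_nat_gt (4 * ‖h‖ / η)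
  have hN0 : (0 : ℝ) < N := lt_of_le_of_lt (by positivity) hN
  set g : EuclideanSpace ℝ (Fin m) := (N : ℝ)⁻¹ • h with hg
  have hNg : N • g = h := by
    rw [← Nat.cast_smul_eq_nsmul ℝ, hg, smul_smul, mul_inv_cancel₀ hN0.ne', one_smul]
  have hgn : ‖h‖ = N * ‖g‖ := by rw [← hNg, ← Nat.cast_smul_eq_nsmul ℝ, norm_smul]; simp
  have hgη : ‖g‖ ≤ η / 4 := by
    rw [div_lt_iff₀ hη, hgn] at hN
    nlinarith
  have hchain := setLIntegral_enorm_sub_sq_chain_le (volume : Measure (EuclideanSpace ℝ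
      (Fin m))) hu (A := A)
    (B := innerCore ω (4 * (η / 4))) N g ?_
  · rw [hNg] at hchain
    refine hchain.trans ?_
    calc _ ≤ (N : ℝ≥0∞) ^ 2 * (M * ENNReal.ofReal ‖g‖) ^ 2 := by
          gcongr
          exact hT (η / 4) (by positivity) g hgη
      _ = _ := by
          rw [hgn, ENNReal.ofReal_mul hN0.le, ENNReal.ofReal_natCast, ← mul_pow]
          ring
  · intro x hx i hi
    rw [mul_div_cancel₀ _ (by norm_num)]
    have := hA x hx (i / N) ⟨by positivity, div_le_one_of_le₀ (by exact_mod_cast hi.le) hN0.le⟩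
    rwa [← Nat.cast_smul_eq_nsmul ℝ, hg, smul_smul, ← div_eq_mul_inv]

/-- Moving by `t` along `e` raises the point by `t` above the graph. A further displacement of size
`ρ` changes its height by at most `ρ` and the value of `γ` by at most `2 * L * ρ`, which is less
than the gain when `ρ * (2 + 2 * L) < t`. -/
theorem add_smul_mem_innerCore_of_graph {e : EuclideanSpace ℝ (Fin m)} {L : ℝ≥0}
    {γ : EuclideanSpace ℝ (Fin m) → ℝ} {r : ℝ} {x₀ : EuclideanSpace ℝ (Fin m)}
    (he : ‖e‖ = 1) (hγ : LipschitzWith L γ)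
    (hg : ∀ y ∈ Metric.ball x₀ r, (y ∈ ω ↔ γ (y - (inner ℝ e y) • e) < inner ℝ e y))
    {y : EuclideanSpace ℝ (Fin m)} (hyω : y ∈ ω) (hy : y ∈ Metric.ball x₀ (r / 4)) {t : ℝ}
        (ht0 : 0 ≤ t)
    (htr : t ≤ r / 2) : y + t • e ∈ innerCore ω (t / (2 + 2 * L)) := by
  rw [mem_innerCore_iff]
  intro z hz
  have hL := L.coe_nonneg
  rw [Metric.mem_ball] at hy hz
  rw [lt_div_iff₀ (by positivity)] at hz
  set ρ := dist z (y + t • e) with hρ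
  have hρ0 : 0 ≤ ρ := dist_nonneg
  have hρt : ρ * 2 ≤ t := by nlinarith
  have hty : dist (y + t • e) y = t := by
    rw [dist_self_add_left, norm_smul, he, mul_one, Real.norm_of_nonneg ht0]
  have hee : inner ℝ e e = (1 : ℝ) := by rw [real_inner_self_eq_norm_sq, he, one_pow]
  have hr : 0 < r := by linarith [dist_nonneg (x := y) (y := x₀)]
  have hz_ball : z ∈ Metric.ball x₀ r := by
    rw [Metric.mem_ball]
    have h1 := dist_triangle z (y + t • e) x₀
    have h2 := dist_triangle (y + t • e) y x₀
    linarith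
  have hy_ball : y ∈ Metric.ball x₀ r := by
    rw [Metric.mem_ball]
    linarith
  rw [hg z hz_ball]
  have hyg := (hg y hy_ball).1 hyω
  set w := z - (y + t • e) with hw
  have hwρ : ‖w‖ = ρ := by rw [hρ, dist_eq_norm]
  have hzw : z = y + t • e + w := by rw [hw]; abel
  have hin : |inner ℝ e w| ≤ ρ := by
    have := abs_real_inner_le_norm e w
    rwa [he, one_mul, hwρ] at this
  have hinz : inner ℝ e z = inner ℝ e y + t + inner ℝ e w := by
    rw [hzw, inner_add_right, inner_add_right, inner_smul_right, hee, mul_one]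
  have hproj : (z - (inner ℝ e z) • e) - (y - (inner ℝ e y) • e) = w - (inner ℝ e w) • e := by
    rw [hinz, hzw]
    module
  have hpn : ‖w - (inner ℝ e w) • e‖ ≤ 2 * ρ := by
    refine (norm_sub_le _ _).trans ?_
    rw [norm_smul, he, mul_one, hwρ, Real.norm_eq_abs]
    linarith
  have hγ' : γ (z - (inner ℝ e z) • e) ≤ γ (y - (inner ℝ e y) • e) + L * (2 * ρ) := by
    have h1 := hγ.dist_le_mul (z - (inner ℝ e z) • e) (y - (inner ℝ e y) • e)
    rw [Real.dist_eq, dist_eq_norm, hproj] at h1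
    have h2 := le_abs_self (γ (z - (inner ℝ e z) • e) - γ (y - (inner ℝ e y) • e))
    have h3 : L * ‖w - (inner ℝ e w) • e‖ ≤ L * (2 * ρ) := by gcongr
    linarith
  have h1 := (abs_le.1 hin).1
  have h2 : ρ * (2 + 2 * L) = 2 * ρ + L * (2 * ρ) := by ring
  rw [h2] at hz
  linarith

/-- Compare `u x` with `u (x + T)`, where `T` points inward: `x + T` lies in a fixed core and the
difference is controlled by the translation estimate. That estimate needs segments at positive
distance from the boundary, so the set is first shifted by `σ k • e`. The bounds are independent of
`k`, and Fatou's lemma removes the shift. -/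
theorem lintegral_sq_ne_top_near_frontier (hωo : IsOpen ω) (hu : Measurable u)
    (hT : ∀ δ > 0, ∀ h : EuclideanSpace ℝ (Fin m), ‖h‖ ≤ δ →
      ∫⁻ x in innerCore ω (4 * δ), ‖u (x + h) - u x‖ₑ ^ 2 ≤ (M * ENNReal.ofReal ‖h‖) ^ 2)
    (hL : ∀ δ > 0, ∫⁻ x in innerCore ω δ, ‖u x‖ₑ ^ 2 ≠ ∞)
    {e : EuclideanSpace ℝ (Fin m)} {L : ℝ≥0} {γ : EuclideanSpace ℝ (Fin m) → ℝ} {r : ℝ}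
        {x₀ : EuclideanSpace ℝ (Fin m)} (hr : 0 < r)
    (he : ‖e‖ = 1) (hγ : LipschitzWith L γ)
    (hg : ∀ y ∈ Metric.ball x₀ r, (y ∈ ω ↔ γ (y - (inner ℝ e y) • e) < inner ℝ e y)) :
    ∫⁻ x in ω ∩ Metric.ball x₀ (r / 4), ‖u x‖ₑ ^ 2 ≠ ∞ := by
  set A := ω ∩ Metric.ball x₀ (r / 4) with hA
  have hAo : IsOpen A := hωo.inter Metric.isOpen_ball
  set c : ℝ := (2 + 2 * L)⁻¹ with hc
  have hc0 : 0 < c := by positivity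
  have hcore : ∀ y ∈ A, ∀ t, 0 ≤ t → t ≤ r / 2 → y + t • e ∈ innerCore ω (t * c) :=
    fun y hy t ht0 htr => by
      have := add_smul_mem_innerCore_of_graph he hγ hg hy.1 hy.2 ht0 htr
      rwa [div_eq_mul_inv] at this
  set T : EuclideanSpace ℝ (Fin m) := (r / 4) • e with hTdef
  set C : ℝ≥0∞ := 2 * (∫⁻ x in innerCore ω (r / 4 * c), ‖u x‖ₑ ^ 2) +
    2 * (M * ENNReal.ofReal ‖T‖) ^ 2 with hC
  have hCt : C ≠ ∞ := ENNReal.add_ne_top.2 ⟨ENNReal.mul_ne_top ENNReal.ofNat_ne_top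
    (hL _ (by positivity)), ENNReal.mul_ne_top ENNReal.ofNat_ne_top (ENNReal.pow_ne_top
    (ENNReal.mul_ne_top ENNReal.coe_ne_top ENNReal.ofReal_ne_top))⟩
  have hsq : Measurable fun x => ‖u x‖ₑ ^ 2 := hu.enorm.pow_const 2
  set σ : ℕ → ℝ := fun k => r / 4 * (1 / ((k : ℝ) + 1)) with hσ
  have hσ0 : ∀ k, 0 < σ k := fun k => by simp only [hσ]; positivity
  have hσ1 : ∀ k, σ k ≤ r / 4 := fun k => by
    simp only [hσ]
    refine mul_le_of_le_one_right (by positivity) ?_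
    rw [div_le_one (by positivity)]
    linarith [k.cast_nonneg (α := ℝ)]
  set B : ℕ → Set (EuclideanSpace ℝ (Fin m)) := fun k => (fun x => x - σ k • e) ⁻¹' A with hB
  have hBo : ∀ k, IsOpen (B k) := fun k => hAo.preimage (continuous_sub_right _)
  have hBle : ∀ k, ∫⁻ x in B k, ‖u x‖ₑ ^ 2 ≤ C := by
    intro k
    have hBmem : ∀ x ∈ B k, ∀ θ ∈ Icc (0 : ℝ) 1,
        x + θ • T ∈ innerCore ω ((σ k + θ * (r / 4)) * c) := by
      intro x hx θ hθ
      have h1 := hcore _ hx (σ k + θ * (r / 4)) (by have := hσ0 k; have := hθ.1; positivity)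
        (by nlinarith [hσ1 k, hθ.2])
      have h2 : x + θ • T = x - σ k • e + (σ k + θ * (r / 4)) • e := by
        rw [hTdef]
        module
      rwa [h2]
    have h1 := lintegral_translate_le_of_segment hu hT (A := B k) (h := T) (η := σ k * c)
      (mul_pos (hσ0 k) hc0) fun x hx θ hθ => innerCore_anti (by
        have := mul_nonneg (mul_nonneg hθ.1 (show 0 ≤ r / 4 by positivity)) hc0.le
        nlinarith) (hBmem x hx θ hθ)
    have h2 : ∫⁻ x in B k, ‖u (x + T)‖ₑ ^ 2 ≤ ∫⁻ x in innerCore ω (r / 4 * c), ‖u x‖ₑ ^ 2 := by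
      refine setLIntegral_add_right_le (volume : Measure (EuclideanSpace ℝ (Fin m)))
          (F := fun x => ‖u x‖ₑ ^ 2)
        fun x hx => ?_
      have := hBmem x hx 1 ⟨zero_le_one, le_rfl⟩
      rw [one_smul] at this
      refine innerCore_anti ?_ this
      have := mul_pos (hσ0 k) hc0
      nlinarith
    calc ∫⁻ x in B k, ‖u x‖ₑ ^ 2
        ≤ ∫⁻ x in B k, (2 * ‖u (x + T)‖ₑ ^ 2 + 2 * ‖u (x + T) - u x‖ₑ ^ 2) := by
          refine lintegral_mono fun x => ?_
          have := enorm_add_sq_le (u (x + T)) (u x - u (x + T))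
          rw [add_sub_cancel] at this
          simpa only [enorm_sq_eq_ofReal, sub_sq_comm (u x)] using this
      _ = 2 * (∫⁻ x in B k, ‖u (x + T)‖ₑ ^ 2) +
          2 * ∫⁻ x in B k, ‖u (x + T) - u x‖ₑ ^ 2 := by
          have h3 : Measurable fun x => ‖u (x + T)‖ₑ ^ 2 := hsq.comp (measurable_add_const T)
          rw [lintegral_add_left (h3.const_mul 2), lintegral_const_mul' 2 _ ENNReal.ofNat_ne_top,
            lintegral_const_mul' 2 _ ENNReal.ofNat_ne_top]
      _ ≤ C := add_le_add (mul_le_mul' le_rfl h2) (mul_le_mul' le_rfl h1)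
  have hσt : Tendsto σ atTop (𝓝 0) := by
    have := (tendsto_one_div_add_atTop_nhds_zero_nat (𝕜 := ℝ)).const_mul (r / 4)
    simpa [hσ] using this
  have hfatou : ∫⁻ x in A, ‖u x‖ₑ ^ 2 ≤ C := by
    calc ∫⁻ x in A, ‖u x‖ₑ ^ 2 = ∫⁻ x, A.indicator (fun x => ‖u x‖ₑ ^ 2) x :=
          (lintegral_indicator hAo.measurableSet _).symm
      _ ≤ ∫⁻ x, liminf (fun k => (B k).indicator (fun x => ‖u x‖ₑ ^ 2) x) atTop := by
          refine lintegral_mono fun x => ?_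
          by_cases hx : x ∈ A
          · refine le_liminf_of_le (by isBoundedDefault) ?_
            -- As `A` is open, each of its points belongs to `B k` for all large `k`.
            have h1 : Tendsto (fun k => x - σ k • e) atTop (𝓝 x) := by
              simpa using (hσt.smul_const e).const_sub x
            filter_upwards [h1.eventually (hAo.mem_nhds hx)] with k hk
            rw [indicator_of_mem hx, indicator_of_mem (show x ∈ B k from hk)]
          · rw [indicator_of_notMem hx]
            exact zero_le
      _ ≤ liminf (fun k => ∫⁻ x, (B k).indicator (fun x => ‖u x‖ₑ ^ 2) x) atTop :=
          lintegral_liminf_le fun k => hsq.indicator (hBo k).measurableSet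
      _ ≤ C := by
          refine liminf_le_of_le (by isBoundedDefault) fun b hb => ?_
          obtain ⟨k, hk⟩ := hb.exists
          rw [lintegral_indicator (hBo k).measurableSet] at hk
          exact hk.trans (hBle k)
  exact ne_top_of_le_ne_top hCt hfatou

/-- A function with the translation estimate on a Lipschitz domain is globally in `L²`. -/
theorem lintegral_sq_ne_top_of_lipschitz (hωo : IsOpen ω) (hωb : Bornology.IsBounded ω)
    (hlip : HasLipschitzBoundary ω) (hu : Measurable u)
    (hT : ∀ δ > 0, ∀ h : EuclideanSpace ℝ (Fin m), ‖h‖ ≤ δ →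
      ∫⁻ x in innerCore ω (4 * δ), ‖u (x + h) - u x‖ₑ ^ 2 ≤ (M * ENNReal.ofReal ‖h‖) ^ 2)
    (hL : ∀ δ > 0, ∫⁻ x in innerCore ω δ, ‖u x‖ₑ ^ 2 ≠ ∞) :
    ∫⁻ x in ω, ‖u x‖ₑ ^ 2 ≠ ∞ := by
  have hcomp : IsCompact (closure ω) := hωb.isCompact_closure
  have key := hcomp.induction_on (p := fun s => ∫⁻ x in ω ∩ s, ‖u x‖ₑ ^ 2 ≠ ∞) (by simp)
    (fun s t hst ht => ne_top_of_le_ne_top ht (lintegral_mono_set (inter_subset_inter_right _ hst)))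
    (fun s t hs ht => by
      rw [inter_union_distrib_left]
      exact ne_top_of_le_ne_top (ENNReal.add_ne_top.2 ⟨hs, ht⟩) (lintegral_union_le _ _ _))
    (fun x hx => ?_)
  · rwa [inter_eq_self_of_subset_left subset_closure] at key
  by_cases hxω : x ∈ ω
  · obtain ⟨R, hR, hball⟩ := Metric.isOpen_iff.1 hωo x hxω
    refine ⟨Metric.ball x (R / 2), mem_nhdsWithin_of_mem_nhds
      (Metric.ball_mem_nhds x (by positivity)),
      ne_top_of_le_ne_top (hL (R / 2) (by positivity)) (lintegral_mono_set ?_)⟩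
    rintro y ⟨-, hy⟩
    rw [Metric.mem_ball] at hy
    exact mem_innerCore_of_dist (mem_innerCore_iff.2 hball) (by linarith)
  · obtain ⟨e, L, γ, r, he, hγ, hr, hg⟩ := hlip x (by
      rw [hωo.frontier_eq]
      exact ⟨hx, hxω⟩)
    exact ⟨Metric.ball x (r / 4), mem_nhdsWithin_of_mem_nhds
      (Metric.ball_mem_nhds x (by positivity)),
      lintegral_sq_ne_top_near_frontier hωo hu hT hL hr he hγ hg⟩

end Boundary

/-! ### Weak derivatives by duality. -/

/-- A functional on `V` dominated by the seminorm `‖J ·‖` is represented by an element of the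
Hilbert space `H`. -/
theorem exists_inner_eq_of_abs_le {V H : Type*} [AddCommGroup V] [Module ℝ V]
    [NormedAddCommGroup H] [InnerProductSpace ℝ H] [CompleteSpace H] (J : V →ₗ[ℝ] H)
    (ℓ : V →ₗ[ℝ] ℝ) (C : ℝ) (h : ∀ v, |ℓ v| ≤ C * ‖J v‖) :
    ∃ g : H, ∀ v, ℓ v = inner ℝ g (J v) := by
  -- `J` need not be injective: `ℓ` vanishes on its kernel, so any linear section defines the
  -- functional on the range. Hahn–Banach extends it to `H`, and Riesz represents it.
  obtain ⟨σ, hσ⟩ := LinearMap.exists_rightInverse_of_surjective J.rangeRestrict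
    (LinearMap.range_eq_top.2 J.surjective_rangeRestrict)
  have hσ' : ∀ w : LinearMap.range J, J (σ w) = w := fun w => by
    have := LinearMap.congr_fun hσ w
    exact congrArg Subtype.val this
  let F : LinearMap.range J →L[ℝ] ℝ := (ℓ ∘ₗ σ).mkContinuous C fun w => by
    have := h (σ w)
    rwa [hσ'] at this
  obtain ⟨G, hG, -⟩ := exists_extension_norm_eq (LinearMap.range J) F
  refine ⟨(InnerProductSpace.toDual ℝ H).symm G, fun v => ?_⟩
  rw [InnerProductSpace.toDual_symm_apply]
  have h1 := hG ⟨J v, v, rfl⟩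
  have h2 := h (v - σ ⟨J v, v, rfl⟩)
  rw [map_sub, map_sub, hσ'] at h2
  simp only [sub_self, norm_zero, mul_zero] at h2
  rw [h1]
  exact sub_eq_zero.1 (abs_nonpos_iff.1 h2)

theorem enorm_integral_mul_le {α : Type*} [MeasurableSpace α] {μ : Measure α} {a b : α → ℝ}
    (ha : AEStronglyMeasurable a μ) (hb : AEStronglyMeasurable b μ) :
    ‖∫ x, a x * b x ∂μ‖ₑ ≤ eLpNorm a 2 μ * eLpNorm b 2 μ := by
  refine (enorm_integral_le_lintegral_enorm _).trans ?_
  have := eLpNorm_smul_le_mul_eLpNorm (p := 2) (q := 2) (r := 1) hb ha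
  rwa [eLpNorm_one_eq_lintegral_enorm] at this

section WeakDerivative

variable {m : ℕ} {ω : Set (EuclideanSpace ℝ (Fin m))}

variable {u : EuclideanSpace ℝ (Fin m) → ℝ} {M : ℝ≥0}

theorem hasDerivAt_integral_mul_translate {w φ : EuclideanSpace ℝ (Fin m) → ℝ} (hw : Integrable w)
    (hφ : ContDiff ℝ (⊤ : ℕ∞) φ) (hφc : HasCompactSupport φ) (e : EuclideanSpace ℝ (Fin m)) :
    HasDerivAt (fun l : ℝ => ∫ x, w x * φ (x - l • e)) (-∫ x, w x * fderiv ℝ φ x e) 0 := by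
  have hcont : Continuous fun x => fderiv ℝ φ x e :=
    (hφ.continuous_fderiv (by simp)).clm_apply continuous_const
  obtain ⟨C, hC⟩ := (hφc.fderiv_apply ℝ e).exists_bound_of_continuous hcont
  obtain ⟨C₀, hC₀⟩ := hφc.exists_bound_of_continuous hφ.continuous
  have hd : ∀ x : EuclideanSpace ℝ (Fin m), ∀ l : ℝ, HasDerivAt (fun l : ℝ => w x * φ (x - l • e))
      (w x * -fderiv ℝ φ (x - l • e) e) l := by
    intro x l
    have h1 : HasDerivAt (fun l : ℝ => x - l • e) (-e) l := by
      simpa using ((hasDerivAt_id l).smul_const e).const_sub x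
    have h2 := ((hφ.differentiable (by simp)) (x - l • e)).hasFDerivAt.comp_hasDerivAt l h1
    rw [map_neg] at h2
    exact h2.const_mul _
  have hmain := hasDerivAt_integral_of_dominated_loc_of_deriv_le (μ := (volume : Measure
      (EuclideanSpace ℝ (Fin m))))
    (F := fun (l : ℝ) x => w x * φ (x - l • e))
    (F' := fun (l : ℝ) x => w x * -fderiv ℝ φ (x - l • e) e) (x₀ := 0)
    (bound := fun x => ‖w x‖ * C) (s := univ) univ_mem
    (Eventually.of_forall fun l => hw.1.mul
      (hφ.continuous.comp (continuous_sub_right _)).aestronglyMeasurable)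
    ((hw.mul_bdd (c := C₀) (hφ.continuous.comp (continuous_sub_right _)).aestronglyMeasurable
      (ae_of_all _ fun x => hC₀ _)))
    (hw.1.mul (hcont.comp (continuous_sub_right _)).neg.aestronglyMeasurable)
    (ae_of_all _ fun x l _ => by
      rw [norm_mul, norm_neg]
      exact mul_le_mul_of_nonneg_left (hC _) (norm_nonneg _))
    (hw.norm.mul_const C)
    (ae_of_all _ fun x l _ => hd x l)
  have h3 := hmain.2
  simpa [integral_neg] using h3

/-- A discrete integration by parts moves the difference quotient from `φ` to `u`. Cauchy–Schwarz
and the translation estimate bound it by `M * |l|` times the norm of `φ`, and this bound passes to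
the derivative at `l = 0`. -/
theorem abs_integral_mul_fderiv_le (hωb : Bornology.IsBounded ω) (hωo : IsOpen ω)
    (hu : Measurable u) (huL : MemLp u 2 (volume.restrict ω))
    (hT : ∀ δ > 0, ∀ h : EuclideanSpace ℝ (Fin m), ‖h‖ ≤ δ →
      eLpNorm (fun x => u (x + h) - u x) 2 (volume.restrict (innerCore ω (4 * δ))) ≤
        M * ENNReal.ofReal ‖h‖)
    {φ : EuclideanSpace ℝ (Fin m) → ℝ} (hφ : ContDiff ℝ (⊤ : ℕ∞) φ) (hφc : HasCompactSupport φ)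
        (hφω : tsupport φ ⊆ ω)
    {e : EuclideanSpace ℝ (Fin m)} (he : ‖e‖ = 1) :
    |∫ x in ω, u x * fderiv ℝ φ x e| ≤ M * (eLpNorm φ 2 (volume.restrict ω)).toReal := by
  have : IsFiniteMeasure (volume.restrict ω) := ⟨by simpa using hωb.measure_lt_top⟩
  obtain ⟨ρ, hρ, hKρ⟩ := IsCompact.exists_subset_innerCore hφc hωo hφω
  set δ := ρ / 4 with hδdef
  have hδ : 0 < δ := by positivity
  have hρδ : 4 * δ = ρ := by rw [hδdef]; ring
  set w : EuclideanSpace ℝ (Fin m) → ℝ := ω.indicator u with hw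
  have hwi : Integrable w := (integrable_indicator_iff hωo.measurableSet).2
    (huL.integrable (by norm_num))
  have hφL : MemLp φ 2 (volume.restrict ω) := hφ.continuous.memLp_of_hasCompactSupport hφc
  have hF := hasDerivAt_integral_mul_translate hwi hφ hφc e
  have heq : ∫ x, w x * fderiv ℝ φ x e = ∫ x in ω, u x * fderiv ℝ φ x e := by
    rw [← integral_indicator hωo.measurableSet]
    refine integral_congr_ae (ae_of_all _ fun x => ?_)
    by_cases hx : x ∈ ω <;> simp [hw, hx]
  have hbound : ‖-∫ x, w x * fderiv ℝ φ x e‖ ≤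
      M * (eLpNorm φ 2 (volume.restrict ω)).toReal := by
    refine hF.le_of_lip' (by positivity) ?_
    filter_upwards [Metric.ball_mem_nhds (0 : ℝ) hδ] with l hl
    rw [mem_ball_zero_iff, Real.norm_eq_abs] at hl
    have hle : ‖l • e‖ = |l| := by rw [norm_smul, he, mul_one, Real.norm_eq_abs]
    have hφl : Continuous fun x => φ (x - l • e) := hφ.continuous.comp (continuous_sub_right _)
    obtain ⟨C₀, hC₀⟩ := hφc.exists_bound_of_continuous hφ.continuous
    have hi1 : Integrable fun x => w (x + l • e) * φ x :=
      (hwi.comp_add_right (l • e)).mul_bdd (c := C₀) hφ.continuous.aestronglyMeasurable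
        (ae_of_all _ hC₀)
    have hi2 : Integrable fun x => w x * φ x :=
      hwi.mul_bdd (c := C₀) hφ.continuous.aestronglyMeasurable (ae_of_all _ hC₀)
    have h1 : ∫ x, w x * φ (x - l • e) = ∫ x, w (x + l • e) * φ x := by
      rw [← integral_add_right_eq_self _ (l • e)]
      simp
    -- Only the core carrying the support of `φ` contributes. There both `x` and `x + l • e` lie in
    -- `ω`, so the extension of `u` by zero is not seen.
    have h2 : (∫ x, w x * φ (x - l • e)) - ∫ x, w x * φ (x - (0 : ℝ) • e) =
        ∫ x in innerCore ω (4 * δ), (u (x + l • e) - u x) * φ x := by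
      simp only [zero_smul, sub_zero]
      rw [h1, ← integral_sub hi1 hi2, ← integral_indicator (measurableSet_innerCore _)]
      refine integral_congr_ae (ae_of_all _ fun x => ?_)
      by_cases hx : x ∈ innerCore ω (4 * δ)
      · have hxω : x ∈ ω := innerCore_subset (by positivity) hx
        have hxl : x + l • e ∈ ω := mem_innerCore_iff.1 hx (by
          rw [Metric.mem_ball, dist_self_add_left, hle]
          linarith)
        rw [indicator_of_mem hx]
        simp only [hw, indicator_of_mem hxω, indicator_of_mem hxl, sub_mul]
      · have hφx : φ x = 0 := by
          by_contra hne
          exact hx (hρδ ▸ hKρ (subset_tsupport φ hne))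
        rw [indicator_of_notMem hx]
        simp [hφx]
    rw [h2]
    set μ := volume.restrict (innerCore ω (4 * δ)) with hμ
    have hμω : μ ≤ volume.restrict ω :=
      Measure.restrict_mono (innerCore_subset (by positivity)) le_rfl
    have hms : Measurable fun x => u (x + l • e) - u x :=
      (hu.comp (measurable_add_const _)).sub hu
    have h3 : ‖∫ x in innerCore ω (4 * δ), (u (x + l • e) - u x) * φ x‖ₑ ≤
        M * ENNReal.ofReal |l| * eLpNorm φ 2 (volume.restrict ω) := by
      refine (enorm_integral_mul_le hms.aestronglyMeasurable
        hφ.continuous.aestronglyMeasurable).trans ?_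
      rw [← hle]
      exact mul_le_mul' (hT δ hδ (l • e) (by rw [hle]; exact hl.le)) (eLpNorm_mono_measure _ hμω)
    have h4 := ENNReal.toReal_mono (ENNReal.mul_ne_top (ENNReal.mul_ne_top ENNReal.coe_ne_top
      ENNReal.ofReal_ne_top) hφL.2.ne) h3
    rw [toReal_enorm, ENNReal.toReal_mul, ENNReal.toReal_mul, ENNReal.coe_toReal,
      ENNReal.toReal_ofReal (abs_nonneg _)] at h4
    rw [sub_zero, Real.norm_eq_abs l]
    linarith
  rw [norm_neg, heq] at hbound
  exact hbound

/-- The smooth functions with compact support in `ω`. -/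
def testFunctions (ω : Set (EuclideanSpace ℝ (Fin m))) : Submodule ℝ (EuclideanSpace ℝ
    (Fin m) → ℝ) where
  carrier := {φ | ContDiff ℝ (⊤ : ℕ∞) φ ∧ HasCompactSupport φ ∧ tsupport φ ⊆ ω}
  add_mem' := fun {φ ψ} hφ hψ => ⟨hφ.1.add hψ.1, hφ.2.1.add hψ.2.1,
    (tsupport_add φ ψ).trans (union_subset hφ.2.2 hψ.2.2)⟩
  zero_mem' := ⟨contDiff_const, HasCompactSupport.zero, by simp [tsupport]⟩
  smul_mem' := fun c φ hφ => ⟨contDiff_const.smul hφ.1, hφ.2.1.smul_left (f := fun _ => c),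
    (closure_mono (Function.support_const_smul_subset c φ)).trans hφ.2.2⟩

theorem exists_hasWeakPartialDeriv (hωb : Bornology.IsBounded ω) (hωo : IsOpen ω)
    (hu : Measurable u) (huL : MemLp u 2 (volume.restrict ω))
    (hT : ∀ δ > 0, ∀ h : EuclideanSpace ℝ (Fin m), ‖h‖ ≤ δ →
      eLpNorm (fun x => u (x + h) - u x) 2 (volume.restrict (innerCore ω (4 * δ))) ≤
        M * ENNReal.ofReal ‖h‖) (i : Fin m) :
    ∃ g : EuclideanSpace ℝ (Fin m) → ℝ, MemLp g 2
        (volume.restrict ω) ∧ HasWeakPartialDeriv ω i u g := by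
  set e : EuclideanSpace ℝ (Fin m) := EuclideanSpace.single i 1 with he
  have hLp : ∀ φ : testFunctions ω, MemLp (φ : EuclideanSpace ℝ (Fin m) → ℝ) 2
      (volume.restrict ω) := fun φ =>
    φ.2.1.continuous.memLp_of_hasCompactSupport φ.2.2.1
  have hdL : ∀ φ : testFunctions ω,
      MemLp (fun x => fderiv ℝ (φ : EuclideanSpace ℝ (Fin m) → ℝ) x e) 2
          (volume.restrict ω) := fun φ =>
    ((φ.2.1.continuous_fderiv (by simp)).clm_apply continuous_const).memLp_of_hasCompactSupport
      (φ.2.2.1.fderiv_apply ℝ e)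
  have hint : ∀ φ : testFunctions ω,
      Integrable (fun x => u x * fderiv ℝ (φ : EuclideanSpace ℝ (Fin m) → ℝ) x e)
          (volume.restrict ω) := fun φ =>
    MemLp.integrable_mul (p := 2) (q := 2) huL (hdL φ)
  have hdiff : ∀ φ : testFunctions ω, Differentiable ℝ (φ : EuclideanSpace ℝ
      (Fin m) → ℝ) := fun φ =>
    φ.2.1.differentiable (by simp)
  let J : testFunctions ω →ₗ[ℝ] Lp ℝ 2 (volume.restrict ω) :=
    { toFun := fun φ => (hLp φ).toLp
      map_add' := fun φ ψ => MemLp.toLp_add (hLp φ) (hLp ψ)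
      map_smul' := fun c φ => MemLp.toLp_const_smul c (hLp φ) }
  let ℓ : testFunctions ω →ₗ[ℝ] ℝ :=
    { toFun := fun φ => ∫ x in ω, u x * fderiv ℝ (φ : EuclideanSpace ℝ (Fin m) → ℝ) x e
      map_add' := fun φ ψ => by
        rw [← integral_add (hint φ) (hint ψ)]
        refine integral_congr_ae (ae_of_all _ fun x => ?_)
        simp only [Submodule.coe_add]
        rw [fderiv_add (hdiff φ x) (hdiff ψ x), add_apply, mul_add]
      map_smul' := fun c φ => by
        rw [RingHom.id_apply, smul_eq_mul, ← integral_const_mul]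
        refine integral_congr_ae (ae_of_all _ fun x => ?_)
        simp only [Submodule.coe_smul]
        rw [fderiv_const_smul (hdiff φ x), smul_apply, smul_eq_mul]
        ring }
  obtain ⟨g, hg⟩ := exists_inner_eq_of_abs_le J ℓ M fun φ => by
    have := abs_integral_mul_fderiv_le hωb hωo hu huL hT φ.2.1 φ.2.2.1 φ.2.2.2 (e := e) (by simp
        [he])
    rwa [← Lp.norm_toLp _ (hLp φ)] at this
  refine ⟨fun x => -g x, (Lp.memLp g).neg, fun φ hφ hφc hφω => ?_⟩
  have h1 := hg ⟨φ, hφ, hφc, hφω⟩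
  have h2 : ∫ x in ω, u x * fderiv ℝ φ x e = ∫ x in ω, g x * φ x := by
    refine h1.trans ?_
    rw [L2.inner_def]
    refine integral_congr_ae ?_
    filter_upwards [(hLp ⟨φ, hφ, hφc, hφω⟩).coeFn_toLp] with x hx
    change inner ℝ (g x) (((hLp ⟨φ, hφ, hφc, hφω⟩).toLp _ : EuclideanSpace ℝ (Fin m) → ℝ) x) = _
    rw [hx]
    simp [mul_comm]
  rw [h2]
  simp [integral_neg]

end WeakDerivative

/-! ### Energy estimates for vertical averages. -/

section FilmAverages

variable {E : Type*} [NormedAddCommGroup E] [NormedSpace ℝ E] [FiniteDimensional ℝ E]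
  [MeasureSpace E] [BorelSpace E] [(volume : Measure E).IsAddHaarMeasure]
  {v : E × ℝ → ℝ} {ω : Set E}

/-- The inner domain moves with `z`, so it is encoded as the indicator of a measurable set of pairs.
-/
theorem measurable_lintegral_ball_prod (hv : Measurable v) (r : ℝ) :
    Measurable fun z : E × ℝ => ∫⁻ w in Metric.ball z.1 r ×ˢ Ioo (0 : ℝ) 1, ‖v z - v w‖ₑ ^ 2 := by
  have hF : Measurable fun p : (E × ℝ) × (E × ℝ) => ‖v p.1 - v p.2‖ₑ ^ 2 :=
    (((hv.comp measurable_fst).sub (hv.comp measurable_snd)).enorm).pow_const 2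
  have hS : MeasurableSet {p : (E × ℝ) × (E × ℝ) | dist p.2.1 p.1.1 < r ∧ p.2.2 ∈ Ioo (0 : ℝ) 1} :=
    (measurableSet_lt (f := fun p : (E × ℝ) × (E × ℝ) => dist p.2.1 p.1.1) (by fun_prop)
      measurable_const).inter
      ((by fun_prop : Measurable fun p : (E × ℝ) × (E × ℝ) => p.2.2) measurableSet_Ioo)
  have hm := (hF.indicator hS).lintegral_prod_right' (ν := (volume : Measure (E × ℝ)))
  convert hm using 2 with z
  rw [← lintegral_indicator (Metric.isOpen_ball.measurableSet.prod measurableSet_Ioo)]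
  rfl

omit [NormedSpace ℝ E] [BorelSpace E] [FiniteDimensional ℝ E] in
theorem setLIntegral_prod_Ioo [SFinite (volume : Measure E)] {F : E × ℝ → ℝ≥0∞}
    (hF : Measurable F) (A : Set E) :
    ∫⁻ z in A ×ˢ Ioo (0 : ℝ) 1, F z = ∫⁻ x in A, ∫⁻ t in Ioo (0 : ℝ) 1, F (x, t) := by
  rw [Measure.volume_eq_prod, ← Measure.prod_restrict, lintegral_prod _ hF.aemeasurable]

theorem lintegral_verticalAverage_translate_le (hv : Measurable v) (A : Set E) (r : ℝ) :
    ∫⁻ x in A, ∫⁻ k in Metric.ball 0 r, ‖verticalAverage v (x + k) - verticalAverage v x‖ₑ ^ 2 ≤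
      ∫⁻ z in A ×ˢ Ioo (0 : ℝ) 1, ∫⁻ w in Metric.ball z.1 r ×ˢ Ioo (0 : ℝ) 1,
        ‖v z - v w‖ₑ ^ 2 := by
  rw [setLIntegral_prod_Ioo (measurable_lintegral_ball_prod hv r)]
  refine lintegral_mono fun x => ?_
  rw [lintegral_ball_add (fun y => ‖verticalAverage v y - verticalAverage v x‖ₑ ^ 2) x r]
  exact lintegral_ball_verticalAverage_le hv x r

theorem lintegral_sub_verticalAverage_le (hv : Measurable v) (A : Set E) (r : ℝ) :
    volume (Metric.ball (0 : E) r) *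
        ∫⁻ z in A ×ˢ Ioo (0 : ℝ) 1, ‖v z - verticalAverage v z.1‖ₑ ^ 2 ≤
      4 * ∫⁻ z in A ×ˢ Ioo (0 : ℝ) 1, ∫⁻ w in Metric.ball z.1 r ×ˢ Ioo (0 : ℝ) 1,
        ‖v z - v w‖ₑ ^ 2 := by
  have hm : Measurable fun z : E × ℝ => ‖v z - verticalAverage v z.1‖ₑ ^ 2 :=
    ((hv.sub ((measurable_verticalAverage hv).comp measurable_fst)).enorm).pow_const 2
  rw [setLIntegral_prod_Ioo hm, setLIntegral_prod_Ioo (measurable_lintegral_ball_prod hv r),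
    ← lintegral_const_mul' _ _ measure_ball_lt_top.ne,
    ← lintegral_const_mul' 4 _ ENNReal.ofNat_ne_top]
  refine lintegral_mono fun x => ?_
  rw [← Measure.addHaar_ball_center volume x r]
  exact volume_ball_mul_lintegral_sub_verticalAverage_le hv x r

theorem memLp_verticalAverage (hv : Measurable v)
    (h : ∫⁻ z in ω ×ˢ Ioo (0 : ℝ) 1, ‖v z‖ₑ ^ 2 ≠ ∞) :
    MemLp (verticalAverage v) 2 (volume.restrict ω) := by
  refine memLp_two_of_lintegral_ne_top (measurable_verticalAverage hv).aestronglyMeasurable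
    (ne_top_of_le_ne_top h ?_)
  rw [setLIntegral_prod_Ioo (hv.enorm.pow_const 2)]
  refine lintegral_mono fun x => ?_
  have hx : Measurable fun t => v (x, t) := hv.comp measurable_prodMk_left
  have := enorm_integral_sub_sq_le (μ := volume.restrict (Ioo (0 : ℝ) 1))
    hx.aestronglyMeasurable 0
  simpa [verticalAverage] using this

end FilmAverages

/-! ### Compactness on the rescaled film. -/

section FilmCompactness

variable {E : Type*} [NormedAddCommGroup E] [NormedSpace ℝ E] [FiniteDimensional ℝ E]
  [MeasureSpace E] [BorelSpace E] [(volume : Measure E).IsAddHaarMeasure]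
  {v : ℕ → E × ℝ → ℝ} {ω : Set E} {ε : ℕ → ℝ} {K : ℝ≥0}

theorem exists_translationBound_verticalAverage (hv : ∀ n, Measurable (v n)) (hε0 : ∀ n, 0 < ε n)
    (hε : Tendsto ε atTop (𝓝 0))
    (hK : ∀ n, ∫⁻ z in innerCore ω (2 * ε n) ×ˢ Ioo (0 : ℝ) 1,
      ∫⁻ w in Metric.ball z.1 (ε n) ×ˢ Ioo (0 : ℝ) 1, ‖v n z - v n w‖ₑ ^ 2 ≤
        K * ENNReal.ofReal (ε n ^ (Module.finrank ℝ E + 2))) :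
    ∃ M : ℝ≥0, TranslationBound ω (fun n => verticalAverage (v n)) ε M := by
  set C : ℝ≥0∞ := 16 * 2 ^ Module.finrank ℝ E * K / volume (Metric.ball (0 : E) 1) with hC
  have hCt : C ≠ ∞ := by
    refine ENNReal.div_ne_top ?_ (Metric.measure_ball_pos _ _ one_pos).ne'
    exact ENNReal.mul_ne_top (ENNReal.mul_ne_top (by simp) (by simp)) ENNReal.coe_ne_top
  refine ⟨NNReal.sqrt C.toNNReal, fun δ hδ => ?_⟩
  filter_upwards [hε.eventually_le_const hδ] with n hn h hh
  refine (lintegral_translate_le (measurable_verticalAverage (hv n)) (hε0 n) hn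
    ((lintegral_verticalAverage_translate_le (hv n) _ _).trans (hK n)) hh).trans_eq ?_
  rw [mul_pow, ← ENNReal.coe_pow, NNReal.sq_sqrt, ENNReal.coe_toNNReal hCt]

/-- The energy `O(ε ^ (d + 2))` divided by the volume `ε ^ d` of the ball, up to a constant, leaves
a squared error `O(ε ^ 2)`. -/
theorem tendsto_lintegral_sub_verticalAverage (hv : ∀ n, Measurable (v n)) (hε0 : ∀ n, 0 < ε n)
    (hε : Tendsto ε atTop (𝓝 0))
    (hK : ∀ n, ∫⁻ z in innerCore ω (2 * ε n) ×ˢ Ioo (0 : ℝ) 1,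
      ∫⁻ w in Metric.ball z.1 (ε n) ×ˢ Ioo (0 : ℝ) 1, ‖v n z - v n w‖ₑ ^ 2 ≤
        K * ENNReal.ofReal (ε n ^ (Module.finrank ℝ E + 2))) {δ : ℝ} (hδ : 0 < δ) :
    Tendsto (fun n => eLpNorm (fun z => v n z - verticalAverage (v n) z.1) 2
      (volume.restrict (innerCore ω δ ×ˢ Ioo (0 : ℝ) 1))) atTop (𝓝 0) := by
  have hb0 : volume (Metric.ball (0 : E) 1) ≠ 0 := (Metric.measure_ball_pos _ _ one_pos).ne'
  have hbt : volume (Metric.ball (0 : E) 1) ≠ ∞ := measure_ball_lt_top.ne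
  set b := volume (Metric.ball (0 : E) 1) with hb
  set d := Module.finrank ℝ E
  set C : ℝ≥0∞ := 4 * K / b with hC
  have hCt : C ≠ ∞ := ENNReal.div_ne_top (ENNReal.mul_ne_top (by simp) ENNReal.coe_ne_top) hb0
  have hle : ∀ᶠ n in atTop, eLpNorm (fun z => v n z - verticalAverage (v n) z.1) 2
      (volume.restrict (innerCore ω δ ×ˢ Ioo (0 : ℝ) 1)) ≤
        NNReal.sqrt C.toNNReal * ENNReal.ofReal (ε n) := by
    filter_upwards [hε.eventually_le_const (half_pos hδ)] with n hn
    refine (ENNReal.pow_le_pow_left_iff two_ne_zero).1 ?_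
    rw [eLpNorm_two_sq, mul_pow, ← ENNReal.coe_pow, NNReal.sq_sqrt, ENNReal.coe_toNNReal hCt]
    refine (lintegral_mono_set (prod_mono (innerCore_anti (by linarith)) subset_rfl)).trans
      (b := ∫⁻ z in innerCore ω (2 * ε n) ×ˢ Ioo (0 : ℝ) 1,
        ‖v n z - verticalAverage (v n) z.1‖ₑ ^ 2) ?_
    have h1 := (lintegral_sub_verticalAverage_le (hv n) (innerCore ω (2 * ε n)) (ε n)).trans
      (mul_le_mul' le_rfl (hK n))
    have hball : volume (Metric.ball (0 : E) (ε n)) = ENNReal.ofReal (ε n ^ d) * b :=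
      Measure.addHaar_ball_of_pos _ _ (hε0 n)
    have h2 : (4 : ℝ≥0∞) * (K * ENNReal.ofReal (ε n ^ (d + 2))) =
        ENNReal.ofReal (ε n ^ d) * b * (C * ENNReal.ofReal (ε n) ^ 2) := by
      rw [hC, ENNReal.div_eq_inv_mul, pow_add, ENNReal.ofReal_mul (pow_nonneg (hε0 n).le _),
        ENNReal.ofReal_pow (hε0 n).le 2]
      calc _ = ENNReal.ofReal (ε n ^ d) * 1 * (4 * K * ENNReal.ofReal (ε n) ^ 2) := by ring
        _ = _ := by rw [← ENNReal.mul_inv_cancel hb0 hbt]; ring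
    rw [h2, hball] at h1
    refine (ENNReal.mul_le_mul_iff_right ?_ ?_).1 h1
    · exact mul_ne_zero (by simpa using pow_pos (hε0 n) d) hb0
    · exact ENNReal.mul_ne_top ENNReal.ofReal_ne_top hbt
  have hlim : Tendsto (fun n => (NNReal.sqrt C.toNNReal : ℝ≥0∞) * ENNReal.ofReal (ε n)) atTop
      (𝓝 0) := by
    have := ENNReal.Tendsto.const_mul (a := (NNReal.sqrt C.toNNReal : ℝ≥0∞))
      (ENNReal.tendsto_ofReal hε) (Or.inr ENNReal.coe_ne_top)
    simpa using this
  exact tendsto_of_tendsto_of_tendsto_of_le_of_le' tendsto_const_nhds hlim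
    (Eventually.of_forall fun _ => zero_le) hle

theorem exists_measurable_of_innerCore (hωo : IsOpen ω) {u₀ : E → ℝ}
    (h : ∀ δ > 0, AEStronglyMeasurable u₀ (volume.restrict (innerCore ω δ))) :
    ∃ u : E → ℝ, Measurable u ∧ u₀ =ᵐ[volume.restrict ω] u := by
  have hU : ω = ⋃ k : ℕ, innerCore ω (1 / ((k : ℝ) + 1)) := by
    refine Subset.antisymm (fun x hx => ?_)
      (iUnion_subset fun k => innerCore_subset Nat.one_div_pos_of_nat)
    obtain ⟨r, hr, hxr⟩ := IsCompact.exists_subset_innerCore (isCompact_singleton (x := x)) hωo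
      (singleton_subset_iff.2 hx)
    obtain ⟨k, hk⟩ := exists_nat_one_div_lt hr
    exact mem_iUnion.2 ⟨k, innerCore_anti hk.le (hxr rfl)⟩
  have hu : AEStronglyMeasurable u₀ (volume.restrict ω) := by
    rw [hU]
    exact aestronglyMeasurable_iUnion_iff.2 fun k => h _ Nat.one_div_pos_of_nat
  exact ⟨hu.mk u₀, hu.stronglyMeasurable_mk.measurable, hu.ae_eq_mk⟩

theorem eLpNorm_comp_fst (g : E → ℝ) (hg : AEStronglyMeasurable g (volume.restrict ω)) :
    eLpNorm (fun z : E × ℝ => g z.1) 2 (volume.restrict (ω ×ˢ Ioo (0 : ℝ) 1)) =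
      eLpNorm g 2 (volume.restrict ω) := by
  have hmp : MeasurePreserving (Prod.fst : E × ℝ → E)
      (volume.restrict (ω ×ˢ Ioo (0 : ℝ) 1)) (volume.restrict ω) := by
    rw [Measure.volume_eq_prod, ← Measure.prod_restrict]
    exact measurePreserving_fst
  exact eLpNorm_comp_measurePreserving hg hmp

/-- Compactness is applied to the vertical averages only; the film functions have the same limit
because their distance to the averages tends to zero on every core. -/
theorem exists_film_limit (hv : ∀ n, Measurable (v n)) (hε0 : ∀ n, 0 < ε n)
    (hε : Tendsto ε atTop (𝓝 0)) (hωo : IsOpen ω) (hωb : Bornology.IsBounded ω)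
    (hωc : IsConnected ω) (hvL : ∀ n, ∫⁻ z in ω ×ˢ Ioo (0 : ℝ) 1, ‖v n z‖ₑ ^ 2 ≠ ∞)
    (hK : ∀ n, ∫⁻ z in innerCore ω (2 * ε n) ×ˢ Ioo (0 : ℝ) 1,
      ∫⁻ w in Metric.ball z.1 (ε n) ×ˢ Ioo (0 : ℝ) 1, ‖v n z - v n w‖ₑ ^ 2 ≤
        K * ENNReal.ofReal (ε n ^ (Module.finrank ℝ E + 2))) :
    ∃ u₀ : E → ℝ, Measurable u₀ ∧ ∃ M : ℝ≥0,
      (∀ δ > 0, MemLp u₀ 2 (volume.restrict (innerCore ω δ))) ∧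
      (∀ δ > 0, ∀ h : E, ‖h‖ ≤ δ →
        eLpNorm (fun x => u₀ (x + h) - u₀ x) 2 (volume.restrict (innerCore ω (4 * δ))) ≤
          M * ENNReal.ofReal ‖h‖) ∧
      ∃ (φ : ℕ → ℕ) (c : ℕ → ℝ), StrictMono φ ∧ ∀ δ > 0,
        Tendsto (fun n => eLpNorm (fun z : E × ℝ => v (φ n) z + c n - u₀ z.1) 2
          (volume.restrict (innerCore ω δ ×ˢ Ioo (0 : ℝ) 1))) atTop (𝓝 0) := by
  have hfin : IsFiniteMeasure (volume.restrict ω) := ⟨by simpa using hωb.measure_lt_top⟩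
  have hf : ∀ n, Measurable (verticalAverage (v n)) := fun n => measurable_verticalAverage (hv n)
  obtain ⟨M, hB⟩ := exists_translationBound_verticalAverage hv hε0 hε hK
  obtain ⟨c, hc⟩ := hB.exists_const_eventuallyL2Bounded hf hε hωo hωc
  have hBc := hB.add_const c
  have hfc : ∀ n, Measurable fun x => verticalAverage (v n) x + c n := fun n =>
    (hf n).add_const _
  obtain ⟨φ, hφ, u₁, hu₁⟩ := hBc.exists_subseq_limit hfc
    (fun n => (memLp_verticalAverage (hv n) (hvL n)).add (memLp_const _)) hε hε0 hωb hc
  obtain ⟨u₀, hu₀, huu⟩ := exists_measurable_of_innerCore hωo fun δ hδ => (hu₁ δ hδ).1.1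
  have huδ : ∀ δ > 0, u₁ =ᵐ[volume.restrict (innerCore ω δ)] u₀ := fun δ hδ =>
    ae_restrict_of_ae_restrict_of_subset (innerCore_subset hδ) huu
  have hlim : ∀ δ > 0, MemLp u₀ 2 (volume.restrict (innerCore ω δ)) ∧
      Tendsto (fun n => eLpNorm ((fun x => verticalAverage (v (φ n)) x + c (φ n)) - u₀) 2
        (volume.restrict (innerCore ω δ))) atTop (𝓝 0) := fun δ hδ => by
    refine ⟨(memLp_congr_ae (huδ δ hδ)).1 (hu₁ δ hδ).1, (hu₁ δ hδ).2.congr fun n => ?_⟩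
    exact eLpNorm_congr_ae ((EventuallyEq.refl _ _).sub (huδ δ hδ))
  have hεφ := hε.comp hφ.tendsto_atTop
  refine ⟨u₀, hu₀, M, fun δ hδ => (hlim δ hδ).1, fun δ hδ h hh =>
    (hBc.comp_strictMono hφ).eLpNorm_limit_translate_le (fun n => hfc (φ n)) hεφ hlim hδ hh,
    φ, fun n => c (φ n), hφ, fun δ hδ => ?_⟩
  have h1 := (tendsto_lintegral_sub_verticalAverage hv hε0 hε hK hδ).comp hφ.tendsto_atTop
  have h2 := h1.add (hlim δ hδ).2
  rw [add_zero] at h2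
  refine tendsto_of_tendsto_of_tendsto_of_le_of_le tendsto_const_nhds h2
    (fun _ => zero_le) fun n => ?_
  have hm : Measurable ((fun x => verticalAverage (v (φ n)) x + c (φ n)) - u₀) :=
    (hfc (φ n)).sub hu₀
  simp only [Function.comp_apply]
  rw [← eLpNorm_comp_fst _ hm.aestronglyMeasurable]
  refine le_trans (le_of_eq ?_) (eLpNorm_add_le
    ((hv _).sub ((hf _).comp measurable_fst)).aestronglyMeasurable
    (hm.comp measurable_fst).aestronglyMeasurable one_le_two)
  congr 1
  ext z
  simp only [Pi.add_apply, Pi.sub_apply]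
  ring

end FilmCompactness

theorem gagliardoSq_congr_ae {d : ℕ} (s : ℝ) {U : Set (EuclideanSpace ℝ (Fin d))}
    {u w : EuclideanSpace ℝ (Fin d) → ℝ} (h : u =ᵐ[volume.restrict U] w) :
    gagliardoSq s U u = gagliardoSq s U w := by
  refine lintegral_congr_ae ?_
  filter_upwards [h] with x hx
  refine lintegral_congr_ae ?_
  filter_upwards [h] with y hy
  rw [hx, hy]

/-! ### Transfer between the films and the rescaled domain. -/

section Rescaling

variable {m : ℕ} {ω : Set (EuclideanSpace ℝ (Fin m))}

theorem isBounded_thinFilm (hω : Bornology.IsBounded ω) (ε : ℝ) :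
    Bornology.IsBounded (thinFilm ω ε) := by
  have hK : IsCompact ((fun z : EuclideanSpace ℝ (Fin m) × ℝ => withHeight z.1 z.2) ''
      (closure ω ×ˢ Icc 0 ε)) :=
    (hω.isCompact_closure.prod isCompact_Icc).image continuous_withHeight
  refine hK.isBounded.subset fun x hx => ?_
  exact ⟨(planar x, x (Fin.last m)), ⟨subset_closure hx.1, Ioo_subset_Icc_self hx.2⟩,
    withHeight_planar x⟩

/-- The change of variables formula, applied to the indicator of a null set, shows that vertical
dilation pulls null sets back to null sets. -/
theorem rescale_ae_eq {ε : ℝ} (hε : 0 < ε)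
    {u w : EuclideanSpace ℝ (Fin (m + 1)) → ℝ}
    (h : u =ᵐ[volume.restrict (thinFilm ω ε)] w) :
    rescale ε u =ᵐ[volume.restrict (thinFilm ω 1)] rescale ε w := by
  obtain ⟨N, hN, hNm, hN0⟩ := exists_measurable_superset_of_null h
  have hF : Measurable (N.indicator (1 : EuclideanSpace ℝ (Fin (m + 1)) → ℝ≥0∞)) :=
    measurable_one.indicator hNm
  have hg : Measurable fun x : EuclideanSpace ℝ (Fin (m + 1)) =>
      withHeight (planar x) (ε * x (Fin.last m)) := by
    refine (continuous_withHeight.comp (continuous_planar.prodMk ?_)).measurable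
    exact continuous_const.mul (PiLp.continuous_apply 2 (fun _ : Fin (m + 1) => ℝ) (Fin.last m))
  have h1 : ∫⁻ x in thinFilm ω ε, N.indicator 1 x = 0 := by
    rw [lintegral_indicator_one hNm, hN0]
  rw [lintegral_thinFilm hε, mul_eq_zero, or_iff_right (by simpa using hε)] at h1
  have h2 : ∫⁻ x in thinFilm ω 1,
      N.indicator (1 : EuclideanSpace ℝ (Fin (m + 1)) → ℝ≥0∞)
        (withHeight (planar x) (ε * x (Fin.last m))) = 0 := by
    rw [lintegral_thinFilm one_pos]
    simpa using h1
  filter_upwards [(lintegral_eq_zero_iff (hF.comp hg)).1 h2] with x hx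
  by_contra hne
  have : withHeight (planar x) (ε * x (Fin.last m)) ∈ N := hN hne
  simp [this] at hx

theorem measurePreserving_heightEquiv_thinFilm (A : Set (EuclideanSpace ℝ (Fin m))) :
    MeasurePreserving (heightEquiv m) (volume.restrict (thinFilm A 1))
      (volume.restrict (A ×ˢ Ioo (0 : ℝ) 1)) := by
  rw [thinFilm_eq_preimage]
  exact measurePreserving_heightEquiv.restrict_preimage_emb (heightEquiv m).measurableEmbedding _

theorem volume_thinFilm_lt_top (hω : Bornology.IsBounded ω) (ε : ℝ) :
    volume (thinFilm ω ε) < ∞ :=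
  (isBounded_thinFilm hω ε).measure_lt_top

theorem exists_subset_thinFilm_innerCore (hωo : IsOpen ω)
    {K : Set (EuclideanSpace ℝ (Fin (m + 1)))} {ε : ℝ} (hK : IsCompact K) (hKω : K ⊆ thinFilm ω ε) :
    ∃ δ > 0, K ⊆ thinFilm (innerCore ω δ) ε := by
  obtain ⟨δ, hδ, h⟩ := IsCompact.exists_subset_innerCore (hK.image continuous_planar) hωo
    (image_subset_iff.2 fun x hx => (hKω hx).1)
  exact ⟨δ, hδ, fun x hx => ⟨h (mem_image_of_mem _ hx), (hKω hx).2⟩⟩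

/-- Dimension-reduction convergence follows from `L²` convergence on the inner cores. -/
theorem drConvergesL1Loc_of_tendsto_eLpNorm (hωo : IsOpen ω) (hωb : Bornology.IsBounded ω)
    {ε : ℕ → ℝ} (hε0 : ∀ n, 0 < ε n) {u w : ℕ → EuclideanSpace ℝ (Fin (m + 1)) → ℝ}
    {u₀ : EuclideanSpace ℝ (Fin m) → ℝ} (hw : ∀ n, Measurable (w n)) (hu₀ : Measurable u₀)
    (huw : ∀ n, u n =ᵐ[volume.restrict (thinFilm ω (ε n))] w n)
    (hwL : ∀ n, MemLp (fun z : EuclideanSpace ℝ (Fin m) × ℝ => w n (withHeight z.1 (ε n * z.2))) 2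
      (volume.restrict (ω ×ˢ Ioo (0 : ℝ) 1)))
    (huL : MemLp u₀ 2 (volume.restrict ω))
    (hlim : ∀ δ > 0, Tendsto (fun n =>
      eLpNorm (fun z : EuclideanSpace ℝ (Fin m) × ℝ =>
        w n (withHeight z.1 (ε n * z.2)) - u₀ z.1) 2
        (volume.restrict (innerCore ω δ ×ˢ Ioo (0 : ℝ) 1))) atTop (𝓝 0)) :
    DRConvergesL1Loc ω ε u u₀ := by
  have hfin : IsFiniteMeasure (volume.restrict ω) := ⟨by simpa using hωb.measure_lt_top⟩
  have hfin' : IsFiniteMeasure (volume.restrict (thinFilm ω 1)) :=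
    ⟨by simpa using volume_thinFilm_lt_top hωb 1⟩
  have hae : ∀ n, rescale (ε n) (u n) =ᵐ[volume.restrict (thinFilm ω 1)] rescale (ε n) (w n) :=
    fun n => rescale_ae_eq (hε0 n) (huw n)
  refine ⟨fun n => ?_, ?_, fun K hK hKω => ?_⟩
  · have h1 : MemLp (rescale (ε n) (w n)) 2 (volume.restrict (thinFilm ω 1)) :=
      (hwL n).comp_measurePreserving (measurePreserving_heightEquiv_thinFilm ω)
    have h2 := (memLp_congr_ae (hae n)).2 h1
    exact IntegrableOn.locallyIntegrableOn (h2.integrable one_le_two)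
  · exact IntegrableOn.locallyIntegrableOn (huL.integrable one_le_two)
  · obtain ⟨δ, hδ, hKδ⟩ := exists_subset_thinFilm_innerCore hωo hK hKω
    have hsub : thinFilm (innerCore ω δ) 1 ⊆ thinFilm ω 1 := fun x hx =>
      ⟨innerCore_subset hδ hx.1, hx.2⟩
    set μ := volume.restrict (innerCore ω δ ×ˢ Ioo (0 : ℝ) 1) with hμ
    set g : ℕ → EuclideanSpace ℝ (Fin m) × ℝ → ℝ := fun n z =>
      w n (withHeight z.1 (ε n * z.2)) - u₀ z.1 with hg
    have hgm : ∀ n, Measurable (g n) := fun n => by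
      refine ((hw n).comp ?_).sub (hu₀.comp measurable_fst)
      exact (continuous_withHeight.comp (continuous_fst.prodMk
        (continuous_const.mul continuous_snd))).measurable
    have hμt : μ univ ≠ ∞ := by
      rw [hμ, Measure.restrict_apply_univ, Measure.volume_eq_prod, Measure.prod_prod]
      exact ENNReal.mul_ne_top ((measure_mono (innerCore_subset hδ)).trans_lt
        hωb.measure_lt_top).ne (by simp)
    have hle : ∀ n, ∫⁻ x in K, ‖rescale (ε n) (u n) x - u₀ (planar x)‖ₑ ≤
        eLpNorm (g n) 2 μ * μ univ ^ (1 / (1 : ℝ≥0∞).toReal - 1 / (2 : ℝ≥0∞).toReal) := fun n => by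
      calc _ ≤ ∫⁻ x in thinFilm (innerCore ω δ) 1, ‖rescale (ε n) (u n) x - u₀ (planar x)‖ₑ :=
            lintegral_mono_set hKδ
        _ = ∫⁻ x in thinFilm (innerCore ω δ) 1, ‖g n (heightEquiv m x)‖ₑ := by
            refine lintegral_congr_ae ?_
            filter_upwards [ae_restrict_of_ae_restrict_of_subset hsub (hae n)] with x hx
            rw [hx]
            rfl
        _ = eLpNorm (g n) 1 μ := by
            rw [eLpNorm_one_eq_lintegral_enorm]
            exact (measurePreserving_heightEquiv_thinFilm (innerCore ω δ)).lintegral_comp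
              (hgm n).enorm
        _ ≤ _ := eLpNorm_le_eLpNorm_mul_rpow_measure_univ one_le_two (hgm n).aestronglyMeasurable
    refine tendsto_of_tendsto_of_tendsto_of_le_of_le tendsto_const_nhds ?_
      (fun _ => zero_le) hle
    have := ENNReal.Tendsto.mul_const (hlim δ hδ)
      (b := μ univ ^ (1 / (1 : ℝ≥0∞).toReal - 1 / (2 : ℝ≥0∞).toReal))
      (Or.inr (ENNReal.rpow_ne_top_of_nonneg (by norm_num) hμt))
    simpa using this

theorem lintegral_rescaled_sq_ne_top (hωo : IsOpen ω) (hωb : Bornology.IsBounded ω) {ε s : ℝ}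
    (hε : 0 < ε) (hs : s ∈ Ioo (0 : ℝ) 1) {u : EuclideanSpace ℝ (Fin (m + 1)) → ℝ}
    (hu : Measurable u) {S : ℝ≥0}
    (hS : ENNReal.ofReal ((1 - s) / ε ^ (3 - 2 * s)) * gagliardoSq s (thinFilm ω ε) u ≤ S) :
    ∫⁻ z in ω ×ˢ Ioo (0 : ℝ) 1, ‖u (withHeight z.1 (ε * z.2))‖ₑ ^ 2 ≠ ∞ := by
  have hpos : 0 < (1 - s) / ε ^ (3 - 2 * s) := div_pos (by linarith [hs.2]) (by positivity)
  have hG : gagliardoSq s (thinFilm ω ε) u ≠ ∞ := fun htop => by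
    rw [htop, ENNReal.mul_top (by simpa using hpos)] at hS
    exact ENNReal.coe_ne_top (top_le_iff.1 hS)
  have h1 := lintegral_sq_ne_top_of_gagliardoSq hs.1
    (measurableSet_thinFilm hωo.measurableSet ε) (isBounded_thinFilm hωb ε) hu hG
  rw [lintegral_thinFilm hε] at h1
  exact fun htop => h1 (by rw [htop, ENNReal.mul_top (by simpa using hε)])

end Rescaling

/-! ### The compactness theorem. -/

theorem theorem4p1 (m : ℕ) (hm : 1 ≤ m) (ω : Set (EuclideanSpace ℝ (Fin m)))
    (hω_open : IsOpen ω) (hω_bdd : Bornology.IsBounded ω) (hω_conn : IsConnected ω)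
    (hω_lip : HasLipschitzBoundary ω)
    (ε s : ℕ → ℝ) (s₀ : ℝ)
    (hε_pos : ∀ n, 0 < ε n) (hε : Tendsto ε atTop (𝓝 0))
    (hs_mem : ∀ n, s n ∈ Ioo (0 : ℝ) 1) (hs : Tendsto s atTop (𝓝 s₀)) (hs₀ : 1 / 2 < s₀)
    (u : ℕ → EuclideanSpace ℝ (Fin (m + 1)) → ℝ)
    (hu : ∀ n, AEStronglyMeasurable (u n) (volume.restrict (thinFilm ω (ε n))))
    (S : ℝ≥0)
    (hS : ∀ n, ENNReal.ofReal ((1 - s n) / ε n ^ (3 - 2 * s n)) *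
      gagliardoSq (s n) (thinFilm ω (ε n)) (u n) ≤ S) :
    ∃ u₀ : EuclideanSpace ℝ (Fin m) → ℝ, MemH1 ω u₀ ∧
      ∃ (j : ℕ → ℕ) (c : ℕ → ℝ), StrictMono j ∧
        DRConvergesL1Loc ω (fun k => ε (j k)) (fun k x => u (j k) x + c k) u₀ := by
  -- Energies and limits depend only on almost-everywhere classes, so measurable representatives may
  -- be used.
  set w : ℕ → EuclideanSpace ℝ (Fin (m + 1)) → ℝ := fun n => (hu n).mk (u n) with hw
  have hwm : ∀ n, Measurable (w n) := fun n => (hu n).stronglyMeasurable_mk.measurable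
  have huw : ∀ n, u n =ᵐ[volume.restrict (thinFilm ω (ε n))] w n := fun n => (hu n).ae_eq_mk
  have hwS : ∀ n, ENNReal.ofReal ((1 - s n) / ε n ^ (3 - 2 * s n)) *
      gagliardoSq (s n) (thinFilm ω (ε n)) (w n) ≤ S := fun n => by
    rw [← gagliardoSq_congr_ae _ (huw n)]
    exact hS n
  set v : ℕ → EuclideanSpace ℝ (Fin m) × ℝ → ℝ := fun n z => w n (withHeight z.1 (ε n * z.2))
    with hv
  have hvm : ∀ n, Measurable (v n) := fun n =>
    (hwm n).comp (continuous_withHeight.comp (continuous_fst.prodMk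
      (continuous_const.mul continuous_snd))).measurable
  have hvL : ∀ n, ∫⁻ z in ω ×ˢ Ioo (0 : ℝ) 1, ‖v n z‖ₑ ^ 2 ≠ ∞ := fun n =>
    lintegral_rescaled_sq_ne_top hω_open hω_bdd (hε_pos n) (hs_mem n) (hwm n) (hwS n)
  obtain ⟨u₀, hu₀, M, hL, hT, φ, c, hφ, hlim⟩ := exists_film_limit (v := v) (ω := ω) (ε := ε)
    (K := 6 * 2 ^ (m + 3) * S) hvm hε_pos hε hω_open hω_bdd hω_conn hvL fun n => by
      rw [finrank_euclideanSpace_fin]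
      exact lintegral_rescaled_pairs_le hω_open (hε_pos n) (hs_mem n) (hwm n) (hwS n)
  -- The Lipschitz boundary enters here: the bounds on the cores alone carry no uniformity up to the
  -- boundary.
  have hu₀L : MemLp u₀ 2 (volume.restrict ω) := by
    refine memLp_two_of_lintegral_ne_top hu₀.aestronglyMeasurable
      (lintegral_sq_ne_top_of_lipschitz hω_open hω_bdd hω_lip hu₀ (M := M) (fun δ hδ h hh => ?_)
        fun δ hδ => ?_)
    · rw [← eLpNorm_two_sq]
      exact pow_le_pow_left' (hT δ hδ h hh) 2
    · rw [← eLpNorm_two_sq]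
      exact ENNReal.pow_ne_top (hL δ hδ).2.ne
  have hfin : IsFiniteMeasure (volume.restrict (ω ×ˢ Ioo (0 : ℝ) 1)) := ⟨by
    rw [Measure.restrict_apply_univ]
    exact (hω_bdd.prod (Metric.isBounded_Ioo 0 1)).measure_lt_top⟩
  refine ⟨u₀, ⟨hu₀L, fun i => exists_hasWeakPartialDeriv hω_bdd hω_open hu₀ hu₀L hT i⟩, φ, c, hφ,
    drConvergesL1Loc_of_tendsto_eLpNorm hω_open hω_bdd (fun k => hε_pos _)
      (w := fun k x => w (φ k) x + c k) (fun k => (hwm _).add_const _) hu₀ (fun k => ?_)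
      (fun k => ?_) hu₀L hlim⟩
  · filter_upwards [huw (φ k)] with x hx
    rw [hx]
  · exact (memLp_two_of_lintegral_ne_top (hvm (φ k)).aestronglyMeasurable (hvL (φ k))).add
      (memLp_const (c k))
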